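/- Let $P,Q\in\mathbb R(x)$ have no zeros or poles in $\mathbb N=\{0,1,2,\dots\}$. **Types.** For $(P,Q)\in(\mathbb R(x)\setminus\{0\})^2$ put $\rho(x)=\frac{Q(x)}{P(x)P(x-1)}$, let $d\in\mathbb Z$ be its degree (so $|\rho(x)|=\Theta(x^d)$), and let $s\in\{+,-\}$ be the sign of $\rho(n)$ for all large $n\in\mathbb N$. If $d\le 0$, write $\rho(x)=\alpha_0+\frac{\alpha_1}{x}+\frac{\alpha_2}{x^2}+O(x^{-3})$. * $(P,Q)$ is of *loxodromic type* if $s=+$. * It is of *hyperbolic type* if $s=-$, $d\le 0$ and $(\alpha_0,\alpha_1,\alpha_2)\ge(-\frac14,0,-\frac1{16})$ lexicographically. * If $s=-$, $d\le0$ and it is not of hyperbolic type, then $\alpha_0=-\frac1{4\cos^2\theta\pi}$ for a unique $\theta\in[0,\frac12)$. If $\theta$ is a positive rational number and $\alpha_1=0$, then $(P,Q)$ is of *$\theta$-$O$ elliptic type*; otherwise it is of *$\mathbb Q$-$\Omega$ elliptic type*. * If $s=-$ and $d\in\{1,2\}$, it is of *$\mathbb Q$-$\Omega$ elliptic type*.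 * If $s=-$ and $d>2$, it is of *$\frac12$-$O$ elliptic type*. **Gap-$\tau$ recurrence.** Let $A^{(\tau)},B^{(\tau)}\in\mathbb R(x)$ $(\tau\ge0)$ be the unique rational functions such that $f(n+\tau)=B^{(\tau)}(n)f(n+1)+A^{(\tau)}(n)f(n)$ for all $n\in\mathbb N$ and all real sequences $f$ with $f(n+2)=P(n)f(n+1)+Q(n)f(n)$ for all $n\in\mathbb N$. When $B^{(\tau)}\ne0$ put $$P_\tau=\frac{B^{(2\tau)}}{B^{(\tau)}},\qquad Q_\tau=A^{(2\tau)}-\frac{B^{(2\tau)}}{B^{(\tau)}}A^{(\tau)},$$ the coefficients of the recurrence $f(n+2\tau)=P_\tau(n)f(n+\tau)+Q_\tau(n)f(n)$. **Corollary.** 1. Suppose that $(P,Q)$ is of loxodromic type, and let $\tau=2$; or that $(P,Q)$ is of $\frac kr$-$O$ elliptic type for some coprime positive integers $k,r$, and let $\tau=2r$. Suppose that $B^{(\tau)}\neq0$ and $B^{(2\tau)}\ne0$. Then $P_\tau\ne0$, $Q_\tau\neq0$, and $(P_\tau(\tau x+N),Q_\tau(\tau x+N))$ is of hyperbolic type for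 all $N\in\mathbb N$. 2. Suppose that $(P,Q)$ is of $\mathbb Q$-$\Omega$ elliptic type. Then, for all integers $\tau\ge1$, $B^{(\tau)}\ne0$, $P_\tau\neq0$, $Q_\tau\ne0$, and $(P_\tau(\tau x+N),Q_\tau(\tau x+N))$ is of $\mathbb Q$-$\Omega$ elliptic type for all $N\in\mathbb N$. -/

import Mathlib

open Filter Asymptotics

namespace SecondOrderHolonomic

noncomputable section

/-- The value `R(y)` of a rational function at a real number which is not a pole of it. -/
def value (R : RatFunc ℝ) (y : ℝ) : ℝ := R.eval (RingHom.id ℝ) y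

/-- The rational function `R(a x + b)` (for `a ≠ 0`). -/
def substLin (a b : ℝ) (R : RatFunc ℝ) : RatFunc ℝ :=
  R.eval RatFunc.C (RatFunc.C a * RatFunc.X + RatFunc.C b)

/-- `R` has no poles in `ℕ`. -/
def NoPoleInNat (R : RatFunc ℝ) : Prop := ∀ n : ℕ, R.denom.eval (n : ℝ) ≠ 0

/-- `R` has no zeros in `ℕ`. -/
def NoZeroInNat (R : RatFunc ℝ) : Prop := ∀ n : ℕ, R.num.eval (n : ℝ) ≠ 0

/-- `f` is a `(P, Q)`-holonomic sequence. -/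
def IsHolonomic (P Q : RatFunc ℝ) (f : ℕ → ℝ) : Prop :=
  ∀ n : ℕ, f (n + 2) = value P n * f (n + 1) + value Q n * f n

/-! ### The classification of pairs `(P, Q)` -/

/-- The rational function `Q(x) / (P(x) P(x - 1))`. -/
def normRatio (P Q : RatFunc ℝ) : RatFunc ℝ := Q / (P * substLin 1 (-1) P)

/-- `R` has ultimate sign `(+)`. -/
def UltPos (R : RatFunc ℝ) : Prop := ∀ᶠ n : ℕ in atTop, 0 < value R n

/-- `R` has ultimate sign `(-)`. -/
def UltNeg (R : RatFunc ℝ) : Prop := ∀ᶠ n : ℕ in atTop, value R n < 0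

/-- `R(x) = α₀ + α₁ / x + α₂ / x² + O(x⁻³)` as `x → ∞`. -/
def HasExpansion (R : RatFunc ℝ) (α₀ α₁ α₂ : ℝ) : Prop :=
  (fun x : ℝ => value R x - (α₀ + α₁ / x + α₂ / x ^ 2)) =O[atTop] fun x : ℝ => (x ^ 3)⁻¹

/-- `(α₀, α₁, α₂) ≥ (-1/4, 0, -1/16)` in the lexicographic order. -/
def LexGe (α₀ α₁ α₂ : ℝ) : Prop :=
  -(1 / 4) < α₀ ∨ (α₀ = -(1 / 4) ∧ (0 < α₁ ∨ (α₁ = 0 ∧ -(1 / 16) ≤ α₂)))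

/-- `∞`-`O` loxodromic type. -/
def IsLoxodromicO (P Q : RatFunc ℝ) : Prop :=
  P ≠ 0 ∧ Q ≠ 0 ∧ UltPos (normRatio P Q) ∧ 2 < (normRatio P Q).intDegree

/-- `∞`-`Ω` loxodromic type. -/
def IsLoxodromicOmega (P Q : RatFunc ℝ) : Prop :=
  P ≠ 0 ∧ Q ≠ 0 ∧ UltPos (normRatio P Q) ∧ (normRatio P Q).intDegree ≤ 2

/-- Loxodromic type. -/
def IsLoxodromic (P Q : RatFunc ℝ) : Prop := IsLoxodromicO P Q ∨ IsLoxodromicOmega P Q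

/-- Hyperbolic type. -/
def IsHyperbolic (P Q : RatFunc ℝ) : Prop :=
  P ≠ 0 ∧ Q ≠ 0 ∧ UltNeg (normRatio P Q) ∧ (normRatio P Q).intDegree ≤ 0 ∧
    ∃ α₀ α₁ α₂ : ℝ, HasExpansion (normRatio P Q) α₀ α₁ α₂ ∧ LexGe α₀ α₁ α₂

/-- The ratio has ultimate sign `(-)` and degree at most `0`, the pair is not hyperbolic, the
constant term of the expansion of the ratio is `-1 / (4 cos² θπ)` with `θ ∈ [0, 1/2)`, and the
coefficient of `1 / x` is `α₁`. -/
def IsBoundedElliptic (P Q : RatFunc ℝ) (θ α₁ : ℝ) : Prop :=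
  P ≠ 0 ∧ Q ≠ 0 ∧ UltNeg (normRatio P Q) ∧ (normRatio P Q).intDegree ≤ 0 ∧
    0 ≤ θ ∧ θ < 1 / 2 ∧
    ∃ α₀ α₂ : ℝ, HasExpansion (normRatio P Q) α₀ α₁ α₂ ∧ ¬ LexGe α₀ α₁ α₂ ∧
      α₀ = -(1 / (4 * Real.cos (θ * Real.pi) ^ 2))

/-- `θ`-`O` elliptic type, for a rational number `θ`. -/
def IsEllipticO (P Q : RatFunc ℝ) (θ : ℚ) : Prop :=
  (0 < θ ∧ IsBoundedElliptic P Q (θ : ℝ) 0) ∨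
  (θ = 1 / 2 ∧ P ≠ 0 ∧ Q ≠ 0 ∧ UltNeg (normRatio P Q) ∧ 2 < (normRatio P Q).intDegree)

/-- `ℚ`-`Ω` elliptic type. -/
def IsEllipticOmega (P Q : RatFunc ℝ) : Prop :=
  (P ≠ 0 ∧ Q ≠ 0 ∧ UltNeg (normRatio P Q) ∧
    ((normRatio P Q).intDegree = 1 ∨ (normRatio P Q).intDegree = 2)) ∨
  ∃ θ α₁ : ℝ, IsBoundedElliptic P Q θ α₁ ∧ ¬ ((∃ q : ℚ, 0 < q ∧ θ = (q : ℝ)) ∧ α₁ = 0)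

/-! ### Generalized canonical numerators and denominators -/

/-- The generalized canonical numerators `A^(τ)` of `(P, Q)`. -/
def canonNum (P Q : RatFunc ℝ) : ℕ → RatFunc ℝ
  | 0 => 1
  | 1 => 0
  | t + 2 => substLin 1 t P * canonNum P Q (t + 1) + substLin 1 t Q * canonNum P Q t

/-- The generalized canonical denominators `B^(τ)` of `(P, Q)`. -/
def canonDen (P Q : RatFunc ℝ) : ℕ → RatFunc ℝ
  | 0 => 0
  | 1 => 1
  | t + 2 => substLin 1 t P * canonDen P Q (t + 1) + substLin 1 t Q * canonDen P Q t

/-- `P_τ = B^(2τ) / B^(τ)`. -/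
def gapP (P Q : RatFunc ℝ) (τ : ℕ) : RatFunc ℝ := canonDen P Q (2 * τ) / canonDen P Q τ

/-- `Q_τ = A^(2τ) - (B^(2τ) / B^(τ)) A^(τ)`. -/
def gapQ (P Q : RatFunc ℝ) (τ : ℕ) : RatFunc ℝ :=
  canonNum P Q (2 * τ) - canonDen P Q (2 * τ) / canonDen P Q τ * canonNum P Q τ

/-! ### The definitions above have their intended meaning -/

theorem eval₂_lin (a b : ℝ) (p : Polynomial ℝ) :
    p.eval₂ RatFunc.C (RatFunc.C a * RatFunc.X + RatFunc.C b) =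
      algebraMap (Polynomial ℝ) (RatFunc ℝ)
        (p.comp (Polynomial.C a * Polynomial.X + Polynomial.C b)) := by
  rw [Polynomial.comp, Polynomial.hom_eval₂]
  congr 1
  simp

theorem substLin_spec (a b y : ℝ) (R : RatFunc ℝ) (h : R.denom.eval (a * y + b) ≠ 0) :
    (substLin a b R).denom.eval y ≠ 0 ∧ value (substLin a b R) y = value R (a * y + b) := by
  set L : Polynomial ℝ := Polynomial.C a * Polynomial.X + Polynomial.C b with hL
  have hd : (R.denom.comp L).eval y ≠ 0 := by simpa [hL, Polynomial.eval_comp] using h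
  have hd0 : R.denom.comp L ≠ 0 := fun h0 => hd (by rw [h0]; simp)
  have e : substLin a b R = algebraMap (Polynomial ℝ) (RatFunc ℝ) (R.num.comp L) /
      algebraMap (Polynomial ℝ) (RatFunc ℝ) (R.denom.comp L) := by
    rw [substLin, RatFunc.eval, eval₂_lin, eval₂_lin]
  have hden : (substLin a b R).denom.eval y ≠ 0 := by
    have hdvd : (substLin a b R).denom ∣ R.denom.comp L := by
      rw [e]; exact RatFunc.denom_div_dvd _ _
    exact fun h0 => hd (Polynomial.eval_eq_zero_of_dvd_of_eval_eq_zero hdvd h0)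
  refine ⟨hden, ?_⟩
  have key : (substLin a b R).num * R.denom.comp L = R.num.comp L * (substLin a b R).denom := by
    rw [RatFunc.num_mul_eq_mul_denom_iff hd0]; exact e
  have key2 := congrArg (Polynomial.eval y) key
  simp only [Polynomial.eval_mul] at key2
  have e1 : value (substLin a b R) y =
      (substLin a b R).num.eval y / (substLin a b R).denom.eval y := by
    simp [value, RatFunc.eval, Polynomial.eval₂_id]
  have e2 : value R (a * y + b) = (R.num.comp L).eval y / (R.denom.comp L).eval y := by
    simp [value, RatFunc.eval, Polynomial.eval₂_id, hL, Polynomial.eval_comp]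
  rw [e1, e2, div_eq_div_iff hden hd, key2]

theorem value_mul_add_mul {R S T U : RatFunc ℝ} (y : ℝ) (hR : R.denom.eval y ≠ 0)
    (hS : S.denom.eval y ≠ 0) (hT : T.denom.eval y ≠ 0) (hU : U.denom.eval y ≠ 0) :
    (R * S + T * U).denom.eval y ≠ 0 ∧
      value (R * S + T * U) y = value R y * value S y + value T y * value U y := by
  have hm : ∀ {V W : RatFunc ℝ}, V.denom.eval y ≠ 0 → W.denom.eval y ≠ 0 →
      (V * W).denom.eval y ≠ 0 := fun {V W} hV hW h0 => by
    have := Polynomial.eval_eq_zero_of_dvd_of_eval_eq_zero (RatFunc.denom_mul_dvd V W) h0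
    rw [Polynomial.eval_mul] at this
    exact mul_ne_zero hV hW this
  refine ⟨fun h0 => ?_, ?_⟩
  · have := Polynomial.eval_eq_zero_of_dvd_of_eval_eq_zero
      (RatFunc.denom_add_dvd (R * S) (T * U)) h0
    rw [Polynomial.eval_mul] at this
    exact mul_ne_zero (hm hR hS) (hm hT hU) this
  · unfold value
    rw [RatFunc.eval_add, RatFunc.eval_mul, RatFunc.eval_mul] <;>
      first
        | exact hR | exact hS | exact hT | exact hU
        | exact hm hR hS | exact hm hT hU

/-- `f(n + τ) = B^(τ)(n) f(n + 1) + A^(τ)(n) f(n)` for every `(P, Q)`-holonomic `f`. -/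
theorem canon_spec (P Q : RatFunc ℝ) (hP : NoPoleInNat P) (hQ : NoPoleInNat Q) (τ : ℕ) :
    NoPoleInNat (canonNum P Q τ) ∧ NoPoleInNat (canonDen P Q τ) ∧
      ∀ f : ℕ → ℝ, IsHolonomic P Q f → ∀ n : ℕ,
        f (n + τ) = value (canonDen P Q τ) n * f (n + 1) + value (canonNum P Q τ) n * f n := by
  induction τ using Nat.twoStepInduction with
  | zero => simp [canonNum, canonDen, NoPoleInNat, value]
  | one => simp [canonNum, canonDen, NoPoleInNat, value]
  | more t ih0 ih1 =>
    obtain ⟨a0, b0, r0⟩ := ih0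
    obtain ⟨a1, b1, r1⟩ := ih1
    have sh : ∀ (R : RatFunc ℝ), NoPoleInNat R → ∀ n : ℕ,
        (substLin 1 t R).denom.eval (n : ℝ) ≠ 0 ∧
          value (substLin 1 t R) n = value R ((n + t : ℕ) : ℝ) := fun R hR n => by
      have := substLin_spec 1 t n R (by simpa using hR (n + t))
      simpa using this
    refine ⟨fun n => ?_, fun n => ?_, fun f hf n => ?_⟩
    · exact (value_mul_add_mul (n : ℝ) (sh P hP n).1 (a1 n) (sh Q hQ n).1 (a0 n)).1
    · exact (value_mul_add_mul (n : ℝ) (sh P hP n).1 (b1 n) (sh Q hQ n).1 (b0 n)).1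
    · have e1 := (value_mul_add_mul (n : ℝ) (sh P hP n).1 (a1 n) (sh Q hQ n).1 (a0 n)).2
      have e2 := (value_mul_add_mul (n : ℝ) (sh P hP n).1 (b1 n) (sh Q hQ n).1 (b0 n)).2
      rw [(sh P hP n).2, (sh Q hQ n).2] at e1 e2
      have h := hf (n + t)
      have h1 := r1 f hf n
      rw [← add_assoc] at h1
      rw [h1, r0 f hf n] at h
      rw [canonNum, canonDen, e1, e2, ← add_assoc, h]
      ring

end

end SecondOrderHolonomic

/-! The invariant behind the proof is `GapPos`: whether some solution is eventually positive along
the progression τℕ + N. The types can be read off from it, and it passes between a recurrence and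
its gap-τ recurrence, because the gap-τ recurrence governs the restrictions of solutions to τℕ + N.

For Part 1, loxodromic pairs have such solutions for τ = 2 and k/r-O elliptic pairs for τ = 2r
(`IsLoxodromic.gapPos`, `IsEllipticO.gapPos`). The restriction is a positive solution of the gap
recurrence, whose last coefficient is eventually negative for even τ by a determinant identity. By a
discrete Kneser criterion, a recurrence with negative last coefficient and a positive solution is
hyperbolic (`isHyperbolic_of_pos_solution`).

For Part 2, a ℚ-Ω elliptic pair has no solution that is positive along any progression
(`IsEllipticOmega.not_gapPos`). Every other type has one (`exists_gapPos_of_not_ellipticOmega`). If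
the gap pair were not ℚ-Ω elliptic, its positive solution would lift to the original recurrence
(`GapPos.of_gap`), a contradiction. The same obstruction forces B^(τ) ≠ 0.

The analysis takes place after a gauge transformation f = w g, which turns the recurrence into
g(n+2) = g(n+1) + ρ(n) g(n) with ρ the normalized ratio. When ρ tends to a limit y ≤ -1/4, the
frozen recurrence has double root 1/2 if y = -1/4, and rotates by the angle θπ if y < -1/4.
Nonexistence comes from a Riccati variable w satisfying w(j+1) - w(j) ≥ c(1 + w²)/(j+1): then arctan
w gains a fixed multiple of 1/j at each step, against the divergence of the harmonic series.
Existence comes from invariant cones that survive the perturbation. Ratios of degree 1 or 2 become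
parabolic (limit -1/4) after passing to gap 2. -/

namespace SecondOrderHolonomic
open Topology

/-! ### Values of rational functions near infinity -/

theorem value_eq_div (R : RatFunc ℝ) (x : ℝ) : value R x = R.num.eval x / R.denom.eval x := by
  simp [value, RatFunc.eval, Polynomial.eval₂_id]

theorem eventually_denom_ne_zero (R : RatFunc ℝ) : ∀ᶠ x : ℝ in atTop, R.denom.eval x ≠ 0 :=
  Polynomial.eventually_atTop_not_isRoot _ R.denom_ne_zero

theorem value_add_eventually (R S : RatFunc ℝ) :
    ∀ᶠ x : ℝ in atTop, value (R + S) x = value R x + value S x := by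
  filter_upwards [eventually_denom_ne_zero R, eventually_denom_ne_zero S] with x hR hS
  exact RatFunc.eval_add _ _ hR hS

theorem value_mul_eventually (R S : RatFunc ℝ) :
    ∀ᶠ x : ℝ in atTop, value (R * S) x = value R x * value S x := by
  filter_upwards [eventually_denom_ne_zero R, eventually_denom_ne_zero S] with x hR hS
  exact RatFunc.eval_mul _ _ hR hS

@[simp] theorem value_zero (x : ℝ) : value 0 x = 0 := by simp [value]
@[simp] theorem value_one (x : ℝ) : value 1 x = 1 := by simp [value]
@[simp] theorem value_C (a x : ℝ) : value (RatFunc.C a) x = a := by simp [value]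
@[simp] theorem value_X (x : ℝ) : value RatFunc.X x = x := by simp [value]

theorem value_neg_eventually (R : RatFunc ℝ) :
    ∀ᶠ x : ℝ in atTop, value (-R) x = -value R x := by
  filter_upwards [value_add_eventually R (-R)] with x h
  rw [add_neg_cancel, value_zero] at h
  linarith

theorem value_sub_eventually (R S : RatFunc ℝ) :
    ∀ᶠ x : ℝ in atTop, value (R - S) x = value R x - value S x := by
  filter_upwards [value_add_eventually R (-S), value_neg_eventually S] with x h1 h2
  rw [sub_eq_add_neg, h1, h2, sub_eq_add_neg]

theorem value_inv_eventually (R : RatFunc ℝ) :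
    ∀ᶠ x : ℝ in atTop, value R⁻¹ x = (value R x)⁻¹ := by
  by_cases h : R = 0
  · simp [h]
  · filter_upwards [value_mul_eventually R⁻¹ R] with x hx
    rw [inv_mul_cancel₀ h, value_one] at hx
    exact eq_inv_of_mul_eq_one_left hx.symm

theorem value_div_eventually (R S : RatFunc ℝ) :
    ∀ᶠ x : ℝ in atTop, value (R / S) x = value R x / value S x := by
  filter_upwards [value_mul_eventually R S⁻¹, value_inv_eventually S] with x h1 h2
  rw [div_eq_mul_inv, h1, h2, div_eq_mul_inv]

theorem tendsto_lin {a : ℝ} (ha : 0 < a) (b : ℝ) : Tendsto (fun x : ℝ => a * x + b) atTop atTop :=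
  tendsto_atTop_add_const_right _ _ (tendsto_id.const_mul_atTop ha)

theorem value_substLin_eventually {a : ℝ} (ha : 0 < a) (b : ℝ) (R : RatFunc ℝ) :
    ∀ᶠ x : ℝ in atTop, value (substLin a b R) x = value R (a * x + b) := by
  filter_upwards [(tendsto_lin ha b).eventually (eventually_denom_ne_zero R)] with x hx
  exact (substLin_spec a b x R hx).2

/-- The leading behaviour of a nonzero rational function. -/
theorem exists_tendsto_value_div_zpow {R : RatFunc ℝ} (hR : R ≠ 0) :
    ∃ c : ℝ, c ≠ 0 ∧ Tendsto (fun x : ℝ => value R x / x ^ R.intDegree) atTop (𝓝 c) := by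
  have hn : R.num.leadingCoeff ≠ 0 := by simpa using RatFunc.num_ne_zero hR
  have hd : R.denom.leadingCoeff ≠ 0 := by simpa using R.denom_ne_zero
  refine ⟨R.num.leadingCoeff / R.denom.leadingCoeff, div_ne_zero hn hd, ?_⟩
  have key : ∀ p : Polynomial ℝ, p ≠ 0 →
      Tendsto (fun x : ℝ => p.eval x / x ^ p.natDegree) atTop (𝓝 p.leadingCoeff) := by
    intro p hp
    have h := (Polynomial.isEquivalent_atTop_lead p)
    have hl : p.leadingCoeff ≠ 0 := by simpa using hp
    rw [isEquivalent_iff_tendsto_one] at h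
    · have := h.const_mul p.leadingCoeff
      rw [mul_one] at this
      refine this.congr' ?_
      filter_upwards [eventually_gt_atTop 0] with x hx
      simp only [Pi.div_apply]
      field_simp
    · filter_upwards [eventually_gt_atTop 0] with x hx
      positivity
  refine ((key _ (RatFunc.num_ne_zero hR)).div (key _ R.denom_ne_zero) hd).congr' ?_
  filter_upwards [eventually_gt_atTop 0, eventually_denom_ne_zero R] with x hx hx2
  rw [value_eq_div, RatFunc.intDegree, zpow_sub₀ hx.ne', zpow_natCast, zpow_natCast, Pi.div_apply]
  field_simp

theorem eventually_value_ne_zero {R : RatFunc ℝ} (hR : R ≠ 0) :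
    ∀ᶠ x : ℝ in atTop, value R x ≠ 0 := by
  obtain ⟨c, hc, h⟩ := exists_tendsto_value_div_zpow hR
  filter_upwards [h.eventually_ne hc] with x hx h0
  simp [h0] at hx

theorem eventually_value_pos_or_neg {R : RatFunc ℝ} (hR : R ≠ 0) :
    (∀ᶠ x : ℝ in atTop, 0 < value R x) ∨ (∀ᶠ x : ℝ in atTop, value R x < 0) := by
  obtain ⟨c, hc, h⟩ := exists_tendsto_value_div_zpow hR
  rcases hc.lt_or_gt with hc | hc
  · right
    filter_upwards [h.eventually_lt_const hc, eventually_gt_atTop 0] with x hx h0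
    have : 0 < x ^ R.intDegree := by positivity
    by_contra! h1
    exact absurd hx (not_lt.2 (by positivity))
  · left
    filter_upwards [h.eventually_const_lt hc, eventually_gt_atTop 0] with x hx h0
    have : 0 < x ^ R.intDegree := by positivity
    by_contra! h1
    exact absurd hx (not_lt.2 (div_nonpos_of_nonpos_of_nonneg h1 this.le))

theorem eventually_nat {p : ℝ → Prop} (h : ∀ᶠ x : ℝ in atTop, p x) :
    ∀ᶠ n : ℕ in atTop, p (n : ℝ) :=
  tendsto_natCast_atTop_atTop.eventually h

/-- A nonzero rational function has constant sign near infinity, so its sign at large integers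
determines its sign at large reals. -/
theorem ultNeg_iff {R : RatFunc ℝ} : UltNeg R ↔ ∀ᶠ x : ℝ in atTop, value R x < 0 := by
  refine ⟨fun h => ?_, eventually_nat⟩
  have hR : R ≠ 0 := by
    rintro rfl
    obtain ⟨n, hn⟩ := h.exists
    simp at hn
  refine (eventually_value_pos_or_neg hR).resolve_left fun h2 => ?_
  obtain ⟨n, h1, h2⟩ := (h.and (eventually_nat h2)).exists
  linarith

theorem intDegree_le_zero_of_tendsto {R : RatFunc ℝ} {l : ℝ}
    (h : Tendsto (value R) atTop (𝓝 l)) : R.intDegree ≤ 0 := by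
  by_cases hR : R = 0
  · simp [hR]
  by_contra! hd
  obtain ⟨c, hc, h1⟩ := exists_tendsto_value_div_zpow hR
  have h2 := h.div_atTop (tendsto_zpow_atTop_atTop hd)
  exact hc (tendsto_nhds_unique h1 h2)

theorem exists_tendsto_of_intDegree_le_zero {R : RatFunc ℝ} (hd : R.intDegree ≤ 0) :
    ∃ l : ℝ, Tendsto (value R) atTop (𝓝 l) := by
  by_cases hR : R = 0
  · exact ⟨0, by simp [hR, funext value_zero]⟩
  obtain ⟨c, hc, h1⟩ := exists_tendsto_value_div_zpow hR
  rcases hd.lt_or_eq with hd | hd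
  · have h2 := h1.mul (tendsto_zpow_atTop_zero (𝕜 := ℝ) hd)
    refine ⟨_, h2.congr' ?_⟩
    filter_upwards [eventually_gt_atTop 0] with x hx
    field_simp
  · exact ⟨c, by simpa [hd] using h1⟩

/-- One step of the expansion of a rational function in powers of `1 / x`. -/
theorem exists_expansion_step {R : RatFunc ℝ} (hd : R.intDegree ≤ 0) :
    ∃ (a : ℝ) (S : RatFunc ℝ), S.intDegree ≤ 0 ∧
      ∀ᶠ x : ℝ in atTop, value R x = a + value S x / x := by
  obtain ⟨a, ha⟩ := exists_tendsto_of_intDegree_le_zero hd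
  have hv : ∀ᶠ x : ℝ in atTop, value R x - a = value (R - RatFunc.C a) x := by
    filter_upwards [value_sub_eventually R (RatFunc.C a)] with x hx
    rw [hx, value_C]
  have hlim : Tendsto (value (R - RatFunc.C a)) atTop (𝓝 0) := by
    have := ha.sub_const a
    rw [sub_self] at this
    exact this.congr' hv
  -- Since R - a tends to 0, it is zero or has negative degree, so multiplying it by X keeps the
  -- degree at most 0.
  refine ⟨a, RatFunc.X * (R - RatFunc.C a), ?_, ?_⟩
  · by_cases h0 : R - RatFunc.C a = 0
    · simp [h0]
    rw [RatFunc.intDegree_mul RatFunc.X_ne_zero h0, RatFunc.intDegree_X]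
    have h1 := intDegree_le_zero_of_tendsto hlim
    have h2 : (R - RatFunc.C a).intDegree ≠ 0 := by
      intro h2
      obtain ⟨c, hc, h3⟩ := exists_tendsto_value_div_zpow h0
      rw [h2] at h3
      simp only [zpow_zero, div_one] at h3
      exact hc (tendsto_nhds_unique h3 hlim)
    omega
  · filter_upwards [hv, value_mul_eventually RatFunc.X (R - RatFunc.C a), eventually_gt_atTop 0]
      with x h1 h2 h3
    rw [h2, ← h1, value_X]
    field_simp
    ring

/-- A rational function of degree at most `0` has an expansion with remainder term. -/
theorem exists_expansion {R : RatFunc ℝ} (hd : R.intDegree ≤ 0) :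
    ∃ (a b c l : ℝ) (T : ℝ → ℝ), Tendsto T atTop (𝓝 l) ∧
      ∀ᶠ x : ℝ in atTop, value R x = a + b / x + c / x ^ 2 + T x / x ^ 3 := by
  obtain ⟨a, S, hS, h1⟩ := exists_expansion_step hd
  obtain ⟨b, S', hS', h2⟩ := exists_expansion_step hS
  obtain ⟨c, T, hT, h3⟩ := exists_expansion_step hS'
  obtain ⟨l, hl⟩ := exists_tendsto_of_intDegree_le_zero hT
  refine ⟨a, b, c, l, value T, hl, ?_⟩
  filter_upwards [h1, h2, h3, eventually_gt_atTop 0] with x h1 h2 h3 h4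
  rw [h1, h2, h3]
  field_simp
  ring

theorem exists_hasExpansion {R : RatFunc ℝ} (hd : R.intDegree ≤ 0) :
    ∃ a b c : ℝ, HasExpansion R a b c := by
  obtain ⟨a, b, c, l, T, hT, h⟩ := exists_expansion hd
  refine ⟨a, b, c, ?_⟩
  have h1 : (fun x => T x * (x ^ 3)⁻¹) =O[atTop] fun x : ℝ => 1 * (x ^ 3)⁻¹ :=
    (hT.isBigO_one ℝ).mul (isBigO_refl _ _)
  simp only [one_mul] at h1
  refine h1.congr' ?_ EventuallyEq.rfl
  filter_upwards [h] with x hx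
  rw [hx]
  ring

theorem HasExpansion.exists_bound {R : RatFunc ℝ} {a b c : ℝ} (h : HasExpansion R a b c) :
    ∃ K : ℝ, 0 < K ∧
      ∀ᶠ x : ℝ in atTop, |value R x - (a + b / x + c / x ^ 2)| ≤ K / x ^ 3 := by
  obtain ⟨K, hK, hb⟩ := h.exists_pos
  refine ⟨K, hK, ?_⟩
  filter_upwards [hb.bound, eventually_gt_atTop 0] with x hx h0
  have h3 : 0 < (x ^ 3)⁻¹ := by positivity
  rwa [Real.norm_eq_abs, Real.norm_eq_abs, abs_of_pos h3, ← div_eq_mul_inv] at hx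

theorem HasExpansion.tendsto {R : RatFunc ℝ} {a b c : ℝ} (h : HasExpansion R a b c) :
    Tendsto (value R) atTop (𝓝 a) := by
  have h1 : Tendsto (fun x : ℝ => value R x - (a + b / x + c / x ^ 2)) atTop (𝓝 0) :=
    h.trans_tendsto ((tendsto_pow_atTop (by norm_num)).inv_tendsto_atTop)
  have h2 : Tendsto (fun x : ℝ => a + b / x + c / x ^ 2) atTop (𝓝 (a + 0 + 0)) :=
    (tendsto_const_nhds.add (tendsto_const_nhds.div_atTop tendsto_id)).add
      (tendsto_const_nhds.div_atTop (tendsto_pow_atTop (by norm_num)))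
  simpa using h1.add h2

/-! ### Growth lemmas for first-order difference inequalities -/

/-- Mean value inequality: on [w, w + s] the quantity 1 + x² is largest at an endpoint, which bounds
the derivative of arctan below by 1 / (L (1 + w²)). -/
theorem arctan_add_le {w s : ℝ} {L : ℝ} (hs : 0 ≤ s)
    (hb : 1 + (w + s) ^ 2 ≤ L * (1 + w ^ 2)) (hL : 1 ≤ L) :
    Real.arctan w + s / (L * (1 + w ^ 2)) ≤ Real.arctan (w + s) := by
  have hpos : 0 < L * (1 + w ^ 2) := by positivity
  have := (convex_Icc w (w + s)).mul_sub_le_image_sub_of_le_deriv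
    (f := Real.arctan) Real.continuous_arctan.continuousOn
    (Real.differentiable_arctan.differentiableOn) (C := 1 / (L * (1 + w ^ 2))) ?_ w
    (Set.left_mem_Icc.2 (by linarith)) (w + s) (Set.right_mem_Icc.2 (by linarith)) (by linarith)
  · have e : 1 / (L * (1 + w ^ 2)) * (w + s - w) = s / (L * (1 + w ^ 2)) := by ring
    linarith
  · intro x hx
    rw [interior_Icc] at hx
    rw [Real.deriv_arctan]
    apply one_div_le_one_div_of_le (by positivity)
    have h1 : x ^ 2 ≤ w ^ 2 ∨ x ^ 2 ≤ (w + s) ^ 2 := by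
      rcases le_total 0 x with h | h
      · right; exact pow_le_pow_left₀ h hx.2.le 2
      · left; nlinarith [hx.1]
    rcases h1 with h1 | h1
    · nlinarith [sq_nonneg w]
    · linarith

/-- A sequence with increments at least `c (1 + w²) / j` cannot stay below a linear bound. -/
theorem not_quadratic_growth {w : ℕ → ℝ} {c C : ℝ} (hc : 0 < c)
    (h1 : ∀ᶠ j : ℕ in atTop, w j + c * (1 + w j ^ 2) / (j + 1) ≤ w (j + 1))
    (h2 : ∀ᶠ j : ℕ in atTop, w j ≤ C * (j + 1)) : False := by
  obtain ⟨j₀, hj⟩ := eventually_atTop.1 (h1.and h2)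
  have hmono : ∀ j, j₀ ≤ j → w j₀ ≤ w j := by
    intro j hj0
    induction j, hj0 using Nat.le_induction with
    | base => exact le_rfl
    | succ j hj0 ih =>
      have h := (hj j hj0).1
      have : 0 ≤ c * (1 + w j ^ 2) / (j + 1) := by positivity
      linarith
  set D : ℝ := max (max C 0) |w j₀| with hD
  have hD0 : 0 ≤ D := le_max_of_le_right (abs_nonneg _)
  have habs : ∀ j, j₀ ≤ j → |w j| ≤ D * (j + 1) := by
    intro j hj0
    have hjj : (1 : ℝ) ≤ j + 1 := by linarith [(Nat.cast_nonneg j : (0 : ℝ) ≤ j)]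
    rw [abs_le]
    constructor
    · have h3 := hmono j hj0
      have h4 : |w j₀| ≤ D := le_max_right _ _
      have := neg_abs_le (w j₀)
      nlinarith
    · have h3 := (hj j hj0).2
      have h4 : C ≤ D := (le_max_left _ _).trans (le_max_left _ _)
      nlinarith
  -- The linear bound on w makes the guaranteed increment s at most E(1 + |w|). Hence 1 + (w + s)² ≤
  -- L(1 + w²), and arctan w gains at least (c / L) / (j + 1) at each step.
  set E : ℝ := c * (1 + D) with hE
  have hE0 : 0 ≤ E := by positivity
  set L : ℝ := 2 + 4 * E ^ 2 + 2 with hL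
  have hstep : ∀ j, j₀ ≤ j → Real.arctan (w j) + c / L * (1 / ((j : ℝ) + 1)) ≤
      Real.arctan (w (j + 1)) := by
    intro j hj0
    have hjj : (1 : ℝ) ≤ j + 1 := by linarith [(Nat.cast_nonneg j : (0 : ℝ) ≤ j)]
    have hjp : (0 : ℝ) < j + 1 := by linarith
    set s := c * (1 + w j ^ 2) / (j + 1) with hs
    have hs0 : 0 ≤ s := by positivity
    have hsb : s ≤ E * (1 + |w j|) := by
      rw [hs, div_le_iff₀ hjp, hE, mul_assoc, mul_assoc]
      apply mul_le_mul_of_nonneg_left _ hc.le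
      have h3 := habs j hj0
      rw [← sq_abs]
      have h4 : 0 ≤ |w j| := abs_nonneg _
      have h5 : |w j| ^ 2 ≤ |w j| * (D * (j + 1)) := by nlinarith
      have h6 : 0 ≤ (1 + D) * |w j| * (j + 1) - |w j| * (D * (j + 1)) := by
        have : 0 ≤ |w j| * (j + 1 : ℝ) := by positivity
        linarith
      nlinarith
    have hb : 1 + (w j + s) ^ 2 ≤ L * (1 + w j ^ 2) := by
      have h3 : s ^ 2 ≤ E ^ 2 * (2 * (1 + w j ^ 2)) := by
        calc s ^ 2 ≤ (E * (1 + |w j|)) ^ 2 := pow_le_pow_left₀ hs0 hsb 2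
          _ = E ^ 2 * (1 + |w j|) ^ 2 := by ring
          _ ≤ E ^ 2 * (2 * (1 + w j ^ 2)) := by
            apply mul_le_mul_of_nonneg_left _ (sq_nonneg _)
            rw [← sq_abs (w j)]
            nlinarith [sq_nonneg (1 - |w j|)]
      rw [hL]
      nlinarith [sq_nonneg (w j - s), sq_nonneg (w j)]
    have h3 := arctan_add_le hs0 hb (by rw [hL]; nlinarith [sq_nonneg E])
    have h4 := Real.arctan_strictMono.monotone (hj j hj0).1
    have h5 : s / (L * (1 + w j ^ 2)) = c / L * (1 / ((j : ℝ) + 1)) := by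
      have : L ≠ 0 := by positivity
      rw [hs]; field_simp
    rw [h5] at h3
    exact h3.trans h4
  have hsum : ∀ k : ℕ, Real.arctan (w j₀) +
      c / L * ∑ i ∈ Finset.range k, 1 / (((i + j₀ : ℕ) : ℝ) + 1) ≤ Real.arctan (w (k + j₀)) := by
    intro k
    induction k with
    | zero => simp
    | succ k ih =>
      rw [Finset.sum_range_succ, mul_add]
      have := hstep (k + j₀) (by omega)
      rw [show k + 1 + j₀ = k + j₀ + 1 by ring]
      linarith
  have hdiv : Tendsto (fun k : ℕ => ∑ i ∈ Finset.range k, 1 / (((i + j₀ : ℕ) : ℝ) + 1))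
      atTop atTop := by
    rw [← not_summable_iff_tendsto_nat_atTop_of_nonneg (fun i => by positivity)]
    intro hsm
    have h3 : Summable fun i : ℕ => 1 / (((i + (j₀ + 1) : ℕ) : ℝ)) := by
      refine hsm.congr fun i => ?_
      push_cast
      ring
    exact Real.not_summable_one_div_natCast ((summable_nat_add_iff (j₀ + 1)).1 h3)
  have hLc : 0 < c / L := by positivity
  obtain ⟨k, hk⟩ := (hdiv.eventually_gt_atTop (2 * Real.pi / (c / L))).exists
  rw [div_lt_iff₀ hLc] at hk
  have h3 := hsum k
  have h4 := Real.arctan_lt_pi_div_two (w (k + j₀))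
  have h5 := Real.neg_pi_div_two_lt_arctan (w j₀)
  nlinarith [Real.pi_pos]

/-- Oscillation criterion of Kneser type. -/
theorem no_pos_solution {ρ g : ℕ → ℝ} {c : ℝ} (hc : 1 / 16 < c)
    (hρ : ∀ᶠ n : ℕ in atTop, ρ n ≤ -(1 / 4) - c / (n : ℝ) ^ 2)
    (hg : ∀ᶠ n in atTop, g (n + 2) = g (n + 1) + ρ n * g n)
    (hpos : ∀ᶠ n in atTop, 0 < g n) : False := by
  obtain ⟨n₀, h⟩ := eventually_atTop.1 (hρ.and (hg.and (hpos.and (eventually_ge_atTop 1))))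
  -- Riccati variable: g(n+1)/g(n) = (1 - w(n)/n)/2 measures the deviation from the double root 1/2
  -- on the scale 1/n. It satisfies (w(n+1) - w(n))(n - w(n)) ≥ w² + w + 4c, and this quadratic is
  -- positive definite exactly when c > 1/16. The constant δ quantifies the definiteness.
  set w : ℕ → ℝ := fun n => -(n * (2 * (g (n + 1) / g n) - 1)) with hw
  set δ : ℝ := min (1 / 2) ((4 * c - 1 / 4) / 2) with hδ
  have hδ0 : 0 < δ := lt_min (by norm_num) (by linarith)
  have hδ1 : δ ≤ 1 / 2 := min_le_left _ _
  have hδ2 : 2 * δ ≤ 4 * c - 1 / 4 := by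
    have : δ ≤ _ := min_le_right (1 / 2) ((4 * c - 1 / 4) / 2)
    linarith
  have hkey : ∀ n, n₀ ≤ n → w n < n ∧
      (w n + w n ^ 2 + 4 * c) ≤ (w (n + 1) - w n) * (n - w n) := by
    intro n hn
    obtain ⟨h1, h2, h3, h4⟩ := h n hn
    have h5 := (h (n + 1) (by omega)).2.2.1
    have hn0 : (0 : ℝ) < n := by exact_mod_cast h4
    set u := g (n + 1) / g n with hu
    have hu0 : 0 < u := div_pos h5 h3
    set u' := g (n + 1 + 1) / g (n + 1) with hu'
    have hr : u' * u = u + ρ n := by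
      rw [hu, hu', show n + 1 + 1 = n + 2 by ring, h2]
      field_simp
    have e1 : w n = -(n * (2 * u - 1)) := rfl
    have e2 : w (n + 1) = -((n + 1) * (2 * u' - 1)) := by simp [hw, hu']
    refine ⟨by rw [e1]; nlinarith, ?_⟩
    have e3 : (w (n + 1) - w n) * (n - w n) =
        -2 * n * (n + 1) * (2 * (u' * u) - u) + n * (2 * u - 1) * (2 * n * u) := by
      rw [e1, e2]; ring
    rw [e3, hr, e1]
    have h6 : n * ρ n ≤ -(n / 4) - c / n := by
      have := mul_le_mul_of_nonneg_left h1 hn0.le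
      refine this.trans_eq ?_
      field_simp
    have h7 : n * (n + 1) * ρ n ≤ -(n * (n + 1) / 4) - c := by
      have := mul_le_mul_of_nonneg_left h6 (by linarith : (0 : ℝ) ≤ n + 1)
      have h8 : (n + 1) * (-(n / 4) - c / n) ≤ -(n * (n + 1) / 4) - c := by
        have : (n + 1) * (-(n / 4) - c / n) = -(n * (n + 1) / 4) - c - c / n := by
          field_simp; ring
        rw [this]
        have : 0 < c / n := div_pos (by linarith) hn0
        linarith
      linarith
    nlinarith
  have hquad : ∀ x : ℝ, δ * (1 + x ^ 2) ≤ x + x ^ 2 + 4 * c := by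
    intro x
    nlinarith [sq_nonneg (x + 1 / 2), sq_nonneg (x + 1), sq_nonneg x, mul_nonneg (sub_nonneg.2 hδ1) (sq_nonneg (x + 1))]
  have hinc : ∀ n, n₀ ≤ n → w n ≤ w (n + 1) := by
    intro n hn
    obtain ⟨h1, h2⟩ := hkey n hn
    by_contra! h3
    have := hquad (w n)
    nlinarith [sq_nonneg (w n)]
  have hmono : ∀ n, n₀ ≤ n → w n₀ ≤ w n := by
    intro n hn
    induction n, hn using Nat.le_induction with
    | base => exact le_rfl
    | succ n hn ih => exact ih.trans (hinc n hn)
  refine not_quadratic_growth (w := w) (c := δ / (1 + |w n₀|)) (C := 1) (by positivity) ?_ ?_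
  · filter_upwards [eventually_ge_atTop n₀] with n hn
    obtain ⟨h1, h2⟩ := hkey n hn
    have h3 := (hquad (w n)).trans h2
    have hn0 : (0 : ℝ) ≤ n := Nat.cast_nonneg n
    have h4 : (n : ℝ) - w n ≤ (1 + |w n₀|) * (n + 1) := by
      have := hmono n hn
      have := neg_abs_le (w n₀)
      nlinarith [abs_nonneg (w n₀)]
    have h5 := hinc n hn
    have h6 : δ * (1 + w n ^ 2) ≤ (w (n + 1) - w n) * ((1 + |w n₀|) * (n + 1)) :=
      h3.trans (mul_le_mul_of_nonneg_left h4 (by linarith))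
    have h7 : δ / (1 + |w n₀|) * (1 + w n ^ 2) / (n + 1) ≤ w (n + 1) - w n := by
      rw [div_mul_eq_mul_div, div_div, div_le_iff₀ (by positivity)]
      exact h6
    linarith
  · filter_upwards [eventually_ge_atTop n₀] with n hn
    have := (hkey n hn).1
    linarith

/-! ### Second-order recurrences for sequences of real numbers -/

/-- The denominators `B^(k)` of a recurrence with sequences `p`, `q` as coefficients. -/
noncomputable def seqDen (p q : ℕ → ℝ) : ℕ → ℕ → ℝ
  | 0, _ => 0
  | 1, _ => 1
  | k + 2, n => p (n + k) * seqDen p q (k + 1) n + q (n + k) * seqDen p q k n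

/-- The numerators `A^(k)` of a recurrence with sequences `p`, `q` as coefficients. -/
noncomputable def seqNum (p q : ℕ → ℝ) : ℕ → ℕ → ℝ
  | 0, _ => 1
  | 1, _ => 0
  | k + 2, n => p (n + k) * seqNum p q (k + 1) n + q (n + k) * seqNum p q k n

/-- Some eventual solution of the recurrence is eventually positive on `τ ℕ + N`. -/
def GapPos (p q : ℕ → ℝ) (τ N : ℕ) : Prop :=
  ∃ f : ℕ → ℝ, (∀ᶠ n in atTop, f (n + 2) = p n * f (n + 1) + q n * f n) ∧
    ∀ᶠ n in atTop, 0 < f (τ * n + N)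

theorem gap_formula {p q f : ℕ → ℝ} {n₀ : ℕ}
    (hf : ∀ n, n₀ ≤ n → f (n + 2) = p n * f (n + 1) + q n * f n) (k : ℕ) {n : ℕ} (hn : n₀ ≤ n) :
    f (n + k) = seqDen p q k n * f (n + 1) + seqNum p q k n * f n := by
  induction k using Nat.twoStepInduction with
  | zero => simp [seqDen, seqNum]
  | one => simp [seqDen, seqNum]
  | more k ih0 ih1 =>
    have h := hf (n + k) (by omega)
    rw [add_assoc n k 1, ih1, ih0] at h
    rw [seqDen, seqNum, ← add_assoc, h]
    ring

theorem eventually_gap_formula {p q f : ℕ → ℝ}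
    (hf : ∀ᶠ n in atTop, f (n + 2) = p n * f (n + 1) + q n * f n) (k : ℕ) :
    ∀ᶠ n in atTop, f (n + k) = seqDen p q k n * f (n + 1) + seqNum p q k n * f n := by
  obtain ⟨n₀, h⟩ := eventually_atTop.1 hf
  filter_upwards [eventually_ge_atTop n₀] with n hn using gap_formula h k hn

theorem tendsto_gap {τ : ℕ} (hτ : 1 ≤ τ) (N : ℕ) :
    Tendsto (fun n : ℕ => τ * n + N) atTop atTop :=
  tendsto_atTop_mono (fun n => (Nat.le_mul_of_pos_left n hτ).trans (Nat.le_add_right _ _)) tendsto_id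

theorem GapPos.mul {p q : ℕ → ℝ} {τ N : ℕ} (h : GapPos p q τ N) {m : ℕ} (hm : 1 ≤ m) :
    GapPos p q (τ * m) N := by
  obtain ⟨f, h1, h2⟩ := h
  refine ⟨f, h1, ?_⟩
  have := (tendsto_gap hm 0).eventually h2
  simpa [mul_assoc] using this

/-- There is an eventual solution with prescribed values at two large consecutive places. -/
theorem exists_solution (p q : ℕ → ℝ) (n₀ : ℕ) (a b : ℝ) :
    ∃ f : ℕ → ℝ, f n₀ = a ∧ f (n₀ + 1) = b ∧
      ∀ n, n₀ ≤ n → f (n + 2) = p n * f (n + 1) + q n * f n := by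
  refine ⟨fun n => seqDen p q (n - n₀) n₀ * b + seqNum p q (n - n₀) n₀ * a, by simp [seqDen, seqNum],
    by simp [seqDen, seqNum], fun n hn => ?_⟩
  obtain ⟨k, rfl⟩ := Nat.exists_eq_add_of_le hn
  simp only [show n₀ + k + 2 - n₀ = k + 2 by omega, show n₀ + k + 1 - n₀ = k + 1 by omega,
    show n₀ + k - n₀ = k by omega, seqDen, seqNum]
  ring

/-! ### Gauge transformation to middle coefficient 1. -/

theorem exists_sign_of_mul_pos {w : ℕ → ℝ} {τ : ℕ} (hτ : Even τ) (h1 : 1 ≤ τ) (N : ℕ)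
    (hw : ∀ᶠ n in atTop, 0 < w n * w (n + 2)) :
    (∀ᶠ n in atTop, 0 < w (τ * n + N)) ∨ (∀ᶠ n in atTop, w (τ * n + N) < 0) := by
  obtain ⟨n₀, hn⟩ := eventually_atTop.1 hw
  obtain ⟨m, hm⟩ := hτ
  have hstep : ∀ n, n₀ ≤ n → ∀ k, 0 < w n * w (n + 2 * k) := by
    intro n hn0 k
    induction k with
    | zero =>
      have := hn n hn0
      have : w n ≠ 0 := left_ne_zero_of_mul this.ne'
      simpa using mul_self_pos.2 this
    | succ k ih =>
      have h3 := hn (n + 2 * k) (by omega)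
      rw [show n + 2 * (k + 1) = n + 2 * k + 2 by ring]
      rcases mul_pos_iff.1 ih with h4 | h4 <;> rcases mul_pos_iff.1 h3 with h5 | h5
      · exact mul_pos h4.1 h5.2
      · linarith
      · linarith
      · exact mul_pos_of_neg_of_neg h4.1 h5.2
  have hbase : n₀ ≤ τ * n₀ + N := by nlinarith
  have hall : ∀ n, n₀ ≤ n → 0 < w (τ * n₀ + N) * w (τ * n + N) := by
    intro n hn0
    obtain ⟨k, rfl⟩ := Nat.exists_eq_add_of_le hn0
    have := hstep _ hbase (m * k)
    rwa [show τ * n₀ + N + 2 * (m * k) = τ * (n₀ + k) + N by rw [hm]; ring] at this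
  rcases lt_or_ge 0 (w (τ * n₀ + N)) with h | h
  · left
    filter_upwards [eventually_ge_atTop n₀] with n hn0
    exact (pos_iff_pos_of_mul_pos (hall n hn0)).1 h
  · right
    filter_upwards [eventually_ge_atTop n₀] with n hn0
    have := hall n hn0
    by_contra! h4
    nlinarith

/-- With w(n+1) = p(n-1) w(n), the substitution f = w g replaces the coefficients p, q by 1 and q(n)
/ (p(n) p(n-1)). Since w(n) w(n+2) = p(n) p(n-1) w(n)², the sign of w is eventually constant on each
parity class. -/
theorem exists_gauge (p : ℕ → ℝ) (hp : ∀ᶠ n in atTop, 0 < p n * p (n - 1)) :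
    ∃ w : ℕ → ℝ, (∀ n, w n ≠ 0) ∧ (∀ᶠ n in atTop, w (n + 1) = p (n - 1) * w n) ∧
      ∀ᶠ n in atTop, 0 < w n * w (n + 2) := by
  -- Zeros of p are replaced by 1 so that w vanishes nowhere; for large n nothing is changed.
  set c : ℕ → ℝ := fun n => if p (n - 1) = 0 then 1 else p (n - 1) with hc
  have hc0 : ∀ n, c n ≠ 0 := by
    intro n
    by_cases h : p (n - 1) = 0 <;> simp [hc, h]
  have hw0 : ∀ n, ∏ i ∈ Finset.range n, c i ≠ 0 := fun n => Finset.prod_ne_zero_iff.2 fun i _ => hc0 i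
  have h1 : ∀ᶠ n in atTop, ∏ i ∈ Finset.range (n + 1), c i =
      p (n - 1) * ∏ i ∈ Finset.range n, c i := by
    filter_upwards [hp] with n hn
    have : p (n - 1) ≠ 0 := right_ne_zero_of_mul hn.ne'
    rw [Finset.prod_range_succ, hc]
    simp [this, mul_comm]
  refine ⟨fun n => ∏ i ∈ Finset.range n, c i, hw0, h1, ?_⟩
  filter_upwards [h1, (tendsto_add_atTop_nat 1).eventually h1, hp] with n h2 h3 h4
  rw [h3, h2, Nat.add_sub_cancel]
  have := mul_self_pos.2 (hw0 n)
  nlinarith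

section Gauge

variable {p q ρ : ℕ → ℝ} {τ N : ℕ}

/-- An even gap stays in one parity class, where the gauge w has a constant sign. If that sign is
negative, the transported solution is multiplied by -1. -/
theorem gapPos_iff_of_gauge (hp : ∀ᶠ n in atTop, 0 < p n * p (n - 1))
    (hρ : ∀ᶠ n in atTop, q n = ρ n * (p n * p (n - 1))) (hτ : Even τ) (h1 : 1 ≤ τ) :
    GapPos p q τ N ↔ GapPos (fun _ => 1) ρ τ N := by
  obtain ⟨w, hw0, hw1, hw2⟩ := exists_gauge p hp
  have hw1' := (tendsto_add_atTop_nat 1).eventually hw1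
  have hsign := exists_sign_of_mul_pos hτ h1 N hw2
  constructor
  · rintro ⟨f, hf, hpos⟩
    have hs : ∀ e : ℝ, ∀ᶠ n in atTop, e * f (n + 2) / w (n + 2) =
        1 * (e * f (n + 1) / w (n + 1)) + ρ n * (e * f n / w n) := by
      intro e
      filter_upwards [hf, hρ, hw1, hw1', hp] with n h2 h3 h4 h5 h6
      have h7 : p n ≠ 0 := left_ne_zero_of_mul h6.ne'
      have h8 : p (n - 1) ≠ 0 := right_ne_zero_of_mul h6.ne'
      have h9 := hw0 n
      rw [Nat.add_sub_cancel] at h5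
      rw [h2, h3, h5, h4]
      field_simp
    rcases hsign with hsg | hsg
    · refine ⟨fun n => 1 * f n / w n, hs 1, ?_⟩
      filter_upwards [hsg, hpos] with n h2 h3
      rw [one_mul]
      exact div_pos h3 h2
    · refine ⟨fun n => -1 * f n / w n, hs (-1), ?_⟩
      filter_upwards [hsg, hpos] with n h2 h3
      exact div_pos_of_neg_of_neg (by linarith) h2
  · rintro ⟨g, hg, hpos⟩
    have hs : ∀ e : ℝ, ∀ᶠ n in atTop, e * (w (n + 2) * g (n + 2)) =
        p n * (e * (w (n + 1) * g (n + 1))) + q n * (e * (w n * g n)) := by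
      intro e
      filter_upwards [hg, hρ, hw1, hw1'] with n h2 h3 h4 h5
      rw [Nat.add_sub_cancel] at h5
      rw [h2, h3, h5, h4]
      ring
    rcases hsign with hsg | hsg
    · refine ⟨fun n => 1 * (w n * g n), hs 1, ?_⟩
      filter_upwards [hsg, hpos] with n h2 h3
      have := mul_pos h2 h3
      linarith
    · refine ⟨fun n => (-1) * (w n * g n), hs (-1), ?_⟩
      filter_upwards [hsg, hpos] with n h2 h3
      have := mul_neg_of_neg_of_pos h2 h3
      linarith

end Gauge

/-! ### Passing to gap recurrences -/

/-- The middle coefficient of the gap-`τ` recurrence. -/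
noncomputable def seqGapP (p q : ℕ → ℝ) (τ n : ℕ) : ℝ := seqDen p q (2 * τ) n / seqDen p q τ n

/-- The last coefficient of the gap-`τ` recurrence. -/
noncomputable def seqGapQ (p q : ℕ → ℝ) (τ n : ℕ) : ℝ :=
  seqNum p q (2 * τ) n - seqDen p q (2 * τ) n / seqDen p q τ n * seqNum p q τ n

theorem gap_recurrence {p q f : ℕ → ℝ} {n₀ τ : ℕ}
    (hf : ∀ n, n₀ ≤ n → f (n + 2) = p n * f (n + 1) + q n * f n) {n : ℕ} (hn : n₀ ≤ n)
    (h0 : seqDen p q τ n ≠ 0) :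
    f (n + 2 * τ) = seqGapP p q τ n * f (n + τ) + seqGapQ p q τ n * f n := by
  rw [gap_formula hf (2 * τ) hn, gap_formula hf τ hn, seqGapP, seqGapQ]
  field_simp
  ring

theorem eventually_gap_recurrence {p q f : ℕ → ℝ} {τ : ℕ} (hτ : 1 ≤ τ) (N : ℕ)
    (hf : ∀ᶠ n in atTop, f (n + 2) = p n * f (n + 1) + q n * f n)
    (h0 : ∀ᶠ n in atTop, seqDen p q τ n ≠ 0) :
    ∀ᶠ n in atTop, f (τ * (n + 2) + N) =
      seqGapP p q τ (τ * n + N) * f (τ * (n + 1) + N) + seqGapQ p q τ (τ * n + N) * f (τ * n + N) := by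
  obtain ⟨n₀, h⟩ := eventually_atTop.1 hf
  filter_upwards [(tendsto_gap hτ N).eventually h0,
    (tendsto_gap hτ N).eventually_ge_atTop n₀] with n h1 h2
  have := gap_recurrence h h2 h1
  rwa [show τ * n + N + 2 * τ = τ * (n + 2) + N by ring,
    show τ * n + N + τ = τ * (n + 1) + N by ring] at this

/-- Every eventual solution h of the gap recurrence is eventually the restriction of a solution f.
The value f(τn₁ + N) is prescribed, and because B^(τ) ≠ 0 the next value b can be chosen so that
f(τ(n₁ + 1) + N) = h(n₁ + 1). -/
theorem GapPos.of_gap {p q : ℕ → ℝ} {τ N m N' : ℕ} (hτ : 1 ≤ τ) (hm : 1 ≤ m)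
    (h0 : ∀ᶠ n in atTop, seqDen p q τ n ≠ 0)
    (h : GapPos (fun n => seqGapP p q τ (τ * n + N)) (fun n => seqGapQ p q τ (τ * n + N)) m N') :
    GapPos p q (τ * m) (τ * N' + N) := by
  obtain ⟨h, hrec, hpos⟩ := h
  obtain ⟨n₁, hn₁⟩ := eventually_atTop.1 (hrec.and ((tendsto_gap hτ N).eventually h0))
  set b := (h (n₁ + 1) - seqNum p q τ (τ * n₁ + N) * h n₁) / seqDen p q τ (τ * n₁ + N) with hb
  obtain ⟨f, hfa, hfb, hf⟩ := exists_solution p q (τ * n₁ + N) (h n₁) b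
  have key : ∀ n, n₁ ≤ n → f (τ * n + N) = h n ∧ f (τ * (n + 1) + N) = h (n + 1) := by
    intro n hn
    induction n, hn using Nat.le_induction with
    | base =>
      refine ⟨hfa, ?_⟩
      have := gap_formula hf τ le_rfl
      have h2 := (hn₁ n₁ le_rfl).2
      rw [show τ * (n₁ + 1) + N = τ * n₁ + N + τ by ring, this, hfb, hfa, hb]
      field_simp
      ring
    | succ n hn ih =>
      refine ⟨ih.2, ?_⟩
      have h2 := hn₁ n hn
      have := gap_recurrence hf (n := τ * n + N) (by nlinarith) h2.2
      rw [show τ * (n + 1 + 1) + N = τ * n + N + 2 * τ by ring, this,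
        show τ * n + N + τ = τ * (n + 1) + N by ring, ih.1, ih.2]
      exact h2.1.symm
  refine ⟨f, eventually_atTop.2 ⟨_, hf⟩, ?_⟩
  filter_upwards [hpos, (tendsto_gap hm N').eventually_ge_atTop n₁] with n h2 h3
  rw [show τ * m * n + (τ * N' + N) = τ * (m * n + N') + N by ring, (key _ h3).1]
  exact h2

/-! ### The recurrence with constant coefficients `1`, `y` -/

/-- The denominators of the recurrence `f (n + 2) = f (n + 1) + y f n`. -/
noncomputable def fib (y : ℝ) : ℕ → ℝ
  | 0 => 0
  | 1 => 1
  | k + 2 => fib y (k + 1) + y * fib y k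

/-- The characteristic roots of z² = z + y are e^{±iφ} / (2 cos φ). The closed form is multiplied
out so that sin φ = 0 needs no exception. -/
theorem fib_mul_sin {φ y : ℝ} (hφ : Real.cos φ ≠ 0) (hy : y = -(1 / (4 * Real.cos φ ^ 2))) (k : ℕ) :
    fib y k * (2 * Real.cos φ) ^ k * Real.sin φ = 2 * Real.cos φ * Real.sin (k * φ) := by
  induction k using Nat.twoStepInduction with
  | zero => simp [fib]
  | one => simp [fib]
  | more k ih0 ih1 =>
    have e : Real.sin (((k + 2 : ℕ) : ℝ) * φ) =
        2 * Real.cos φ * Real.sin (((k + 1 : ℕ) : ℝ) * φ) - Real.sin (k * φ) := by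
      have h1 : ((k + 2 : ℕ) : ℝ) * φ = ((k + 1 : ℕ) : ℝ) * φ + φ := by push_cast; ring
      have h2 : (k : ℝ) * φ = ((k + 1 : ℕ) : ℝ) * φ - φ := by push_cast; ring
      rw [h1, h2, Real.sin_add, Real.sin_sub]
      ring
    have hy' : y * (2 * Real.cos φ) ^ 2 = -1 := by
      rw [hy]; field_simp; norm_num
    rw [e, fib]
    calc (fib y (k + 1) + y * fib y k) * (2 * Real.cos φ) ^ (k + 2) * Real.sin φ
        = 2 * Real.cos φ * (fib y (k + 1) * (2 * Real.cos φ) ^ (k + 1) * Real.sin φ) +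
          (y * (2 * Real.cos φ) ^ 2) * (fib y k * (2 * Real.cos φ) ^ k * Real.sin φ) := by ring
      _ = _ := by rw [ih0, ih1, hy']; ring

theorem fib_neg_quarter (k : ℕ) : fib (-(1 / 4)) k = 2 * k / 2 ^ k := by
  induction k using Nat.twoStepInduction with
  | zero => simp [fib]
  | one => simp [fib]
  | more k ih0 ih1 =>
    rw [fib, ih0, ih1]
    push_cast
    field_simp
    ring

theorem differentiable_fib (k : ℕ) : Differentiable ℝ fun y => fib y k := by
  induction k using Nat.twoStepInduction with
  | zero => simp [fib]
  | one => simp [fib]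
  | more k ih0 ih1 =>
    simp only [fib]
    exact ih1.add (differentiable_id.mul ih0)

/-- For k ≥ 1 the limit of the numerators is y times the denominator of index k - 1; the difference
form of the statement avoids this index and also covers k = 0. -/
theorem tendsto_seqDen_seqNum {ρ : ℕ → ℝ} {y : ℝ} (h : Tendsto ρ atTop (𝓝 y)) (k : ℕ) :
    Tendsto (seqDen (fun _ => 1) ρ k) atTop (𝓝 (fib y k)) ∧
      Tendsto (seqNum (fun _ => 1) ρ k) atTop (𝓝 (fib y (k + 1) - fib y k)) := by
  induction k using Nat.twoStepInduction with
  | zero =>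
    simp only [funext fun n => show seqDen (fun _ => 1) ρ 0 n = 0 from rfl,
      funext fun n => show seqNum (fun _ => 1) ρ 0 n = 1 from rfl]
    simp [fib]
  | one =>
    simp only [funext fun n => show seqDen (fun _ => 1) ρ 1 n = 1 from rfl,
      funext fun n => show seqNum (fun _ => 1) ρ 1 n = 0 from rfl]
    simp [fib]
  | more k ih0 ih1 =>
    have hk : Tendsto (fun n => ρ (n + k)) atTop (𝓝 y) := h.comp (tendsto_add_atTop_nat k)
    constructor
    · have := (ih1.1.const_mul 1).add (hk.mul ih0.1)
      rw [one_mul] at this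
      exact this
    · have := (ih1.2.const_mul 1).add (hk.mul ih0.2)
      rw [one_mul] at this
      refine (this.congr fun n => rfl).trans_eq ?_
      congr 1
      have e1 : fib y (k + 2 + 1) = fib y (k + 1) + y * fib y k + y * fib y (k + 1) := rfl
      rw [e1, fib]
      ring

/-- Comparison of the denominators and numerators with those for frozen coefficients. -/
theorem seqDen_seqNum_sub_fib_isBigO {ρ Y e : ℕ → ℝ} (hY : Y =O[atTop] fun _ => (1 : ℝ))
    (he : e =O[atTop] fun _ => (1 : ℝ)) (hρ : ∀ i, (fun n => ρ (n + i) - Y n) =O[atTop] e) (k : ℕ) :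
    (fun n => seqDen (fun _ => 1) ρ k n - fib (Y n) k) =O[atTop] e ∧
      (fun n => seqNum (fun _ => 1) ρ k n - (fib (Y n) (k + 1) - fib (Y n) k)) =O[atTop] e := by
  have hfib : ∀ k, (fun n => fib (Y n) k) =O[atTop] fun _ => (1 : ℝ) := by
    intro k
    induction k using Nat.twoStepInduction with
    | zero => exact isBigO_zero _ _
    | one => exact isBigO_refl _ _
    | more k ih0 ih1 =>
      have := hY.mul ih0
      simp only [mul_one] at this
      exact ih1.add this
  have hstep : ∀ (k : ℕ) (D F : ℕ → ℝ), F =O[atTop] (fun _ => (1 : ℝ)) →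
      (fun n => D n - F n) =O[atTop] e →
      (fun n => ρ (n + k) * D n - Y n * F n) =O[atTop] e := by
    intro k D F hF hD
    have h1 := (hρ k).mul (hD.trans he)
    have h2 := (hρ k).mul hF
    have h3 := hY.mul hD
    simp only [mul_one, one_mul] at h1 h2 h3
    refine ((h1.add h2).add h3).congr_left fun n => ?_
    ring
  induction k using Nat.twoStepInduction with
  | zero => simpa [fib, seqDen, seqNum] using isBigO_zero _ _
  | one => simpa [fib, seqDen, seqNum] using isBigO_zero _ _
  | more k ih0 ih1 =>
    constructor
    · refine (ih1.1.add (hstep k _ _ (hfib k) ih0.1)).congr_left fun n => ?_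
      simp only [seqDen, fib]
      ring
    · refine (ih1.2.add (hstep k _ _ ((hfib (k + 1)).sub (hfib k)) ih0.2)).congr_left fun n => ?_
      have e1 : fib (Y n) (k + 2 + 1) =
          fib (Y n) (k + 1) + Y n * fib (Y n) k + Y n * fib (Y n) (k + 1) := rfl
      rw [seqNum, e1, fib]
      ring

/-! ### Positive solutions -/

theorem GapPos.of_eventually_pos {p q f : ℕ → ℝ}
    (hf : ∀ᶠ n in atTop, f (n + 2) = p n * f (n + 1) + q n * f n) (hpos : ∀ᶠ n in atTop, 0 < f n)
    {τ : ℕ} (hτ : 1 ≤ τ) (N : ℕ) : GapPos p q τ N :=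
  ⟨f, hf, (tendsto_gap hτ N).eventually hpos⟩

theorem gapPos_of_pos {ρ : ℕ → ℝ} (hρ : ∀ᶠ n in atTop, 0 < ρ n) {τ : ℕ} (hτ : 1 ≤ τ) (N : ℕ) :
    GapPos (fun _ => 1) ρ τ N := by
  obtain ⟨n₀, h⟩ := eventually_atTop.1 hρ
  obtain ⟨f, ha, hb, hf⟩ := exists_solution (fun _ => 1) ρ n₀ 1 1
  refine .of_eventually_pos (eventually_atTop.2 ⟨n₀, hf⟩) (eventually_atTop.2 ⟨n₀, fun n hn => ?_⟩) hτ N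
  suffices 0 < f n ∧ 0 < f (n + 1) from this.1
  induction n, hn using Nat.le_induction with
  | base => simp [ha, hb]
  | succ n hn ih =>
    refine ⟨ih.2, ?_⟩
    rw [show n + 1 + 1 = n + 2 by ring, hf n hn]
    have := mul_pos (h n hn) ih.1
    linarith [ih.2]

/-- The Kneser type criterion for the existence of a positive solution. -/
theorem gapPos_of_ge {ρ : ℕ → ℝ} {K : ℝ} (hK : 0 < K)
    (hρ : ∀ᶠ n : ℕ in atTop, -(1 / 4) - 1 / (16 * (n : ℝ) ^ 2) - K / (n : ℝ) ^ 3 ≤ ρ n)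
    {τ : ℕ} (hτ : 1 ≤ τ) (N : ℕ) : GapPos (fun _ => 1) ρ τ N := by
  set s : ℕ → ℝ := fun n => (√(n : ℝ))⁻¹ with hs
  have hslim : Tendsto s atTop (𝓝 0) :=
    (Real.tendsto_sqrt_atTop.comp tendsto_natCast_atTop_atTop).inv_tendsto_atTop
  -- With x = s(n), the bound (5 + 32K) x ≤ 1 is what gives x² + x²/4 + 8K x² ≤ x/4 in `hmain`.
  have hKp : 0 < 1 / (5 + 32 * K) := by positivity
  obtain ⟨n₀, h⟩ := eventually_atTop.1 (hρ.and ((hslim.eventually_lt_const hKp).and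
    (eventually_ge_atTop 1)))
  -- Barrier for the ratio f(n+1)/f(n). If (u(n+1) - 1) u(n) ≤ ρ(n) and u(n+1) ≤ 1, then f(n+1) ≥
  -- u(n) f(n) propagates. The term 1/2 is the critical Kneser coefficient. The correction s(n) =
  -- n^(-1/2) gains a term of order n^(-5/2), which absorbs the error K / n³.
  set u : ℕ → ℝ := fun n => (1 + (1 / 2 + s n) / n) / 2 with hu
  have hs0 : ∀ n : ℕ, 1 ≤ n → 0 < s n ∧ s n ^ 2 * n = 1 ∧ s n ≤ 1 := by
    intro n hn
    have hn' : (1 : ℝ) ≤ n := by exact_mod_cast hn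
    refine ⟨by positivity, ?_, ?_⟩
    · simp only [hs, inv_pow, Real.sq_sqrt (by linarith : (0 : ℝ) ≤ n)]
      exact inv_mul_cancel₀ (by linarith)
    · exact inv_le_one_of_one_le₀ (Real.one_le_sqrt.2 hn')
  have hu0 : ∀ n, 1 ≤ n → 0 < u n := by
    intro n hn
    have := (hs0 n hn).1
    positivity
  have hu1 : ∀ n, 2 ≤ n → u n ≤ 1 := by
    intro n hn
    have h1 := hs0 n (by omega)
    have h2 : (2 : ℝ) ≤ n := by exact_mod_cast hn
    have : (1 / 2 + s n) / n ≤ 1 := by rw [div_le_one (by linarith)]; linarith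
    simp only [hu]
    linarith
  have hkey : ∀ n, n₀ ≤ n → (u (n + 1) - 1) * u n ≤ ρ n := by
    intro n hn
    obtain ⟨h1, h2, h3⟩ := h n hn
    refine le_trans ?_ h1
    have hn0 : (1 : ℝ) ≤ n := by exact_mod_cast h3
    have hn1 : (0 : ℝ) < n := by linarith
    obtain ⟨a1, a2, a3⟩ := hs0 n h3
    obtain ⟨b1, b2, b3⟩ := hs0 (n + 1) (by omega)
    push_cast at b2
    set x := s n
    set z := s (n + 1)
    have hx : x ^ 2 = 1 / n := by field_simp; exact a2
    have hz : z ^ 2 = 1 / (n + 1) := by field_simp; exact b2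
    have hzx : z ≤ x := by
      apply abs_le_of_sq_le_sq' _ a1.le |>.2
      rw [hx, hz]
      exact one_div_le_one_div_of_le hn1 (by linarith)
    have hdiff : (x - z) * (x + z) = x ^ 2 * z ^ 2 := by
      have : (x - z) * (x + z) = x ^ 2 - z ^ 2 := by ring
      rw [this, hx, hz]; field_simp; ring
    have hd1 : x * z ^ 2 / 2 ≤ x - z := by
      have h4 : x ^ 2 * z ^ 2 ≤ (x - z) * (2 * x) := by
        rw [← hdiff]; exact mul_le_mul_of_nonneg_left (by linarith) (by linarith)
      have h5 : x * (x * z ^ 2) ≤ x * (2 * (x - z)) := by linarith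
      have := le_of_mul_le_mul_left h5 a1
      linarith
    have hd2 : x / 4 ≤ (n + 1 / 2) * (x - z) := by
      have h4 : 1 / 2 ≤ (n + 1 / 2) * z ^ 2 := by nlinarith
      nlinarith
    have hsmall : (5 + 32 * K) * x ≤ 1 := by
      have := (lt_div_iff₀ (by positivity)).1 h2
      linarith
    have hmain : x * z + 1 / (4 * n) + 4 * K * (n + 1) / n ^ 2 ≤ (n + 1 / 2) * (x - z) := by
      refine le_trans ?_ hd2
      have h4 : x * z ≤ x ^ 2 := by nlinarith
      have h5 : 1 / (4 * (n : ℝ)) = x ^ 2 / 4 := by rw [hx]; field_simp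
      have h6 : 4 * K * (n + 1) / n ^ 2 ≤ 8 * K * x ^ 2 := by
        rw [hx, div_le_iff₀ (by positivity)]
        have : 8 * K * (1 / (n : ℝ)) * n ^ 2 = 8 * K * n := by field_simp
        rw [this]
        nlinarith
      nlinarith
    have e1 : (u (n + 1) - 1) * u n = -(1 / 4) +
        (-(1 / 4) - (n + 1 / 2) * (x - z) + x * z) / (4 * (n * (n + 1))) := by
      simp only [hu]
      push_cast
      change ((1 + (1 / 2 + z) / ((n : ℝ) + 1)) / 2 - 1) * ((1 + (1 / 2 + x) / n) / 2) = _
      field_simp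
      ring
    have e2 : -(1 / 4) - 1 / (16 * (n : ℝ) ^ 2) - K / (n : ℝ) ^ 3 = -(1 / 4) +
        (-(1 / 4) - 1 / (4 * n) - 4 * K * (n + 1) / n ^ 2) / (4 * (n * (n + 1))) := by
      field_simp
      ring
    rw [e1, e2]
    gcongr
    linarith
  obtain ⟨f, ha, hb, hf⟩ := exists_solution (fun _ => 1) ρ n₀ 1 (u n₀)
  refine .of_eventually_pos (eventually_atTop.2 ⟨n₀, hf⟩) (eventually_atTop.2 ⟨n₀, fun n hn => ?_⟩) hτ N
  suffices 0 < f n ∧ u n * f n ≤ f (n + 1) from this.1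
  induction n, hn using Nat.le_induction with
  | base => simp [ha, hb]
  | succ n hn ih =>
    have hn1 := (h n hn).2.2
    refine ⟨lt_of_lt_of_le (mul_pos (hu0 n hn1) ih.1) ih.2, ?_⟩
    rw [show n + 1 + 1 = n + 2 by ring, hf n hn]
    have h1 := mul_le_mul_of_nonneg_right (hkey n hn) ih.1.le
    have h2 := hu1 (n + 1) (by omega)
    nlinarith [ih.2]

/-! ### Oscillation -/

/-- In the parabolic case, no solution is eventually positive along an arithmetic progression. -/
theorem not_gapPos_of_parabolic {ρ : ℕ → ℝ} {c : ℝ} (hc : 1 / 16 < c)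
    (hlim : Tendsto ρ atTop (𝓝 (-(1 / 4))))
    (hρ : ∀ᶠ n : ℕ in atTop, ρ n ≤ -(1 / 4) - c / (n : ℝ) ^ 2) {τ : ℕ} (hτ : 1 ≤ τ) (N : ℕ) :
    ¬ GapPos (fun _ => 1) ρ τ N := by
  rintro ⟨g, hg, hpos⟩
  have hg' : ∀ᶠ n in atTop, g (n + 2) = g (n + 1) + ρ n * g n := by simpa using hg
  have hden : ∀ k, 1 ≤ k → ∀ᶠ n in atTop, 0 < seqDen (fun _ => 1) ρ k n := by
    intro k hk
    refine (tendsto_seqDen_seqNum hlim k).1.eventually_const_lt ?_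
    rw [fib_neg_quarter]
    have : (0 : ℝ) < k := by exact_mod_cast hk
    positivity
  have hnum : ∀ k, 2 ≤ k → ∀ᶠ n in atTop, seqNum (fun _ => 1) ρ k n < 0 := by
    intro k hk
    refine (tendsto_seqDen_seqNum hlim k).2.eventually_lt_const ?_
    rw [fib_neg_quarter, fib_neg_quarter]
    have : (2 : ℝ) ≤ k := by exact_mod_cast hk
    have e : 2 * ((k + 1 : ℕ) : ℝ) / 2 ^ (k + 1) - 2 * k / 2 ^ k = (1 - k) / 2 ^ k := by
      push_cast
      field_simp
      ring
    rw [e]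
    exact div_neg_of_neg_of_pos (by linarith) (by positivity)
  have hall : ∀ᶠ n in atTop, ∀ k ∈ Finset.Icc 2 (τ + 1),
      0 < seqDen (fun _ => 1) ρ k n ∧ seqNum (fun _ => 1) ρ k n < 0 ∧
      g (n + k) = seqDen (fun _ => 1) ρ k n * g (n + 1) + seqNum (fun _ => 1) ρ k n * g n := by
    rw [Filter.eventually_all_finset]
    intro k hk
    rw [Finset.mem_Icc] at hk
    filter_upwards [hden k (by omega), hnum k hk.1, eventually_gap_formula hg k] with n h1 h2 h3
      using ⟨h1, h2, h3⟩
  obtain ⟨m₀, hm⟩ := eventually_atTop.1 hpos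
  obtain ⟨n₁, hn₁⟩ := eventually_atTop.1 hall
  -- If g(n) > 0 ≥ g(n+1), then the signs B^(k) > 0 > A^(k) make g(n+k) negative for 2 ≤ k ≤ τ + 1.
  -- These are τ consecutive indices, so one of them lies in τℕ + N, where g is positive.
  have hstep : ∀ n, n₁ + τ * m₀ + N ≤ n → 0 < g n → 0 < g (n + 1) := by
    intro n hn h0
    by_contra! h1
    set j := (n + 1 - N) / τ + 1 with hj
    have h2 := Nat.div_add_mod (n + 1 - N) τ
    have h3 := Nat.mod_lt (n + 1 - N) (by omega : τ > 0)
    have h4 : τ * j = τ * ((n + 1 - N) / τ) + τ := by rw [hj]; ring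
    have hmj : m₀ ≤ j := by
      have : τ * m₀ ≤ τ * j := by omega
      exact Nat.le_of_mul_le_mul_left this hτ
    have h5 := hm j hmj
    obtain ⟨k, hk⟩ := Nat.exists_eq_add_of_le (show n + 2 ≤ τ * j + N by omega)
    obtain ⟨a1, a2, a3⟩ := hn₁ n (by omega) (k + 2) (Finset.mem_Icc.2 ⟨by omega, by omega⟩)
    rw [hk, show n + 2 + k = n + (k + 2) by ring, a3] at h5
    nlinarith
  obtain ⟨n₂, hn₂⟩ : ∃ n, n₁ + τ * m₀ + N ≤ n ∧ 0 < g n :=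
    ⟨τ * (n₁ + m₀) + N, by nlinarith, hm _ (by omega)⟩
  refine no_pos_solution hc hρ hg' (eventually_atTop.2 ⟨n₂, fun n hn => ?_⟩)
  induction n, hn using Nat.le_induction with
  | base => exact hn₂.2
  | succ n hn ih => exact hstep n (by omega) ih

/-- An elliptic linear system with slow rotation has no solution with positive first component. -/
theorem no_pos_elliptic_system {A B A' B' h k : ℕ → ℝ} {y e c C : ℝ} (he : e ^ 2 = 1)
    (hy : y < -(1 / 4)) (hc : 0 < c)
    (hh : ∀ᶠ j in atTop, h (j + 1) = A j * h j + B j * k j)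
    (hk : ∀ᶠ j in atTop, k (j + 1) = A' j * h j + B' j * k j)
    (hpos : ∀ᶠ j in atTop, 0 < h j)
    (hB : ∀ᶠ j : ℕ in atTop, B j ≤ -(c / (j + 1))) (hBC : ∀ᶠ j in atTop, -C ≤ B j)
    (hAC : ∀ᶠ j in atTop, A j ≤ C)
    (hA' : Tendsto (fun j => (A' j - y * B j) / B j) atTop (𝓝 0))
    (hB' : Tendsto (fun j => (B' j - A j - e * B j) / B j) atTop (𝓝 0)) : False := by
  set δ : ℝ := min (1 / 16) ((-y - 1 / 4) / 8) with hδ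
  have hδ0 : 0 < δ := lt_min (by norm_num) (by linarith)
  have hδ1 : δ ≤ 1 / 16 := min_le_left _ _
  have hδ2 : 8 * δ ≤ -y - 1 / 4 := by
    have : δ ≤ _ := min_le_right (1 / 16) ((-y - 1 / 4) / 8)
    linarith
  have hA'' := hA'.eventually (Metric.closedBall_mem_nhds 0 hδ0)
  have hB'' := hB'.eventually (Metric.closedBall_mem_nhds 0 hδ0)
  obtain ⟨j₀, H⟩ := eventually_atTop.1 (hh.and (hk.and (hpos.and (hB.and (hBC.and (hAC.and
    (hA''.and hB'')))))))
  -- Up to the errors controlled by `hA'` and `hB'`, one has (w(j+1) - w(j))(A + Bw) = -B(w² - e w -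
  -- y). The quadratic has discriminant e² + 4y = 1 + 4y < 0. Positivity of A + Bw, which is
  -- h(j+1)/h(j), also yields the linear upper bound on w.
  set w : ℕ → ℝ := fun j => k j / h j with hw
  have hkey : ∀ j, j₀ ≤ j → 0 < A j + B j * w j ∧
      δ * (-B j) * (1 + w j ^ 2) ≤ (w (j + 1) - w j) * (A j + B j * w j) := by
    intro j hj
    obtain ⟨h1, h2, h3, h4, h5, h6, h7, h8⟩ := H j hj
    have h9 := (H (j + 1) (by omega)).2.2.1
    have hjp : (0 : ℝ) < c / (j + 1) := by positivity
    have hBneg : B j < 0 := by linarith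
    have e1 : A j + B j * w j = h (j + 1) / h j := by
      rw [h1]; simp only [hw]; field_simp
    have hden : 0 < A j + B j * w j := by rw [e1]; exact div_pos h9 h3
    refine ⟨hden, ?_⟩
    have e2 : w (j + 1) * (A j + B j * w j) = A' j + B' j * w j := by
      rw [e1]; simp only [hw]; rw [h2]; field_simp
    rw [sub_mul, e2]
    rw [dist_zero_right, Real.norm_eq_abs, abs_div, abs_of_neg hBneg,
      div_le_iff₀ (by linarith), abs_le] at h7 h8
    set x := w j
    have q2 : -(δ * (-B j) * ((1 + x ^ 2) / 2)) ≤ (B' j - A j - e * B j) * x := by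
      have hx : |x| ≤ (1 + x ^ 2) / 2 := by
        rw [abs_le]; constructor <;> nlinarith [sq_nonneg (x - 1), sq_nonneg (x + 1)]
      have h10 : |(B' j - A j - e * B j) * x| ≤ δ * (-B j) * ((1 + x ^ 2) / 2) := by
        rw [abs_mul]
        exact mul_le_mul (abs_le.2 h8) hx (abs_nonneg _) (mul_nonneg hδ0.le (by linarith))
      exact (abs_le.1 h10).1
    have q3 : 4 * δ * (1 + x ^ 2) ≤ x ^ 2 - e * x - y := by
      have q7 : 0 < 1 - 4 * δ := by linarith
      have q8 : (1 - 4 * δ) * (1 / 4 + 4 * δ) ≤ (1 - 4 * δ) * (-y - 4 * δ) :=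
        mul_le_mul_of_nonneg_left (by linarith) q7.le
      have q9 : 1 / 4 ≤ (1 - 4 * δ) * (1 / 4 + 4 * δ) := by nlinarith
      have q10 : (1 - 4 * δ) * (x ^ 2 - e * x - y - 4 * δ * (1 + x ^ 2)) =
          ((1 - 4 * δ) * x - e / 2) ^ 2 + (1 - 4 * δ) * (-y - 4 * δ) - e ^ 2 / 4 := by ring
      have q11 : 0 ≤ (1 - 4 * δ) * (x ^ 2 - e * x - y - 4 * δ * (1 + x ^ 2)) := by
        rw [q10, he]
        linarith [sq_nonneg ((1 - 4 * δ) * x - e / 2)]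
      linarith [nonneg_of_mul_nonneg_right q11 q7]
    have q4 := mul_le_mul_of_nonneg_left q3 (by linarith : 0 ≤ -B j)
    have q5 : 0 ≤ δ * (-B j) := mul_nonneg hδ0.le (by linarith)
    have q6 : 0 ≤ δ * (-B j) * x ^ 2 := mul_nonneg q5 (sq_nonneg x)
    linarith [h7.1]
  have hBneg : ∀ j, j₀ ≤ j → B j < 0 ∧ c / (j + 1) ≤ -B j := by
    intro j hj
    have h4 := (H j hj).2.2.2.1
    have hjp : (0 : ℝ) < c / (j + 1) := by positivity
    exact ⟨by linarith, by linarith⟩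
  have hinc : ∀ j, j₀ ≤ j → w j ≤ w (j + 1) := by
    intro j hj
    obtain ⟨h1, h2⟩ := hkey j hj
    have := (hBneg j hj).1
    have h3 : 0 ≤ δ * (-B j) * (1 + w j ^ 2) :=
      mul_nonneg (mul_nonneg hδ0.le (by linarith)) (by positivity)
    by_contra! h4
    nlinarith
  have hmono : ∀ j, j₀ ≤ j → w j₀ ≤ w j := by
    intro j hj
    induction j, hj using Nat.le_induction with
    | base => exact le_rfl
    | succ j hj ih => exact ih.trans (hinc j hj)
  set C' : ℝ := |C| * (1 + |w j₀|) + 1 with hC'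
  have hC'0 : 0 < C' := by positivity
  refine not_quadratic_growth (w := w) (c := δ * c / C') (C := |C| / c) (by positivity) ?_ ?_
  · filter_upwards [eventually_ge_atTop j₀] with j hj
    obtain ⟨h1, h2⟩ := hkey j hj
    obtain ⟨h3, h4⟩ := hBneg j hj
    obtain ⟨-, -, -, -, h5, h6, -⟩ := H j hj
    have hle : A j + B j * w j ≤ C' := by
      have h7 : B j * w j ≤ B j * w j₀ := mul_le_mul_of_nonpos_left (hmono j hj) h3.le
      have h8 : B j * w j₀ ≤ |C| * |w j₀| := by
        have : |B j * w j₀| ≤ |C| * |w j₀| := by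
          rw [abs_mul, abs_of_neg h3]
          exact mul_le_mul_of_nonneg_right ((by linarith : -B j ≤ C).trans (le_abs_self C)) (abs_nonneg _)
        exact (le_abs_self _).trans this
      have := le_abs_self C
      rw [hC']; linarith
    have h9 : δ * (c / (j + 1)) * (1 + w j ^ 2) ≤ (w (j + 1) - w j) * C' := by
      calc δ * (c / (j + 1)) * (1 + w j ^ 2) ≤ δ * (-B j) * (1 + w j ^ 2) := by gcongr
        _ ≤ _ := h2
        _ ≤ _ := mul_le_mul_of_nonneg_left hle (by linarith [hinc j hj])
    have h10 : δ * c / C' * (1 + w j ^ 2) / (j + 1) = δ * (c / (j + 1)) * (1 + w j ^ 2) / C' := by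
      field_simp
    have h11 := (div_le_iff₀ hC'0).2 h9
    linarith
  · filter_upwards [eventually_ge_atTop j₀] with j hj
    obtain ⟨h1, h2⟩ := hkey j hj
    obtain ⟨h3, h4⟩ := hBneg j hj
    obtain ⟨-, -, -, -, h5, h6, -⟩ := H j hj
    have hjp : (0 : ℝ) < (j : ℝ) + 1 := by positivity
    rcases le_or_gt (w j) 0 with h7 | h7
    · exact h7.trans (by positivity)
    · rw [div_mul_eq_mul_div, le_div_iff₀ hc]
      have h8 : c / (j + 1) * w j ≤ -B j * w j := mul_le_mul_of_nonneg_right h4 h7.le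
      have h9 : c / (j + 1) * w j ≤ |C| := by
        have := le_abs_self C
        linarith
      rw [div_mul_eq_mul_div, div_le_iff₀ hjp] at h9
      linarith

/-! ### Elliptic recurrences -/

/-- For constant coefficients, A^(τ+1) = y B^(τ) and B^(τ+1) - A^(τ) = B^(τ). It suffices that these
relations hold up to errors small compared with B^(τ), and that B^(τ) is at least of order 1/n. The
scale s allows both nonzero limits (s = 1) and decay like 1/n (s = n). -/
theorem not_gapPos_of_scaled {ρ s : ℕ → ℝ} {y κ : ℝ} (hρ : Tendsto ρ atTop (𝓝 y))
    (hy : y < -(1 / 4)) {τ : ℕ} (hτ : 1 ≤ τ) (N : ℕ) (hs : ∀ᶠ n : ℕ in atTop, 0 < s n ∧ s n ≤ n + 1)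
    (hκ : κ ≠ 0) (hB : Tendsto (fun n => s n * seqDen (fun _ => 1) ρ τ n) atTop (𝓝 κ))
    (hA' : Tendsto (fun n => s n * (seqNum (fun _ => 1) ρ (τ + 1) n -
      y * seqDen (fun _ => 1) ρ τ n)) atTop (𝓝 0))
    (hB' : Tendsto (fun n => s n * (seqDen (fun _ => 1) ρ (τ + 1) n -
      seqNum (fun _ => 1) ρ τ n - seqDen (fun _ => 1) ρ τ n)) atTop (𝓝 0)) :
    ¬ GapPos (fun _ => 1) ρ τ N := by
  rintro ⟨g, hg, hpos⟩
  set B := seqDen (fun _ => 1) ρ τ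
  set A := seqNum (fun _ => 1) ρ τ
  set B' := seqDen (fun _ => 1) ρ (τ + 1)
  set A' := seqNum (fun _ => 1) ρ (τ + 1)
  have hlimB : Tendsto B atTop (𝓝 _) := (tendsto_seqDen_seqNum hρ τ).1
  have hlimA : Tendsto A atTop (𝓝 _) := (tendsto_seqDen_seqNum hρ τ).2
  have hgap := tendsto_gap hτ N
  have q : ∀ F : ℕ → ℝ, Tendsto (fun n => s n * F n) atTop (𝓝 0) →
      Tendsto (fun n => F n / B n) atTop (𝓝 0) := by
    intro F hF
    have := hF.div hB hκ
    rw [zero_div] at this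
    refine this.congr' ?_
    filter_upwards [hs] with n h1
    have := h1.1.ne'
    rw [Pi.div_apply]
    field_simp
  obtain ⟨C₁, hC₁⟩ : ∃ C, ∀ᶠ n in atTop, |B n| ≤ C :=
    ⟨_, (hlimB.abs.eventually_lt_const (lt_add_one _)).mono fun n h => h.le⟩
  obtain ⟨C₂, hC₂⟩ : ∃ C, ∀ᶠ n in atTop, A n ≤ C :=
    ⟨_, (hlimA.eventually_lt_const (lt_add_one _)).mono fun n h => h.le⟩
  have hbound : ∀ c : ℝ, 0 < c → ∀ᶠ j : ℕ in atTop, ∀ x : ℝ, c ≤ s (τ * j + N) * x →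
      c / (τ + N + 1) / (j + 1) ≤ x := by
    intro c hc
    filter_upwards [hgap.eventually hs] with j h1 x hx
    obtain ⟨h2, h3⟩ := h1
    have hx0 : 0 < x := by
      by_contra! h
      nlinarith
    rw [div_div, div_le_iff₀ (by positivity), mul_comm]
    refine hx.trans (mul_le_mul_of_nonneg_right (h3.trans ?_) hx0.le)
    have h4 : (0 : ℝ) ≤ j := Nat.cast_nonneg j
    have h5 : (0 : ℝ) ≤ τ := Nat.cast_nonneg τ
    have h6 : (0 : ℝ) ≤ N := Nat.cast_nonneg N
    push_cast
    nlinarith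
  have hrec1 : ∀ᶠ j in atTop, g (τ * (j + 1) + N) =
      A (τ * j + N) * g (τ * j + N) + B (τ * j + N) * g (τ * j + N + 1) := by
    filter_upwards [hgap.eventually (eventually_gap_formula hg τ)] with j h
    rw [show τ * (j + 1) + N = τ * j + N + τ by ring, h, add_comm]
  have hrec2 : ∀ᶠ j in atTop, g (τ * (j + 1) + N + 1) =
      A' (τ * j + N) * g (τ * j + N) + B' (τ * j + N) * g (τ * j + N + 1) := by
    filter_upwards [hgap.eventually (eventually_gap_formula hg (τ + 1))] with j h
    rw [show τ * (j + 1) + N + 1 = τ * j + N + (τ + 1) by ring, h, add_comm]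
  have hc : 0 < |κ| / 2 / (τ + N + 1) := by positivity
  rcases lt_or_gt_of_ne hκ with hκ' | hκ'
  · have h1 : ∀ᶠ n in atTop, |κ| / 2 ≤ s n * -B n := by
      have : -|κ| / 2 > κ := by rw [abs_of_neg hκ']; linarith
      filter_upwards [hB.eventually_lt_const this] with n hn
      linarith
    refine no_pos_elliptic_system (A := fun j => A (τ * j + N)) (B := fun j => B (τ * j + N))
      (A' := fun j => A' (τ * j + N)) (B' := fun j => B' (τ * j + N)) (h := fun j => g (τ * j + N))
      (k := fun j => g (τ * j + N + 1)) (y := y) (e := 1) (C := max C₁ C₂) (by norm_num) hy hc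
      hrec1 hrec2 hpos ?_ ?_ ?_ ((q _ hA').comp hgap) ?_
    · filter_upwards [hgap.eventually h1, hbound _ (by positivity : 0 < |κ| / 2)] with j h2 h3
      have := h3 _ h2
      linarith
    · filter_upwards [hgap.eventually hC₁] with j h
      have h2 := (abs_le.1 h).1
      have := le_max_left C₁ C₂
      linarith
    · filter_upwards [hgap.eventually hC₂] with j h using h.trans (le_max_right _ _)
    · refine ((q _ hB').comp hgap).congr fun j => ?_
      simp
  · have h1 : ∀ᶠ n in atTop, |κ| / 2 ≤ s n * B n := by
      have : |κ| / 2 < κ := by rw [abs_of_pos hκ']; linarith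
      filter_upwards [hB.eventually_const_lt this] with n hn using hn.le
    -- The system lemma wants B < 0. Replacing the second component by its negative flips the signs
    -- of B and A', and hence turns e into -1.
    refine no_pos_elliptic_system (A := fun j => A (τ * j + N)) (B := fun j => -B (τ * j + N))
      (A' := fun j => -A' (τ * j + N)) (B' := fun j => B' (τ * j + N)) (h := fun j => g (τ * j + N))
      (k := fun j => -g (τ * j + N + 1)) (y := y) (e := -1) (C := max C₁ C₂) (by norm_num) hy hc
      ?_ ?_ hpos ?_ ?_ ?_ ?_ ?_
    · filter_upwards [hrec1] with j h
      rw [h]; ring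
    · filter_upwards [hrec2] with j h
      rw [h]; ring
    · filter_upwards [hgap.eventually h1, hbound _ (by positivity : 0 < |κ| / 2)] with j h2 h3
      have := h3 _ h2
      linarith
    · filter_upwards [hgap.eventually hC₁] with j h
      have h2 := (abs_le.1 h).2
      have := le_max_left C₁ C₂
      linarith
    · filter_upwards [hgap.eventually hC₂] with j h using h.trans (le_max_right _ _)
    · refine ((q _ hA').comp hgap).congr fun j => ?_
      simp only [Function.comp]
      rw [← neg_div_neg_eq]
      ring
    · have := ((q _ hB').comp hgap).neg
      rw [neg_zero] at this
      refine this.congr fun j => ?_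
      simp only [Function.comp]
      rw [div_neg]
      ring

theorem not_gapPos_of_fib_ne_zero {ρ : ℕ → ℝ} {y : ℝ} (hρ : Tendsto ρ atTop (𝓝 y))
    (hy : y < -(1 / 4)) {τ : ℕ} (hτ : 1 ≤ τ) (N : ℕ) (h0 : fib y τ ≠ 0) :
    ¬ GapPos (fun _ => 1) ρ τ N := by
  have h1 := tendsto_seqDen_seqNum hρ τ
  have h2 := tendsto_seqDen_seqNum hρ (τ + 1)
  refine not_gapPos_of_scaled (s := fun _ => 1) hρ hy hτ N (.of_forall fun n => by simp) h0 ?_ ?_ ?_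
  · simpa using h1.1
  · have := h2.2.sub (h1.1.const_mul y)
    have e : fib y (τ + 1 + 1) = fib y (τ + 1) + y * fib y τ := rfl
    rw [e] at this
    simpa using this
  · have := (h2.1.sub h1.2).sub h1.1
    simpa using this

/-- At the limit the τ-step map is scalar, but the term a/n moves it off this resonance: B^(τ)(n) =
fib(y + a/n, τ) + O(1/n²) behaves like aD/n. These rotations of size 1/n have a divergent sum, so
the scale s = n applies. -/
theorem not_gapPos_of_drift {ρ : ℕ → ℝ} {y a D : ℝ} (hy : y < -(1 / 4)) (ha : a ≠ 0)
    (hρ : ∀ i : ℕ, (fun n : ℕ => ρ (n + i) - (y + a / n)) =O[atTop] fun n : ℕ => ((n : ℝ) ^ 2)⁻¹)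
    {τ : ℕ} (hτ : 1 ≤ τ) (N : ℕ) (h0 : fib y τ = 0) (hD : HasDerivAt (fun y => fib y τ) D y)
    (hD0 : D ≠ 0) : ¬ GapPos (fun _ => 1) ρ τ N := by
  have hcast : Tendsto (fun n : ℕ => (n : ℝ)) atTop atTop := tendsto_natCast_atTop_atTop
  have hsq : Tendsto (fun n : ℕ => ((n : ℝ) ^ 2)⁻¹) atTop (𝓝 0) :=
    ((tendsto_pow_atTop (by norm_num)).comp hcast).inv_tendsto_atTop
  have hdiv : Tendsto (fun n : ℕ => a / n) atTop (𝓝 0) := tendsto_const_nhds.div_atTop hcast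
  have hYlim : Tendsto (fun n : ℕ => y + a / n) atTop (𝓝 y) := by simpa using hdiv.const_add y
  have hlim : Tendsto ρ atTop (𝓝 y) := by
    have := ((hρ 0).trans_tendsto hsq).add hYlim
    simpa using this
  have hfr := fun k => seqDen_seqNum_sub_fib_isBigO (ρ := ρ) (Y := fun n : ℕ => y + a / n)
    (hYlim.isBigO_one ℝ) (hsq.isBigO_one ℝ) hρ k
  have hO : ∀ F : ℕ → ℝ, F =O[atTop] (fun n : ℕ => ((n : ℝ) ^ 2)⁻¹) →
      Tendsto (fun n : ℕ => (n : ℝ) * F n) atTop (𝓝 0) := by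
    intro F hF
    have h1 : (fun n : ℕ => (n : ℝ) * F n) =O[atTop] fun n : ℕ => (n : ℝ) * ((n : ℝ) ^ 2)⁻¹ :=
      (isBigO_refl _ _).mul hF
    refine h1.trans_tendsto (hcast.inv_tendsto_atTop.congr' ?_)
    filter_upwards [eventually_gt_atTop 0] with n hn
    have : (0 : ℝ) < n := by exact_mod_cast hn
    simp only [Pi.inv_apply]
    field_simp
  have hfibY : Tendsto (fun n : ℕ => (n : ℝ) * fib (y + a / n) τ) atTop (𝓝 (a * D)) := by
    have h1 : Tendsto (fun n : ℕ => a / (n : ℝ)) atTop (𝓝[≠] 0) := by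
      refine tendsto_nhdsWithin_iff.2 ⟨hdiv, ?_⟩
      filter_upwards [eventually_gt_atTop 0] with n hn
      have : (0 : ℝ) < n := by exact_mod_cast hn
      exact div_ne_zero ha this.ne'
    have h2 := (hD.tendsto_slope_zero.comp h1).const_mul a
    refine h2.congr' ?_
    filter_upwards [eventually_gt_atTop 0] with n hn
    have : (0 : ℝ) < n := by exact_mod_cast hn
    simp only [Function.comp, h0, smul_eq_mul]
    field_simp
    ring
  have hB : Tendsto (fun n : ℕ => (n : ℝ) * seqDen (fun _ => 1) ρ τ n) atTop (𝓝 (a * D)) := by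
    have := (hO _ (hfr τ).1).add hfibY
    rw [zero_add] at this
    exact this.congr fun n => by ring
  refine not_gapPos_of_scaled (s := fun n => (n : ℝ)) hlim hy hτ N ?_ (mul_ne_zero ha hD0) hB ?_ ?_
  · filter_upwards [eventually_gt_atTop 0] with n hn
    exact ⟨by exact_mod_cast hn, by simp⟩
  · have h1 := (hO _ (hfr (τ + 1)).2).sub ((hO _ (hfr τ).1).const_mul y)
    have h2 := h1.add (hdiv.mul hfibY)
    simp only [mul_zero, zero_mul, sub_zero, add_zero] at h2
    refine h2.congr fun n => ?_
    have e : fib (y + a / n) (τ + 1 + 1) =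
      fib (y + a / n) (τ + 1) + (y + a / n) * fib (y + a / n) τ := rfl
    rw [e]
    ring
  · have h1 := ((hO _ (hfr (τ + 1)).1).sub (hO _ (hfr τ).2)).sub (hO _ (hfr τ).1)
    simp only [sub_zero] at h1
    exact h1.congr fun n => by ring

/-- At a zero of `fib · τ` of the form `-1 / (4 cos² φ)` the derivative does not vanish. -/
theorem fib_deriv_ne_zero {φ y D : ℝ} (hc : Real.cos φ ≠ 0)
    (hy : y = -(1 / (4 * Real.cos φ ^ 2))) {τ : ℕ} (hτ : 1 ≤ τ) (hsin : Real.sin (τ * φ) = 0)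
    (h0 : fib y τ = 0) (hD : HasDerivAt (fun y => fib y τ) D y) : D ≠ 0 := by
  -- If D were 0, then differentiating fib · (2 cos x)^τ sin x = 2 cos x sin(τx) at φ would give 0
  -- on the left and 2τ cos φ cos(τφ) ≠ 0 on the right.
  rintro rfl
  have hY : HasDerivAt (fun x => -(1 / (4 * Real.cos x ^ 2)))
      (deriv (fun x => -(1 / (4 * Real.cos x ^ 2))) φ) φ := by
    refine DifferentiableAt.hasDerivAt ?_
    have : 4 * Real.cos φ ^ 2 ≠ 0 := by positivity
    have h : DifferentiableAt ℝ (fun x => 4 * Real.cos x ^ 2) φ := by fun_prop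
    exact ((differentiableAt_const (1 : ℝ)).div h this).neg
  have hF : HasDerivAt (fun x => fib (-(1 / (4 * Real.cos x ^ 2))) τ)
      (0 * deriv (fun x => -(1 / (4 * Real.cos x ^ 2))) φ) φ := by
    rw [hy] at hD
    exact HasDerivAt.comp φ hD hY
  have hG : HasDerivAt (fun x => (2 * Real.cos x) ^ τ * Real.sin x)
      (deriv (fun x => (2 * Real.cos x) ^ τ * Real.sin x) φ) φ :=
    DifferentiableAt.hasDerivAt (by fun_prop)
  have hL := hF.mul hG
  have hR : HasDerivAt (fun x => 2 * Real.cos x * Real.sin (τ * x))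
      (2 * -Real.sin φ * Real.sin (τ * φ) + 2 * Real.cos φ * (Real.cos (τ * φ) * τ)) φ := by
    refine HasDerivAt.mul ((Real.hasDerivAt_cos φ).const_mul 2) ?_
    exact (hasDerivAt_const_mul (τ : ℝ)).sin
  have heq : (fun x => fib (-(1 / (4 * Real.cos x ^ 2))) τ) * (fun x => (2 * Real.cos x) ^ τ * Real.sin x)
      =ᶠ[𝓝 φ] fun x => 2 * Real.cos x * Real.sin (τ * x) := by
    filter_upwards [Real.continuous_cos.continuousAt.eventually_ne hc] with x hx
    have := fib_mul_sin hx rfl τ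
    simp only [Pi.mul_apply]
    rw [← this]
    ring
  have h1 := (hR.congr_of_eventuallyEq heq).unique hL
  have h2 : fib (-(1 / (4 * Real.cos φ ^ 2))) τ = 0 := by rw [← hy]; exact h0
  rw [h2, hsin] at h1
  simp only [mul_zero, zero_mul, zero_add] at h1
  have h3 : Real.cos (τ * φ) ≠ 0 := by
    intro h4
    have := Real.sin_sq_add_cos_sq (τ * φ)
    rw [hsin, h4] at this
    norm_num at this
  have h4 : (τ : ℝ) ≠ 0 := by positivity
  exact absurd h1 (mul_ne_zero (mul_ne_zero two_ne_zero hc) (mul_ne_zero h3 h4))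

/-- A linear system summably close to a positive multiple of the identity has a solution with
positive first component. -/
theorem gapPos_of_near_scalar {ρ : ℕ → ℝ} {σ : ℝ} (hσ : 0 < σ) {τ : ℕ} (hτ : 1 ≤ τ) (N : ℕ)
    (hB : seqDen (fun _ => 1) ρ τ =O[atTop] fun n : ℕ => ((n : ℝ) ^ 2)⁻¹)
    (hA : (fun n => seqNum (fun _ => 1) ρ τ n - σ) =O[atTop] fun n : ℕ => ((n : ℝ) ^ 2)⁻¹)
    (hB' : (fun n => seqDen (fun _ => 1) ρ (τ + 1) n - σ) =O[atTop] fun n : ℕ => ((n : ℝ) ^ 2)⁻¹)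
    (hA' : seqNum (fun _ => 1) ρ (τ + 1) =O[atTop] fun n : ℕ => ((n : ℝ) ^ 2)⁻¹) :
    GapPos (fun _ => 1) ρ τ N := by
  have hb : ∀ F : ℕ → ℝ, F =O[atTop] (fun n : ℕ => ((n : ℝ) ^ 2)⁻¹) → ∃ C, 0 < C ∧
      ∀ᶠ j : ℕ in atTop, |F (τ * j + N)| ≤ C / (j : ℝ) ^ 2 := by
    intro F hF
    obtain ⟨C, hC, h⟩ := hF.exists_pos
    refine ⟨C, hC, ?_⟩
    filter_upwards [(tendsto_gap hτ N).eventually h.bound, eventually_gt_atTop 0] with j h1 h2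
    have h3 : (0 : ℝ) < j := by exact_mod_cast h2
    have h4 : (j : ℝ) ≤ ((τ * j + N : ℕ) : ℝ) := by exact_mod_cast (by nlinarith)
    have h5 : 0 ≤ (((τ * j + N : ℕ) : ℝ) ^ 2)⁻¹ := by positivity
    rw [Real.norm_eq_abs, Real.norm_eq_abs, abs_of_nonneg h5] at h1
    refine h1.trans ?_
    rw [div_eq_mul_inv]
    gcongr
  obtain ⟨C₁, p₁, h₁⟩ := hb _ hB
  obtain ⟨C₂, p₂, h₂⟩ := hb _ hA
  obtain ⟨C₃, p₃, h₃⟩ := hb _ hB'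
  obtain ⟨C₄, p₄, h₄⟩ := hb _ hA'
  set C := C₁ + C₂ + C₃ + C₄ with hC
  have hC0 : 0 < C := by positivity
  -- The cone |k| ≤ (1 - L/j) h is propagated. One step costs at most 4ε with ε = C/j², and widening
  -- the cone from j to j + 1 gains σL / (j(j+1)) = 8C / (j(j+1)) ≥ 4ε.
  set L := 8 * C / σ with hL
  have hL0 : 0 < L := by positivity
  have hσL : σ * L = 8 * C := by rw [hL]; field_simp
  obtain ⟨m, hm⟩ := exists_nat_gt L
  have hsm : Tendsto (fun j : ℕ => 2 * C / (j : ℝ) ^ 2) atTop (𝓝 0) :=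
    tendsto_const_nhds.div_atTop ((tendsto_pow_atTop (by norm_num)).comp tendsto_natCast_atTop_atTop)
  obtain ⟨j₀, H⟩ := eventually_atTop.1 (h₁.and (h₂.and (h₃.and (h₄.and ((eventually_gt_atTop 0).and
    ((eventually_ge_atTop m).and (hsm.eventually_lt_const hσ)))))))
  obtain ⟨g, ha, hb, hg⟩ := exists_solution (fun _ => 1) ρ (τ * j₀ + N) 1 0
  refine ⟨g, eventually_atTop.2 ⟨_, hg⟩, eventually_atTop.2 ⟨j₀, fun j hj => ?_⟩⟩
  suffices 0 < g (τ * j + N) ∧ |g (τ * j + N + 1)| ≤ (1 - L / j) * g (τ * j + N) from this.1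
  have hLj : ∀ j, j₀ ≤ j → L / j ≤ 1 := by
    intro j hj
    obtain ⟨-, -, -, -, h5, h6, -⟩ := H j hj
    have h7 : (0 : ℝ) < j := by exact_mod_cast h5
    have h8 : (m : ℝ) ≤ j := by exact_mod_cast h6
    rw [div_le_one h7]
    linarith
  induction j, hj using Nat.le_induction with
  | base =>
    rw [ha, hb]
    have := hLj j₀ le_rfl
    simpa using this
  | succ j hj ih =>
    obtain ⟨b1, b2, b3, b4, h5, h6, h7⟩ := H j hj
    have hj0 : (0 : ℝ) < j := by exact_mod_cast h5
    have hnj : τ * j₀ + N ≤ τ * j + N := by gcongr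
    have r1 := gap_formula hg τ hnj
    have r2 := gap_formula hg (τ + 1) hnj
    rw [show τ * j + N + τ = τ * (j + 1) + N by ring] at r1
    rw [show τ * j + N + (τ + 1) = τ * (j + 1) + N + 1 by ring] at r2
    set ε := C / (j : ℝ) ^ 2 with hε
    have hε0 : 0 < ε := by positivity
    have hεle : ∀ {c x : ℝ}, |x| ≤ c / (j : ℝ) ^ 2 → c ≤ C → |x| ≤ ε := by
      intro c x h1 h2
      refine h1.trans ?_
      rw [hε]
      gcongr
    have c1 := hεle b1 (by linarith)
    have c2 := hεle b2 (by linarith)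
    have c3 := hεle b3 (by linarith)
    have c4 := hεle b4 (by linarith)
    have h2ε : 2 * ε < σ := by
      have : 2 * C / (j : ℝ) ^ 2 = 2 * ε := by rw [hε]; ring
      linarith
    obtain ⟨i1, i2⟩ := ih
    set h := g (τ * j + N)
    set k := g (τ * j + N + 1)
    have hLj1 := hLj j hj
    have hLj0 : 0 < L / j := by positivity
    have hk : |k| ≤ h := i2.trans (by nlinarith)
    have hprod : ∀ {x y b : ℝ}, |x| ≤ ε → |y| ≤ b → |x * y| ≤ ε * b := by
      intro x y b h1 h2
      rw [abs_mul]
      exact mul_le_mul h1 h2 (abs_nonneg _) hε0.le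
    have d1 := abs_le.1 (hprod c1 hk)
    have d2 := abs_le.1 (hprod c2 (abs_of_pos i1).le)
    have d3 := hprod c3 hk
    have d4 := hprod c4 (abs_of_pos i1).le
    have hlow : (σ - 2 * ε) * h ≤ g (τ * (j + 1) + N) := by
      rw [r1]
      have := d2.1
      linarith [d1.1]
    have hup : |g (τ * (j + 1) + N + 1)| ≤ (σ * (1 - L / j) + 2 * ε) * h := by
      have e : g (τ * (j + 1) + N + 1) = σ * k + ((seqDen (fun _ => 1) ρ (τ + 1) (τ * j + N) - σ) * k +
          seqNum (fun _ => 1) ρ (τ + 1) (τ * j + N) * h) := by rw [r2]; ring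
      rw [e]
      have h8 : |σ * k| ≤ σ * ((1 - L / j) * h) := by
        rw [abs_mul, abs_of_pos hσ]
        exact mul_le_mul_of_nonneg_left i2 hσ.le
      calc _ ≤ |σ * k| + (|(seqDen (fun _ => 1) ρ (τ + 1) (τ * j + N) - σ) * k| +
          |seqNum (fun _ => 1) ρ (τ + 1) (τ * j + N) * h|) :=
            (abs_add_le _ _).trans (add_le_add_right (abs_add_le _ _) _)
        _ ≤ _ := by linarith
    have hpos' : 0 < (σ - 2 * ε) * h := mul_pos (by linarith) i1
    refine ⟨hpos'.trans_le hlow, hup.trans ?_⟩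
    have hL1 := hLj (j + 1) (by omega)
    refine le_trans ?_ (mul_le_mul_of_nonneg_left hlow (by linarith))
    rw [← mul_assoc]
    refine mul_le_mul_of_nonneg_right ?_ i1.le
    push_cast
    have e1 : σ * (L / j) - σ * (L / (j + 1)) = 8 * C / (j * (j + 1)) := by
      rw [← hσL]; field_simp; ring
    have e2 : 4 * ε ≤ 8 * C / (j * (j + 1)) := by
      have h1j : (1 : ℝ) ≤ j := by exact_mod_cast h5
      rw [hε, mul_div_assoc', div_le_div_iff₀ (by positivity) (by positivity)]
      have : 0 ≤ C * j * (j - 1) := mul_nonneg (by positivity) (by linarith)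
      linarith
    have e3 : 0 ≤ ε * (L / (j + 1)) := by positivity
    linarith

/-- When 2rφ is a multiple of 2π, the frozen 2r-step map is (2 cos φ)^(-2r) times the identity.
Without a 1/n term in ρ, the true map differs from it by O(1/n²), which is summable. -/
theorem gapPos_of_elliptic {ρ : ℕ → ℝ} {φ y : ℝ} (hc : Real.cos φ ≠ 0) (hs : Real.sin φ ≠ 0)
    (hy : y = -(1 / (4 * Real.cos φ ^ 2))) {r : ℕ} (hr : 1 ≤ r) (hsin : Real.sin ((2 * r : ℕ) * φ) = 0)
    (hcos : Real.cos ((2 * r : ℕ) * φ) = 1)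
    (hρ : ∀ i : ℕ, (fun n : ℕ => ρ (n + i) - y) =O[atTop] fun n : ℕ => ((n : ℝ) ^ 2)⁻¹) (N : ℕ) :
    GapPos (fun _ => 1) ρ (2 * r) N := by
  have h2c : (2 * Real.cos φ) ≠ 0 := mul_ne_zero two_ne_zero hc
  have hp : (2 * Real.cos φ) ^ (2 * r) ≠ 0 := pow_ne_zero _ h2c
  have hF0 : fib y (2 * r) = 0 := by
    have := fib_mul_sin hc hy (2 * r)
    rw [hsin, mul_zero] at this
    simpa [hs, hp] using this
  have hF1 : fib y (2 * r + 1) = ((2 * Real.cos φ) ^ (2 * r))⁻¹ := by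
    have h1 := fib_mul_sin hc hy (2 * r + 1)
    have h2 : Real.sin (((2 * r + 1 : ℕ) : ℝ) * φ) = Real.sin φ := by
      have : ((2 * r + 1 : ℕ) : ℝ) * φ = (2 * r : ℕ) * φ + φ := by push_cast; ring
      rw [this, Real.sin_add, hsin, hcos]
      ring
    rw [h2, pow_succ] at h1
    field_simp
    have h3 : (2 * Real.cos φ * Real.sin φ) * (fib y (2 * r + 1) * (2 * Real.cos φ) ^ (2 * r)) =
        (2 * Real.cos φ * Real.sin φ) * 1 := by linarith
    exact mul_left_cancel₀ (mul_ne_zero h2c hs) h3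
  have hsq : Tendsto (fun n : ℕ => ((n : ℝ) ^ 2)⁻¹) atTop (𝓝 0) :=
    ((tendsto_pow_atTop (by norm_num)).comp tendsto_natCast_atTop_atTop).inv_tendsto_atTop
  have hfr := fun k => seqDen_seqNum_sub_fib_isBigO (ρ := ρ) (Y := fun _ : ℕ => y)
    (tendsto_const_nhds.isBigO_one ℝ) (hsq.isBigO_one ℝ) hρ k
  have hσ : 0 < fib y (2 * r + 1) := by
    rw [hF1, pow_mul]
    positivity
  have e : fib y (2 * r + 1 + 1) = fib y (2 * r + 1) + y * fib y (2 * r) := rfl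
  refine gapPos_of_near_scalar hσ (by omega) N ?_ ?_ ?_ ?_
  · simpa [hF0] using (hfr (2 * r)).1
  · simpa [hF0] using (hfr (2 * r)).2
  · exact (hfr (2 * r + 1)).1
  · simpa [e, hF0] using (hfr (2 * r + 1)).2

/-! ### Sequences of the form `1 + a / n + o(1 / n)` -/

/-- `f n = 1 + a / n + o(1 / n)`. -/
def NearOne (f : ℕ → ℝ) (a : ℝ) : Prop := Tendsto (fun n : ℕ => (n : ℝ) * (f n - 1)) atTop (𝓝 a)

theorem NearOne.congr {f g : ℕ → ℝ} {a : ℝ} (h : NearOne f a) (hfg : f =ᶠ[atTop] g) :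
    NearOne g a :=
  Tendsto.congr' (hfg.mono fun n hn => by simp only [hn]) h

theorem NearOne.tendsto {f : ℕ → ℝ} {a : ℝ} (h : NearOne f a) : Tendsto f atTop (𝓝 1) := by
  have h1 := (Tendsto.div_atTop h (tendsto_natCast_atTop_atTop (R := ℝ))).add_const 1
  rw [zero_add] at h1
  refine h1.congr' ?_
  filter_upwards [eventually_gt_atTop 0] with n hn
  have : (n : ℝ) ≠ 0 := by positivity
  field_simp
  ring

theorem NearOne.mul {f g : ℕ → ℝ} {a b : ℝ} (hf : NearOne f a) (hg : NearOne g b) :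
    NearOne (fun n => f n * g n) (a + b) := by
  have h := (Tendsto.mul hf hg.tendsto).add hg
  rw [mul_one] at h
  exact h.congr fun n => by ring

theorem NearOne.shift {f : ℕ → ℝ} {a : ℝ} (hf : NearOne f a) (k : ℕ) :
    NearOne (fun n => f (n + k)) a := by
  have h1 : Tendsto (fun n => ((n + k : ℕ) : ℝ) * (f (n + k) - 1)) atTop (𝓝 a) :=
    Tendsto.comp hf (tendsto_add_atTop_nat k)
  have h2 := h1.sub ((hf.tendsto.comp (tendsto_add_atTop_nat k)).sub_const 1 |>.const_mul (k : ℝ))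
  simp only [sub_self, mul_zero, sub_zero] at h2
  refine h2.congr fun n => ?_
  simp only [Function.comp]
  push_cast
  ring

/-- The coefficient is the derivative of x ↦ x^β at 1, multiplied by k. -/
theorem nearOne_rpow (k β : ℝ) : NearOne (fun n : ℕ => (1 + k / n) ^ β) (k * β) := by
  by_cases hk : k = 0
  · simp [NearOne, hk]
  have hD : HasDerivAt (fun x : ℝ => x ^ β) (β * 1 ^ (β - 1)) 1 :=
    Real.hasDerivAt_rpow_const (Or.inl one_ne_zero)
  rw [Real.one_rpow, mul_one] at hD
  have h1 : Tendsto (fun n : ℕ => k / (n : ℝ)) atTop (𝓝[≠] 0) := by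
    refine tendsto_nhdsWithin_iff.2
      ⟨tendsto_const_nhds.div_atTop tendsto_natCast_atTop_atTop, ?_⟩
    filter_upwards [eventually_gt_atTop 0] with n hn
    have : (0 : ℝ) < n := by exact_mod_cast hn
    exact div_ne_zero hk this.ne'
  refine ((hD.tendsto_slope_zero.comp h1).const_mul k).congr' ?_
  filter_upwards [eventually_gt_atTop 0] with n hn
  have : (0 : ℝ) < n := by exact_mod_cast hn
  simp only [Function.comp, Real.one_rpow, smul_eq_mul]
  field_simp

/-- Rapidly growing negative coefficients: some solution is eventually positive along `4 ℕ + N`. -/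
theorem gapPos_of_rapid {R : ℕ → ℝ} {d : ℝ} (hd : 2 < d)
    (hR : NearOne (fun n => R (n + 1) / R n) d)
    {c : ℝ} (hc : 0 < c) (hRc : Tendsto (fun n : ℕ => R n / (n : ℝ) ^ d) atTop (𝓝 c)) (N : ℕ) :
    GapPos (fun _ => 1) (fun n => -R n) 4 N := by
  -- The midpoint of d/2 and d - 1. For d > 2 it satisfies β > 1, β + 1 < d and 4β > 2d. Over four
  -- steps g(n+1)/g(n) is multiplied by about 1 + 2d/n, while the cone bound V(n) = n^β grows by 1 +
  -- 4β/n. The other two inequalities make the remaining terms o(1/n).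
  set β : ℝ := (3 * d - 2) / 4 with hβ
  set V : ℕ → ℝ := fun n => (n : ℝ) ^ β with hV
  have hcast : Tendsto (fun n : ℕ => (n : ℝ)) atTop atTop := tendsto_natCast_atTop_atTop
  have hRinv : ∀ γ : ℝ, γ < d → Tendsto (fun n : ℕ => (n : ℝ) ^ γ / R n) atTop (𝓝 0) := by
    intro γ hγ
    have h1 := ((tendsto_rpow_neg_atTop (sub_pos.2 hγ)).comp hcast).mul (hRc.inv₀ hc.ne')
    rw [zero_mul] at h1
    refine h1.congr' ?_
    filter_upwards [eventually_gt_atTop 0] with n hn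
    have h2 : (0 : ℝ) < n := by exact_mod_cast hn
    simp only [Function.comp]
    rw [inv_div, neg_sub, Real.rpow_sub h2]
    have : (n : ℝ) ^ d ≠ 0 := by positivity
    field_simp
  have hRpos : ∀ᶠ n in atTop, 0 < R n := by
    filter_upwards [hRc.eventually_const_lt hc, eventually_gt_atTop 0] with n h1 h2
    have h3 : (0 : ℝ) < n := by exact_mod_cast h2
    have h4 : (0 : ℝ) < (n : ℝ) ^ d := by positivity
    by_contra! h5
    exact absurd h1 (not_lt.2 (div_nonpos_of_nonpos_of_nonneg h5 h4.le))
  have hRtop : Tendsto R atTop atTop := by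
    have h1 := (hRinv 0 (by linarith))
    simp only [Real.rpow_zero, one_div] at h1
    have h2 : Tendsto (fun n => (R n)⁻¹) atTop (𝓝[>] 0) :=
      tendsto_nhdsWithin_iff.2 ⟨h1, hRpos.mono fun n hn => inv_pos.2 hn⟩
    exact h2.inv_tendsto_nhdsGT_zero.congr fun n => by simp
  have hq0 := hR.tendsto
  have hq := fun k => (hR.shift k).tendsto
  have hleft : NearOne (fun n => R (n + 1) / R n * (R (n + 3) / R (n + 2)) +
      (1 + R (n + 3) / R (n + 2)) / V n) (2 * d) := by
    have h1 : Tendsto (fun n : ℕ => (n : ℝ) * ((1 + R (n + 3) / R (n + 2)) / V n)) atTop (𝓝 0) := by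
      have h2 := ((tendsto_rpow_neg_atTop (show 0 < β - 1 by rw [hβ]; linarith)).comp hcast).mul
        ((hq 2).const_add 1)
      rw [zero_mul] at h2
      refine h2.congr' ?_
      filter_upwards [eventually_gt_atTop 0] with n hn
      have h2 : (0 : ℝ) < n := by exact_mod_cast hn
      simp only [Function.comp, hV]
      rw [neg_sub, Real.rpow_sub h2, Real.rpow_one]
      ring
    have h3 := Tendsto.add (hR.mul (hR.shift 2)) h1
    rw [add_zero, ← two_mul] at h3
    exact h3.congr fun n => by ring
  have hright : NearOne (fun n => V (n + 4) / V n *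
      (1 - (1 / R (n + 2) + (1 + (R (n + 2) / R (n + 1))⁻¹) * (V n / R n))))
      (4 * β) := by
    have h1 : NearOne (fun n => V (n + 4) / V n) (4 * β) := by
      refine (nearOne_rpow 4 β).congr ?_
      filter_upwards [eventually_gt_atTop 0] with n hn
      have h2 : (0 : ℝ) < n := by exact_mod_cast hn
      simp only [hV]
      rw [← Real.div_rpow (by positivity) h2.le]
      congr 1
      push_cast
      field_simp
    have h2 : NearOne (fun n => 1 - (1 / R (n + 2) + (1 + (R (n + 2) / R (n + 1))⁻¹) *
        (V n / R n))) 0 := by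
      have h3 : Tendsto (fun n : ℕ => (n : ℝ) * (1 / R (n + 2))) atTop (𝓝 0) := by
        have h4 := (hRinv 1 (by linarith)).comp (tendsto_add_atTop_nat 2)
        have h5 := h4.sub ((hRtop.comp (tendsto_add_atTop_nat 2)).inv_tendsto_atTop.const_mul 2)
        simp only [mul_zero, sub_zero] at h5
        refine h5.congr fun n => ?_
        simp only [Function.comp, Real.rpow_one, Pi.inv_apply]
        push_cast
        ring
      have h4 : Tendsto (fun n : ℕ => (n : ℝ) * (V n / R n)) atTop (𝓝 0) := by
        refine (hRinv (β + 1) (by rw [hβ]; linarith)).congr' ?_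
        filter_upwards [eventually_gt_atTop 0] with n hn
        have h2 : (0 : ℝ) < n := by exact_mod_cast hn
        rw [Real.rpow_add h2, Real.rpow_one]
        ring
      have h5 := (h3.add ((((hq 1).inv₀ one_ne_zero).const_add 1).mul h4)).neg
      simp only [mul_zero, add_zero, neg_zero] at h5
      exact h5.congr fun n => by ring
    have := h1.mul h2
    rwa [add_zero] at this
  have hdiff := Tendsto.sub hright hleft
  have hgap : (0 : ℝ) < 4 * β - 2 * d := by rw [hβ]; linarith
  have hfin := hdiff.eventually_const_lt hgap
  have hbig4 : ∀ᶠ n in atTop, 8 ≤ R n := hRtop.eventually_ge_atTop 8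
  have hrat : ∀ᶠ n in atTop, R (n + 1) / R n ≤ 2 := by
    filter_upwards [hq0.eventually_lt_const (by norm_num : (1 : ℝ) < 2)] with n hn using hn.le
  obtain ⟨n₀, H⟩ := eventually_atTop.1 ((hbig4.and hfin).and ((eventually_gt_atTop 0).and hrat))
  obtain ⟨g, ha, hb, hg⟩ := exists_solution (fun _ => 1) (fun n => -R n) (4 * n₀ + N) 1 0
  refine ⟨g, eventually_atTop.2 ⟨_, hg⟩, eventually_atTop.2 ⟨n₀, fun j hj => ?_⟩⟩
  have hVpos : ∀ n : ℕ, 0 < n → 0 < V n := by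
    intro n hn
    have : (0 : ℝ) < n := by exact_mod_cast hn
    positivity
  suffices 0 < g (4 * j + N) ∧ |g (4 * j + N + 1)| ≤ V (4 * j + N) * g (4 * j + N) from this.1
  induction j, hj using Nat.le_induction with
  | base =>
    rw [ha, hb]
    have h0 := (H n₀ le_rfl).2.1
    have := (hVpos (4 * n₀ + N) (by omega)).le
    simpa using this
  | succ j hj ih =>
    have h0 : 0 < j := by have := (H n₀ le_rfl).2.1; omega
    set n := 4 * j + N with hn
    have hn0 : n₀ ≤ n := by omega
    have hf := (H n hn0).1.2
    have R0 := (H n hn0).1.1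
    have R1 := (H (n + 1) (by omega)).1.1
    have R2 := (H (n + 2) (by omega)).1.1
    have R3 := (H (n + 3) (by omega)).1.1
    have hnpos : (0 : ℝ) < n := by exact_mod_cast (show 0 < n by omega)
    have hf' : R (n + 1) / R n * (R (n + 3) / R (n + 2)) + (1 + R (n + 3) / R (n + 2)) / V n <
        V (n + 4) / V n *
        (1 - (1 / R (n + 2) + (1 + (R (n + 2) / R (n + 1))⁻¹) * (V n / R n))) := by
      by_contra! h1
      have := mul_nonneg hnpos.le (sub_nonneg.2 h1)
      linarith
    have hV0 := hVpos n (by omega)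
    have hV4 := hVpos (n + 4) (by omega)
    have g2 := hg n (by omega)
    have g3 := hg (n + 1) (by omega)
    have g4 := hg (n + 2) (by omega)
    have g5 := hg (n + 3) (by omega)
    have g4' : g (n + 4) = R n * (R (n + 2) - 1) * g n -
        (R (n + 1) + R (n + 2) - 1) * g (n + 1) := by
      rw [show n + 4 = n + 2 + 2 by ring, g4, show n + 2 + 1 = n + 1 + 2 by ring, g3,
        show n + 1 + 1 = n + 2 by ring, g2]
      ring
    have g5' : g (n + 5) = R n * (R (n + 2) + R (n + 3) - 1) * g n +
        (R (n + 1) * R (n + 3) - (R (n + 1) + R (n + 2) + R (n + 3) - 1)) * g (n + 1) := by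
      rw [show n + 5 = n + 3 + 2 by ring, g5, show n + 3 + 1 = n + 4 by ring, g4',
        show n + 3 = n + 1 + 2 by ring, g3, show n + 1 + 1 = n + 2 by ring, g2]
      ring
    have hrat1 : R (n + 2) ≤ 2 * R (n + 1) := by
      have := (H (n + 1) (by omega)).2.2
      rwa [div_le_iff₀ (by linarith)] at this
    obtain ⟨i1, i2⟩ := ih
    have hk := abs_le.1 i2
    -- Inside the cone |g(n+1)| ≤ V(n) g(n), T bounds g(n+4)/g(n) from below and S bounds
    -- |g(n+5)|/g(n) from above. The inequality S < V(n+4) T is `hf'` with denominators cleared.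
    set T := R n * R (n + 2) - R n - (R (n + 1) + R (n + 2)) * V n with hT
    set S := R (n + 1) * R (n + 3) * V n + R n * (R (n + 2) + R (n + 3)) with hS
    have hST : S < V (n + 4) * T := by
      have p0 : 0 < R n := by linarith
      have p1 : 0 < R (n + 1) := by linarith
      have p2 : 0 < R (n + 2) := by linarith
      have hm : 0 < V n * (R n * R (n + 2)) := by positivity
      have h1 := mul_lt_mul_of_pos_right hf' hm
      have e1 : (R (n + 1) / R n * (R (n + 3) / R (n + 2)) + (1 + R (n + 3) / R (n + 2)) / V n) *
          (V n * (R n * R (n + 2))) = S := by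
        rw [hS]; field_simp
      have e2 : (V (n + 4) / V n *
          (1 - (1 / R (n + 2) + (1 + (R (n + 2) / R (n + 1))⁻¹) * (V n / R n)))) *
          (V n * (R n * R (n + 2))) = V (n + 4) * T := by
        rw [hT]; field_simp; ring
      rwa [e1, e2] at h1
    have hS0 : 0 < S := by
      have : 0 < R n * (R (n + 2) + R (n + 3)) := mul_pos (by linarith) (by linarith)
      have : 0 < R (n + 1) * R (n + 3) * V n := mul_pos (mul_pos (by linarith) (by linarith)) hV0
      linarith
    have hT0 : 0 < T := pos_of_mul_pos_right (hS0.trans hST) hV4.le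
    have hlow : T * g n ≤ g (n + 4) := by
      have h1 : (R (n + 1) + R (n + 2) - 1) * g (n + 1) ≤
          (R (n + 1) + R (n + 2) - 1) * (V n * g n) :=
        mul_le_mul_of_nonneg_left hk.2 (by linarith)
      have h2 : 0 ≤ V n * g n := (mul_pos hV0 i1).le
      rw [g4', hT]
      linarith
    have hup : |g (n + 5)| ≤ S * g n := by
      have hc0 : 0 ≤ R (n + 1) * R (n + 3) - (R (n + 1) + R (n + 2) + R (n + 3) - 1) := by
        have := mul_le_mul (sub_le_sub_right R1 1) (sub_le_sub_right R3 1) (by norm_num) (by linarith)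
        nlinarith
      have h1 := mul_le_mul_of_nonneg_left i2 hc0
      have h2 : 0 ≤ V n * g n := (mul_pos hV0 i1).le
      have h3 : 0 ≤ (R (n + 1) + R (n + 2) + R (n + 3) - 1) * (V n * g n) :=
        mul_nonneg (by linarith) h2
      have h4 : 0 ≤ R n * g n := mul_nonneg (by linarith) i1.le
      have h5 : 0 ≤ R n * (R (n + 2) + R (n + 3) - 1) * g n :=
        mul_nonneg (mul_nonneg (by linarith) (by linarith)) i1.le
      rw [g5', hS]
      refine (abs_add_le _ _).trans ?_
      rw [abs_of_nonneg h5, abs_mul, abs_of_nonneg hc0]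
      linarith
    rw [show 4 * (j + 1) + N = n + 4 by rw [hn]; ring]
    refine ⟨(mul_pos hT0 i1).trans_le hlow, hup.trans ?_⟩
    calc S * g n ≤ V (n + 4) * T * g n := mul_le_mul_of_nonneg_right hST.le i1.le
      _ = V (n + 4) * (T * g n) := by ring
      _ ≤ _ := mul_le_mul_of_nonneg_left hlow hV4.le

/-! ### Coefficients of linear or quadratic growth -/

/-- In 4R(x)R(x+1) minus the product of the middle coefficients, the terms of degree 4 and 3 cancel;
the quadratic in `hΛ` is its exact polynomial part. The remainder T(x)/x is negligible on the scale
w, which is x² or x according to the degree. -/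
theorem tendsto_gap_two_aux {R : ℝ → ℝ} {a b e l A Λ : ℝ} {T w : ℝ → ℝ}
    (hR : ∀ᶠ x : ℝ in atTop, R x = a * x ^ 2 + b * x + e + T x / x) (hT : Tendsto T atTop (𝓝 l))
    (hw : Tendsto w atTop atTop)
    (hA : ∀ i : ℝ, Tendsto (fun x => (a * (x + i) ^ 2 + b * (x + i) + e) / w x) atTop (𝓝 A))
    (hΛ : Tendsto (fun x : ℝ => ((4 * a ^ 2 + 4 * a) * x ^ 2 + (4 * a * b + 4 * a ^ 2 + 4 * a + 4 * b) * x
      + (4 * e * (a + b + e) - (5 * a + 3 * b + 2 * e - 1) * (a - b + 2 * e - 1))) / w x)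
      atTop (𝓝 Λ)) :
    (∀ i : ℝ, Tendsto (fun x => R (x + i) / w x) atTop (𝓝 A)) ∧
    Tendsto (fun x => (4 * (R x * R (x + 1)) -
      (R (x + 1) + R (x + 2) - 1) * (R (x - 1) + R x - 1)) / w x) atTop (𝓝 Λ) := by
  have hshift : ∀ i : ℝ, Tendsto (fun x : ℝ => x + i) atTop atTop := fun i =>
    tendsto_atTop_add_const_right _ _ tendsto_id
  have hη : ∀ i : ℝ, Tendsto (fun x => T (x + i) / (x + i)) atTop (𝓝 0) := fun i =>
    (hT.comp (hshift i)).div_atTop (hshift i)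
  have hwi := hw.inv_tendsto_atTop
  have hw0 : ∀ᶠ x in atTop, w x ≠ 0 := hw.eventually_ne_atTop 0
  constructor
  · intro i
    have h := (hA i).add ((hη i).mul hwi)
    rw [zero_mul, add_zero] at h
    refine h.congr' ?_
    filter_upwards [(hshift i).eventually hR] with x hx
    rw [hx, Pi.inv_apply]
    ring
  · have hz : Tendsto (fun x => 4 * ((a * (x + 0) ^ 2 + b * (x + 0) + e) / w x * (T (x + 1) / (x + 1)) +
          (a * (x + 1) ^ 2 + b * (x + 1) + e) / w x * (T (x + 0) / (x + 0)) +
          (T (x + 0) / (x + 0)) * (T (x + 1) / (x + 1)) * (w x)⁻¹) -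
        (((a * (x + 1) ^ 2 + b * (x + 1) + e) / w x + (a * (x + 2) ^ 2 + b * (x + 2) + e) / w x - (w x)⁻¹) *
            (T (x + (-1)) / (x + (-1)) + T (x + 0) / (x + 0)) +
          (T (x + 1) / (x + 1) + T (x + 2) / (x + 2)) *
            ((a * (x + (-1)) ^ 2 + b * (x + (-1)) + e) / w x + (a * (x + 0) ^ 2 + b * (x + 0) + e) / w x
              - (w x)⁻¹) +
          (T (x + 1) / (x + 1) + T (x + 2) / (x + 2)) *
            (T (x + (-1)) / (x + (-1)) + T (x + 0) / (x + 0)) * (w x)⁻¹)) atTop (𝓝 0) := by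
      have := ((((hA 0).mul (hη 1)).add ((hA 1).mul (hη 0))).add
        (((hη 0).mul (hη 1)).mul hwi)).const_mul 4 |>.sub
        ((((((hA 1).add (hA 2)).sub hwi).mul ((hη (-1)).add (hη 0))).add
          (((hη 1).add (hη 2)).mul (((hA (-1)).add (hA 0)).sub hwi))).add
          ((((hη 1).add (hη 2)).mul ((hη (-1)).add (hη 0))).mul hwi))
      simpa only [mul_zero, zero_mul, add_zero, sub_zero, Pi.inv_apply] using this
    have h := hΛ.add hz
    rw [add_zero] at h
    refine h.congr' ?_
    filter_upwards [(hshift 0).eventually hR, (hshift 1).eventually hR, (hshift 2).eventually hR,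
      (hshift (-1)).eventually hR, hw0] with x h0 h1 h2 h3 h4
    rw [add_zero] at h0
    rw [h0, h1, h2, sub_eq_add_neg x 1, h3]
    generalize T (x + 1) / (x + 1) = t1
    generalize T (x + 2) / (x + 2) = t2
    generalize T (x + -1) / (x + -1) = t3
    rw [add_zero]
    generalize T x / x = t0
    field_simp
    ring

/-- The quotient X is such that the normalized ratio of the gap-2 recurrence is -1/(4X). In the
quadratic case x²(1 - X) tends to 1 + 1/a. In the linear case x(1 - X) tends to 1/b, so x²(1 - X) is
unbounded. -/
theorem tendsto_gap_two {R : ℝ → ℝ} {a b e l : ℝ} {T : ℝ → ℝ}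
    (hR : ∀ᶠ x : ℝ in atTop, R x = a * x ^ 2 + b * x + e + T x / x) (hT : Tendsto T atTop (𝓝 l))
    (hab : 0 < a ∨ a = 0 ∧ 0 < b) :
    Tendsto R atTop atTop ∧
    Tendsto (fun x => (R (x + 1) + R (x + 2) - 1) * (R (x - 1) + R x - 1) / (4 * (R x * R (x + 1))))
      atTop (𝓝 1) ∧
    ∃ κ : ℝ, 1 < κ ∧ ∀ᶠ x : ℝ in atTop, κ ≤ x ^ 2 *
      (1 - (R (x + 1) + R (x + 2) - 1) * (R (x - 1) + R x - 1) / (4 * (R x * R (x + 1)))) := by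
  have hi1 : Tendsto (fun x : ℝ => x⁻¹) atTop (𝓝 0) := tendsto_inv_atTop_zero
  have hcore : ∀ (w : ℝ → ℝ) (A Λ : ℝ), 0 < A → Tendsto w atTop atTop →
      (∀ i : ℝ, Tendsto (fun x => R (x + i) / w x) atTop (𝓝 A)) →
      Tendsto (fun x => (4 * (R x * R (x + 1)) -
        (R (x + 1) + R (x + 2) - 1) * (R (x - 1) + R x - 1)) / w x) atTop (𝓝 Λ) →
      Tendsto R atTop atTop ∧ Tendsto (fun x => w x * (1 - (R (x + 1) + R (x + 2) - 1) *
        (R (x - 1) + R x - 1) / (4 * (R x * R (x + 1))))) atTop (𝓝 (Λ / (4 * (A * A)))) := by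
    intro w A Λ hA hw h1 h2
    have h10 := h1 0
    simp only [add_zero] at h10
    have hRtop : Tendsto R atTop atTop := by
      refine (h10.pos_mul_atTop hA hw).congr' ?_
      filter_upwards [hw.eventually_ne_atTop 0] with x hx
      field_simp
    refine ⟨hRtop, ?_⟩
    have hA' : 4 * (A * A) ≠ 0 := by positivity
    refine (h2.div ((h10.mul (h1 1)).const_mul 4) hA').congr' ?_
    have hRtop1 := hRtop.comp (tendsto_atTop_add_const_right atTop (1 : ℝ) tendsto_id)
    filter_upwards [hw.eventually_ne_atTop 0, hRtop.eventually_ne_atTop 0,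
      hRtop1.eventually_ne_atTop 0] with x hx hx1 hx2
    simp only [Function.comp, id] at hx2
    rw [Pi.div_apply]
    field_simp
  have hfrom : ∀ (w : ℝ → ℝ) (L : ℝ) (X : ℝ → ℝ), Tendsto w atTop atTop →
      Tendsto (fun x => w x * (1 - X x)) atTop (𝓝 L) → Tendsto X atTop (𝓝 1) := by
    intro w L X hw h
    have := (h.mul hw.inv_tendsto_atTop).const_sub 1
    rw [mul_zero, sub_zero] at this
    refine this.congr' ?_
    filter_upwards [hw.eventually_ne_atTop 0] with x hx
    rw [Pi.inv_apply]
    field_simp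
    ring
  rcases hab with ha | ⟨rfl, hb⟩
  · have hw : Tendsto (fun x : ℝ => x ^ 2) atTop atTop := tendsto_pow_atTop (by norm_num)
    have hquad : ∀ c₂ c₁ c₀ : ℝ, Tendsto (fun x : ℝ => (c₂ * x ^ 2 + c₁ * x + c₀) / x ^ 2) atTop (𝓝 c₂) := by
      intro c₂ c₁ c₀
      have := ((hi1.const_mul c₁).const_add c₂).add ((hi1.mul hi1).const_mul c₀)
      simp only [mul_zero, add_zero] at this
      refine this.congr' ?_
      filter_upwards [eventually_gt_atTop 0] with x hx
      field_simp
    obtain ⟨h1, h2⟩ := tendsto_gap_two_aux (A := a) hR hT hw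
      (fun i => (hquad a (2 * a * i + b) (a * i ^ 2 + b * i + e)).congr fun x => by ring_nf) (hquad _ _ _)
    obtain ⟨h3, h4⟩ := hcore _ a _ ha hw h1 h2
    refine ⟨h3, hfrom _ _ _ hw h4, 1 + 1 / (2 * a), by simp [ha], ?_⟩
    have : 1 + 1 / (2 * a) < (4 * a ^ 2 + 4 * a) / (4 * (a * a)) := by
      have e1 : (4 * a ^ 2 + 4 * a) / (4 * (a * a)) = 1 + 1 / (2 * a) + 1 / (2 * a) := by
        field_simp
        ring
      rw [e1]
      have : 0 < 1 / (2 * a) := by positivity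
      linarith
    filter_upwards [h4.eventually_const_lt this] with x hx using hx.le
  · have hw : Tendsto (fun x : ℝ => x) atTop atTop := tendsto_id
    have hlin : ∀ c₁ c₀ : ℝ, Tendsto (fun x : ℝ => (c₁ * x + c₀) / x) atTop (𝓝 c₁) := by
      intro c₁ c₀
      have := (hi1.const_mul c₀).const_add c₁
      simp only [mul_zero, add_zero] at this
      refine this.congr' ?_
      filter_upwards [eventually_gt_atTop 0] with x hx
      field_simp
    obtain ⟨h1, h2⟩ := tendsto_gap_two_aux (A := b) hR hT hw
      (fun i => (hlin b (b * i + e)).congr fun x => by ring_nf)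
      ((hlin (4 * b) (4 * e * (b + e) - (3 * b + 2 * e - 1) * (-b + 2 * e - 1))).congr fun x => by ring_nf)
    obtain ⟨h3, h4⟩ := hcore _ b _ hb hw h1 h2
    refine ⟨h3, hfrom _ _ _ hw h4, 2, by norm_num, ?_⟩
    have hpos : 0 < 4 * b / (4 * (b * b)) := by positivity
    filter_upwards [(h4.pos_mul_atTop hpos hw).eventually_ge_atTop 2] with x hx
    refine hx.trans_eq ?_
    ring

/-- Passing to gap 2 gives g(m+4) = (1 - R(m+1) - R(m+2)) g(m+2) - R(m)R(m+1) g(m). Its normalized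
ratio tends to -1/4 and lies below the Kneser threshold, so the parabolic case applies. -/
theorem not_gapPos_of_linear_or_quadratic {R : ℝ → ℝ} {a b e l : ℝ} {T : ℝ → ℝ}
    (hR : ∀ᶠ x : ℝ in atTop, R x = a * x ^ 2 + b * x + e + T x / x) (hT : Tendsto T atTop (𝓝 l))
    (hab : 0 < a ∨ a = 0 ∧ 0 < b) {τ : ℕ} (hτ : 1 ≤ τ) (N : ℕ) :
    ¬ GapPos (fun _ => 1) (fun n => -R n) τ N := by
  rintro ⟨g, hg, hpos⟩
  obtain ⟨hRtop, hX1, κ, hκ, hXκ⟩ := tendsto_gap_two hR hT hab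
  set X : ℝ → ℝ := fun x => (R (x + 1) + R (x + 2) - 1) * (R (x - 1) + R x - 1) /
    (4 * (R x * R (x + 1))) with hX
  have hm : Tendsto (fun n : ℕ => ((2 * n + N : ℕ) : ℝ)) atTop atTop :=
    tendsto_natCast_atTop_atTop.comp (tendsto_gap (by norm_num) N)
  have hRshift : ∀ i : ℝ, Tendsto (fun n : ℕ => R (((2 * n + N : ℕ) : ℝ) + i)) atTop atTop := fun i =>
    hRtop.comp (tendsto_atTop_add_const_right _ _ hm)
  set p : ℕ → ℝ := fun n => 1 - R (((2 * n + N : ℕ) : ℝ) + 1) - R (((2 * n + N : ℕ) : ℝ) + 2) with hp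
  set q : ℕ → ℝ := fun n => -(R (2 * n + N : ℕ) * R (((2 * n + N : ℕ) : ℝ) + 1)) with hq
  have hGap : GapPos p q τ 0 := by
    refine ⟨fun n => g (2 * n + N), ?_, ?_⟩
    · have ht := tendsto_gap (τ := 2) (by norm_num) N
      filter_upwards [ht.eventually hg, ht.eventually ((tendsto_add_atTop_nat 1).eventually hg),
        ht.eventually ((tendsto_add_atTop_nat 2).eventually hg)] with n h0 h1 h2
      simp only [hp, hq]
      rw [show 2 * (n + 2) + N = 2 * n + N + 2 + 2 by ring,
        show 2 * (n + 1) + N = 2 * n + N + 2 by ring, h2,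
        show 2 * n + N + 2 + 1 = 2 * n + N + 1 + 2 by ring, h1,
        show 2 * n + N + 1 + 1 = 2 * n + N + 2 by ring, h0]
      push_cast
      ring
    · have := (tendsto_gap (τ := 2) (by norm_num) 0).eventually hpos
      filter_upwards [this] with n hn
      rwa [show 2 * (τ * n + 0) + N = τ * (2 * n + 0) + N by ring]
  have hprev : ∀ᶠ n in atTop, p (n - 1) =
      1 - R (((2 * n + N : ℕ) : ℝ) - 1) - R ((2 * n + N : ℕ) : ℝ) := by
    filter_upwards [eventually_ge_atTop 1] with n hn
    obtain ⟨k, rfl⟩ := Nat.exists_eq_add_of_le hn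
    simp only [hp, Nat.add_sub_cancel_left]
    push_cast
    ring_nf
  have hev : ∀ᶠ n in atTop, p n < 0 ∧ p (n - 1) < 0 := by
    filter_upwards [hprev, (hRshift 1).eventually_gt_atTop 1, (hRshift 2).eventually_gt_atTop 0,
      (hRshift (-1)).eventually_gt_atTop 1, (hRshift 0).eventually_gt_atTop 0] with n h1 h2 h3 h4 h5
    rw [add_zero] at h5
    rw [← sub_eq_add_neg] at h4
    rw [h1]
    refine ⟨?_, by linarith⟩
    simp only [hp]
    linarith
  have hpp : ∀ᶠ n in atTop, 0 < p n * p (n - 1) :=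
    hev.mono fun n hn => mul_pos_of_neg_of_neg hn.1 hn.2
  have hG2 := hGap.mul (m := 2) (by norm_num)
  rw [gapPos_iff_of_gauge (ρ := fun n => q n / (p n * p (n - 1))) hpp
    (hpp.mono fun n hn => (div_mul_cancel₀ _ hn.ne').symm) (by simp) (by omega)] at hG2
  have hρX : ∀ᶠ n : ℕ in atTop, q n / (p n * p (n - 1)) = -(1 / (4 * X ((2 * n + N : ℕ) : ℝ))) := by
    filter_upwards [hprev, hpp, (hRshift 0).eventually_gt_atTop 0, (hRshift 1).eventually_gt_atTop 0]
      with n h1 h2 h3 h4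
    rw [add_zero] at h3
    have e1 : X ((2 * n + N : ℕ) : ℝ) = p n * p (n - 1) / (-(4 * q n)) := by
      rw [h1]
      simp only [hX, hp, hq]
      congr 1 <;> ring
    have hq0 : q n ≠ 0 := by
      simp only [hq]
      exact (neg_neg_of_pos (mul_pos h3 h4)).ne
    rw [e1]
    have := h2.ne'
    field_simp
  have hXn := hX1.comp hm
  -- At x = 2n + N the deficit κ/(4x²) is about κ/(16n²). The constant chosen is the midpoint of
  -- 1/16 and κ/16.
  refine not_gapPos_of_parabolic (c := (1 + κ) / 32) (by linarith) ?_ ?_ (by omega) 0 hG2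
  · have := (((hXn.const_mul 4).inv₀ (by norm_num)).neg)
    rw [mul_one] at this
    rw [show -(1 / 4 : ℝ) = -(4 : ℝ)⁻¹ by norm_num]
    refine this.congr' ?_
    filter_upwards [hρX] with n hn
    rw [hn, one_div]
    rfl
  · have hratio : Tendsto (fun n : ℕ => (2 + (N : ℝ) / n) ^ 2 * ((1 + κ) / 32)) atTop
        (𝓝 ((2 + 0) ^ 2 * ((1 + κ) / 32))) :=
      (((tendsto_const_nhds.div_atTop tendsto_natCast_atTop_atTop).const_add 2).pow 2).mul_const _
    have hlt : (2 + 0) ^ 2 * ((1 + κ) / 32) < κ / 4 := by linarith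
    filter_upwards [hρX, hm.eventually hXκ, hXn.eventually_const_lt (by norm_num : (0 : ℝ) < 1),
      eventually_gt_atTop 0, hratio.eventually_lt_const hlt] with n h1 h2 h3 h4 h5
    rw [h1]
    have hn : (0 : ℝ) < n := by exact_mod_cast h4
    set x : ℝ := ((2 * n + N : ℕ) : ℝ) with hx
    have hx' : x = 2 * n + N := by rw [hx]; push_cast; ring
    have hN : (0 : ℝ) ≤ N := Nat.cast_nonneg N
    have hx0 : 0 < x := by rw [hx']; linarith
    change 0 < X x at h3
    change κ ≤ x ^ 2 * (1 - X x) at h2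
    have e1 : 2 - X x ≤ 1 / X x := by
      rw [le_div_iff₀ h3]
      nlinarith [sq_nonneg (X x - 1)]
    have e2 : 1 / (4 * X x) = 1 / X x / 4 := by field_simp
    have e3 : κ / x ^ 2 ≤ 1 - X x := by
      rw [div_le_iff₀ (by positivity)]
      linarith
    have e4 : (1 + κ) / 32 / (n : ℝ) ^ 2 ≤ κ / x ^ 2 / 4 := by
      have e5 : x = n * (2 + N / n) := by rw [hx']; field_simp
      rw [div_div, div_div, div_le_div_iff₀ (by positivity) (by positivity), e5]
      have := mul_le_mul_of_nonneg_right h5.le (by positivity : (0 : ℝ) ≤ 128 * n ^ 2)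
      generalize (N : ℝ) / n = t at this
      linarith
    rw [e2]
    linarith

/-! ### The sequences attached to a pair of rational functions -/

/-- The sequence of values of a rational function at the natural numbers. -/
noncomputable def natValue (R : RatFunc ℝ) (n : ℕ) : ℝ := value R n

theorem natValue_pos_or_neg {R : RatFunc ℝ} (hR : R ≠ 0) :
    (∀ᶠ n in atTop, 0 < natValue R n) ∨ (∀ᶠ n in atTop, natValue R n < 0) :=
  (eventually_value_pos_or_neg hR).imp eventually_nat eventually_nat

theorem natValue_mul_pos {R : RatFunc ℝ} (hR : R ≠ 0) (k : ℕ) :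
    ∀ᶠ n in atTop, 0 < natValue R (n + k) * natValue R n := by
  rcases natValue_pos_or_neg hR with h | h <;>
    filter_upwards [h, (tendsto_add_atTop_nat k).eventually h] with n h1 h2
  · exact mul_pos h2 h1
  · exact mul_pos_of_neg_of_neg h2 h1

theorem natValue_ne_zero {R : RatFunc ℝ} (hR : R ≠ 0) : ∀ᶠ n in atTop, natValue R n ≠ 0 :=
  eventually_nat (eventually_value_ne_zero hR)

theorem natValue_substLin {τ : ℕ} (hτ : 1 ≤ τ) (N : ℕ) (R : RatFunc ℝ) :
    ∀ᶠ n in atTop, natValue (substLin τ N R) n = natValue R (τ * n + N) := by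
  filter_upwards [eventually_nat (value_substLin_eventually (a := τ) (by exact_mod_cast hτ) N R)]
    with n hn
  simp only [natValue, hn]
  push_cast
  rfl

theorem substLin_ne_zero {τ : ℕ} (hτ : 1 ≤ τ) (N : ℕ) {R : RatFunc ℝ} (hR : R ≠ 0) :
    substLin τ N R ≠ 0 := by
  intro h
  obtain ⟨n, h1, h2⟩ := ((natValue_substLin hτ N R).and
    ((tendsto_gap hτ N).eventually (natValue_ne_zero hR))).exists
  rw [h] at h1
  exact h2 (by rw [← h1, natValue, value_zero])

theorem natValue_canon (P Q : RatFunc ℝ) (k : ℕ) :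
    ∀ᶠ n in atTop, natValue (canonDen P Q k) n = seqDen (natValue P) (natValue Q) k n ∧
      natValue (canonNum P Q k) n = seqNum (natValue P) (natValue Q) k n := by
  induction k using Nat.twoStepInduction with
  | zero => simp [natValue, canonDen, canonNum, seqDen, seqNum]
  | one => simp [natValue, canonDen, canonNum, seqDen, seqNum]
  | more k ih0 ih1 =>
    have hs : ∀ R : RatFunc ℝ, ∀ᶠ n in atTop, value (substLin 1 k R) (n : ℕ) = natValue R (n + k) := by
      intro R
      filter_upwards [natValue_substLin le_rfl k R] with n hn
      simpa [natValue] using hn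
    have hv : ∀ R S T U : RatFunc ℝ, ∀ᶠ n : ℕ in atTop, value (R * S + T * U) n =
        value R n * value S n + value T n * value U n := by
      intro R S T U
      filter_upwards [eventually_nat (value_add_eventually (R * S) (T * U)),
        eventually_nat (value_mul_eventually R S), eventually_nat (value_mul_eventually T U)]
        with n h1 h2 h3
      rw [h1, h2, h3]
    filter_upwards [ih0, ih1, hs P, hs Q, hv (substLin 1 k P) (canonDen P Q (k + 1))
      (substLin 1 k Q) (canonDen P Q k), hv (substLin 1 k P) (canonNum P Q (k + 1))
      (substLin 1 k Q) (canonNum P Q k)] with n h0 h1 h2 h3 h4 h5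
    rw [natValue, natValue, canonDen, canonNum, seqDen, seqNum, h4, h5, h2, h3, ← h0.1, ← h0.2,
      ← h1.1, ← h1.2]
    exact ⟨rfl, rfl⟩

theorem natValue_gap (P Q : RatFunc ℝ) (τ : ℕ) :
    ∀ᶠ n in atTop, natValue (gapP P Q τ) n = seqGapP (natValue P) (natValue Q) τ n ∧
      natValue (gapQ P Q τ) n = seqGapQ (natValue P) (natValue Q) τ n := by
  filter_upwards [natValue_canon P Q τ, natValue_canon P Q (2 * τ),
    eventually_nat (value_div_eventually (canonDen P Q (2 * τ)) (canonDen P Q τ)),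
    eventually_nat (value_mul_eventually (canonDen P Q (2 * τ) / canonDen P Q τ) (canonNum P Q τ)),
    eventually_nat (value_sub_eventually (canonNum P Q (2 * τ))
      (canonDen P Q (2 * τ) / canonDen P Q τ * canonNum P Q τ))] with n h1 h2 h3 h4 h5
  rw [natValue, natValue, gapP, gapQ, seqGapP, seqGapQ, h5, h4, h3, ← h1.1, ← h1.2, ← h2.1, ← h2.2]
  exact ⟨rfl, rfl⟩

theorem value_normRatio (P Q : RatFunc ℝ) :
    ∀ᶠ x : ℝ in atTop, value (normRatio P Q) x = value Q x / (value P x * value P (x - 1)) := by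
  filter_upwards [value_div_eventually Q (P * substLin 1 (-1) P),
    value_mul_eventually P (substLin 1 (-1) P),
    value_substLin_eventually one_pos (-1) P] with x h1 h2 h3
  rw [normRatio, h1, h2, h3, one_mul, ← sub_eq_add_neg]

theorem natValue_mul_pred_pos {P : RatFunc ℝ} (hP : P ≠ 0) :
    ∀ᶠ n in atTop, 0 < natValue P n * natValue P (n - 1) := by
  have h := (tendsto_sub_atTop_nat 1).eventually (natValue_mul_pos hP 1)
  filter_upwards [h, eventually_ge_atTop 1] with n h1 h2
  rwa [Nat.sub_add_cancel h2] at h1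

theorem natValue_normRatio (P Q : RatFunc ℝ) :
    ∀ᶠ n in atTop, natValue (normRatio P Q) n =
      natValue Q n / (natValue P n * natValue P (n - 1)) := by
  filter_upwards [eventually_nat (value_normRatio P Q), eventually_ge_atTop 1] with n h1 h2
  rw [natValue, h1, natValue, natValue, natValue, Nat.cast_sub h2, Nat.cast_one]

theorem normRatio_ne_zero {P Q : RatFunc ℝ} (hP : P ≠ 0) (hQ : Q ≠ 0) : normRatio P Q ≠ 0 := by
  intro h
  obtain ⟨n, h1, h2, h3⟩ := ((natValue_normRatio P Q).and
    ((natValue_ne_zero hQ).and (natValue_mul_pred_pos hP))).exists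
  rw [h, natValue, value_zero] at h1
  exact div_ne_zero h2 h3.ne' h1.symm

theorem natValue_eq_normRatio_mul {P : RatFunc ℝ} (hP : P ≠ 0) (Q : RatFunc ℝ) :
    ∀ᶠ n in atTop, natValue Q n =
      natValue (normRatio P Q) n * (natValue P n * natValue P (n - 1)) := by
  filter_upwards [natValue_normRatio P Q, natValue_mul_pred_pos hP] with n h1 h2
  rw [h1, div_mul_cancel₀ _ h2.ne']

theorem gapPos_iff_normRatio {P : RatFunc ℝ} (hP : P ≠ 0) (Q : RatFunc ℝ) {τ : ℕ} (hτ : Even τ)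
    (h1 : 1 ≤ τ) (N : ℕ) :
    GapPos (natValue P) (natValue Q) τ N ↔ GapPos (fun _ => 1) (natValue (normRatio P Q)) τ N :=
  gapPos_iff_of_gauge (natValue_mul_pred_pos hP) (natValue_eq_normRatio_mul hP Q) hτ h1

theorem GapPos.congr {p q p' q' : ℕ → ℝ} {τ N : ℕ} (h : GapPos p q τ N)
    (hp : ∀ᶠ n in atTop, p n = p' n) (hq : ∀ᶠ n in atTop, q n = q' n) : GapPos p' q' τ N := by
  obtain ⟨f, h1, h2⟩ := h
  refine ⟨f, ?_, h2⟩
  filter_upwards [h1, hp, hq] with n a b c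
  rw [a, b, c]

/-! ### Consequences of an expansion at infinity -/

section Expansion

variable {R : RatFunc ℝ} {a b c : ℝ}

theorem HasExpansion.tendsto_one (h : HasExpansion R a b c) :
    Tendsto (fun x => x * (value R x - a)) atTop (𝓝 b) ∧
      Tendsto (fun x => x ^ 2 * (value R x - (a + b / x))) atTop (𝓝 c) := by
  have hx1 : Tendsto (fun x : ℝ => x⁻¹) atTop (𝓝 0) := tendsto_inv_atTop_zero
  have h2 : Tendsto (fun x => x ^ 2 * (value R x - (a + b / x))) atTop (𝓝 c) := by
    have h1 : (fun x : ℝ => x ^ 2 * (value R x - (a + b / x + c / x ^ 2))) =O[atTop]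
        fun x : ℝ => x ^ 2 * (x ^ 3)⁻¹ := (isBigO_refl _ _).mul h
    have h2 := (h1.trans_tendsto (hx1.congr' ?_)).add_const c
    · rw [zero_add] at h2
      refine h2.congr' ?_
      filter_upwards [eventually_gt_atTop 0] with x hx
      field_simp
      ring
    · filter_upwards [eventually_gt_atTop 0] with x hx
      field_simp
  refine ⟨?_, h2⟩
  have := (h2.mul hx1).add_const b
  rw [mul_zero, zero_add] at this
  refine this.congr' ?_
  filter_upwards [eventually_gt_atTop 0] with x hx
  field_simp
  ring

theorem HasExpansion.shift_isBigO (h : HasExpansion R a b c) (i : ℕ) :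
    (fun n : ℕ => natValue R (n + i) - (a + b / n)) =O[atTop] fun n : ℕ => ((n : ℝ) ^ 2)⁻¹ := by
  have hcast : Tendsto (fun n : ℕ => (n : ℝ)) atTop atTop := tendsto_natCast_atTop_atTop
  have hs := hcast.comp (tendsto_add_atTop_nat i)
  have h1 := h.tendsto_one.2.comp hs
  have h2 : Tendsto (fun n : ℕ => (n : ℝ) / ((n + i : ℕ) : ℝ)) atTop (𝓝 1) := by
    have := (tendsto_const_nhds (x := (i : ℝ))).div_atTop hs |>.const_sub 1
    rw [sub_zero] at this
    refine this.congr' ?_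
    filter_upwards [eventually_gt_atTop 0] with n hn
    have : (0 : ℝ) < ((n + i : ℕ) : ℝ) := by exact_mod_cast (show 0 < n + i by omega)
    simp only [Function.comp]
    field_simp
    push_cast
    ring
  have h3 := (h1.mul (h2.pow 2)).sub (h2.const_mul (b * i))
  have h4 : Tendsto (fun n : ℕ => (n : ℝ) ^ 2 * (natValue R (n + i) - (a + b / n))) atTop
      (𝓝 (c * 1 ^ 2 - b * i * 1)) := by
    refine h3.congr' ?_
    filter_upwards [eventually_gt_atTop 0] with n hn
    have h5 : (0 : ℝ) < n := by exact_mod_cast hn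
    have h6 : (0 : ℝ) < ((n + i : ℕ) : ℝ) := by exact_mod_cast (show 0 < n + i by omega)
    have h7 : ((n + i : ℕ) : ℝ) = n + i := by push_cast; ring
    simp only [Function.comp, natValue]
    generalize value R ((n + i : ℕ) : ℝ) = v
    rw [h7] at h6 ⊢
    field_simp
    ring
  have h5 := (h4.isBigO_one ℝ).mul (isBigO_refl (fun n : ℕ => ((n : ℝ) ^ 2)⁻¹) atTop)
  simp only [one_mul] at h5
  refine h5.congr' ?_ EventuallyEq.rfl
  filter_upwards [eventually_gt_atTop 0] with n hn
  have h5 : (0 : ℝ) < n := by exact_mod_cast hn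
  field_simp

/-- Links the lexicographic condition to the Kneser criterion: the first coefficient below its
threshold dominates all later terms. -/
theorem HasExpansion.le_of_not_lexGe (h : HasExpansion R a b c) (hlex : ¬ LexGe a b c) :
    ∃ k : ℝ, 1 / 16 < k ∧ ∀ᶠ x : ℝ in atTop, value R x ≤ -(1 / 4) - k / x ^ 2 := by
  simp only [LexGe, not_or, not_and, not_lt, not_le] at hlex
  obtain ⟨h1, h2⟩ := hlex
  rcases h1.lt_or_eq with h1 | h1
  · refine ⟨1, by norm_num, ?_⟩
    have h3 : Tendsto (fun x : ℝ => -(1 / 4) - 1 / x ^ 2) atTop (𝓝 (-(1 / 4) - 0)) :=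
      (tendsto_const_nhds.div_atTop (tendsto_pow_atTop (by norm_num))).const_sub _
    rw [sub_zero] at h3
    filter_upwards [h.tendsto.eventually_lt h3 h1] with x hx using hx.le
  · obtain ⟨h3, h4⟩ := h2 h1
    rcases h3.lt_or_eq with h3 | h3
    · refine ⟨1, by norm_num, ?_⟩
      have h5 : Tendsto (fun x : ℝ => -(1 / x)) atTop (𝓝 0) := by
        simpa using (tendsto_inv_atTop_zero (𝕜 := ℝ)).neg
      filter_upwards [h.tendsto_one.1.eventually_lt h5 h3, eventually_gt_atTop 0] with x hx hx0
      have e : -(1 / 4) - 1 / x ^ 2 = a + -(1 / x) / x := by rw [h1]; field_simp; ring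
      rw [e, ← sub_le_iff_le_add', le_div_iff₀ hx0]
      linarith
    · have h5 := h4 h3
      refine ⟨(1 / 16 - c) / 2, by linarith, ?_⟩
      filter_upwards [h.tendsto_one.2.eventually_lt_const (show c < -((1 / 16 - c) / 2) by linarith),
        eventually_gt_atTop 0] with x hx hx0
      rw [h3, zero_div, add_zero, h1] at hx
      have e : (1 / 16 - c) / 2 / x ^ 2 * x ^ 2 = (1 / 16 - c) / 2 := by field_simp
      have hx2 : 0 < x ^ 2 := by positivity
      by_contra! h6
      have := mul_lt_mul_of_pos_right h6 hx2
      linarith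

theorem HasExpansion.ge_of_lexGe (h : HasExpansion R a b c) (hlex : LexGe a b c) :
    ∃ K : ℝ, 0 < K ∧
      ∀ᶠ x : ℝ in atTop, -(1 / 4) - 1 / (16 * x ^ 2) - K / x ^ 3 ≤ value R x := by
  have hsuff : (∀ᶠ x : ℝ in atTop, -(1 / 4) ≤ value R x) → ∃ K : ℝ, 0 < K ∧
      ∀ᶠ x : ℝ in atTop, -(1 / 4) - 1 / (16 * x ^ 2) - K / x ^ 3 ≤ value R x := by
    intro h1
    refine ⟨1, one_pos, ?_⟩
    filter_upwards [h1, eventually_gt_atTop 0] with x hx hx0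
    have : 0 < 1 / (16 * x ^ 2) := by positivity
    have : 0 < 1 / x ^ 3 := by positivity
    linarith
  rcases hlex with h1 | ⟨h1, h2 | ⟨h2, h3⟩⟩
  · exact hsuff ((h.tendsto.eventually_const_lt h1).mono fun x hx => hx.le)
  · refine hsuff ?_
    filter_upwards [h.tendsto_one.1.eventually_const_lt h2, eventually_gt_atTop 0] with x hx hx0
    have := pos_of_mul_pos_right hx hx0.le
    linarith
  · obtain ⟨K, hK, hb⟩ := h.exists_bound
    refine ⟨K, hK, ?_⟩
    filter_upwards [hb, eventually_gt_atTop 0] with x hx hx0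
    have h4 := (abs_le.1 hx).1
    rw [h1, h2, zero_div, add_zero] at h4
    have h5 : -(1 / (16 * x ^ 2)) ≤ c / x ^ 2 := by
      have e : -(1 / (16 * x ^ 2)) = -(1 / 16) / x ^ 2 := by field_simp
      rw [e]
      gcongr
    linarith

end Expansion

/-! ### The types and positivity along arithmetic progressions -/

section Types

variable {P Q : RatFunc ℝ}

theorem IsLoxodromic.gapPos (h : IsLoxodromic P Q) (N : ℕ) :
    GapPos (natValue P) (natValue Q) 2 N := by
  have h' : P ≠ 0 ∧ UltPos (normRatio P Q) := by
    rcases h with h | h <;> exact ⟨h.1, h.2.2.1⟩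
  exact (gapPos_iff_normRatio h'.1 Q even_two (by norm_num) N).2 (gapPos_of_pos h'.2 (by norm_num) N)

theorem IsHyperbolic.gapPos (h : IsHyperbolic P Q) (N : ℕ) :
    GapPos (natValue P) (natValue Q) 2 N := by
  obtain ⟨hP, -, -, -, a, b, c, hexp, hlex⟩ := h
  obtain ⟨K, hK, hge⟩ := hexp.ge_of_lexGe hlex
  exact (gapPos_iff_normRatio hP Q even_two (by norm_num) N).2
    (gapPos_of_ge hK (eventually_nat hge) (by norm_num) N)

/-- If the ratio is negative of degree at least `3`, some solution is eventually positive along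
`4 ℕ + N`. -/
theorem gapPos_of_two_lt_intDegree {R : RatFunc ℝ} (hR : UltNeg R) (hd : 2 < R.intDegree) (N : ℕ) :
    GapPos (fun _ => 1) (natValue R) 4 N := by
  have hneg := ultNeg_iff.1 hR
  have hR0 : R ≠ 0 := by rintro rfl; simp at hd
  obtain ⟨m, hm⟩ := Int.eq_ofNat_of_zero_le (show 0 ≤ R.intDegree by omega)
  obtain ⟨c, hc, hlim⟩ := exists_tendsto_value_div_zpow hR0
  simp only [hm, zpow_natCast] at hlim
  have hc' : c < 0 := by
    refine lt_of_le_of_ne (le_of_tendsto hlim ?_) hc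
    filter_upwards [hneg, eventually_gt_atTop 0] with x h1 h2
    exact div_nonpos_of_nonpos_of_nonneg h1.le (by positivity)
  have hpow : ∀ k : ℕ, ∀ᶠ x : ℝ in atTop, value (RatFunc.X ^ k) x = x ^ k := by
    intro k
    induction k with
    | zero => simp
    | succ k ih =>
      filter_upwards [ih, value_mul_eventually (RatFunc.X ^ k) RatFunc.X] with x h1 h2
      rw [pow_succ, h2, h1, value_X, pow_succ]
  have hS : ∀ᶠ x : ℝ in atTop, value (R / RatFunc.X ^ m) x = value R x / x ^ m := by
    filter_upwards [hpow m, value_div_eventually R (RatFunc.X ^ m)] with x h1 h2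
    rw [h2, h1]
  have hSlim := hlim.congr' (hS.mono fun x hx => hx.symm)
  obtain ⟨a, S', hS', hexp⟩ := exists_expansion_step (intDegree_le_zero_of_tendsto hSlim)
  obtain ⟨l, hl⟩ := exists_tendsto_of_intDegree_le_zero hS'
  have hcast : Tendsto (fun n : ℕ => (n : ℝ)) atTop atTop := tendsto_natCast_atTop_atTop
  have hs1 : Tendsto (fun x : ℝ => x + 1) atTop atTop :=
    tendsto_atTop_add_const_right _ _ tendsto_id
  -- The quotient R / x^m equals c + O(1/x) with c ≠ 0, so its consecutive ratios are 1 + o(1/n).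
  -- The coefficient m of the ratio of R itself comes only from (1 + 1/n)^m.
  have hnear : NearOne (fun n : ℕ => value (R / RatFunc.X ^ m) (n + 1) / value (R / RatFunc.X ^ m) n) 0 := by
    have h1 := (((hl.comp hs1).sub ((hl.comp hs1).div_atTop hs1)).sub hl).div hSlim hc
    simp only [sub_zero, sub_self, zero_div] at h1
    refine (h1.comp hcast).congr' ?_
    have h2 := eventually_nat hexp
    have h3 := eventually_nat (hs1.eventually hexp)
    have h4 := eventually_nat (hSlim.eventually_ne hc)
    filter_upwards [h2, h3, h4, eventually_gt_atTop 0] with n h2 h3 h4 h5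
    have hn : (0 : ℝ) < n := by exact_mod_cast h5
    simp only [Function.comp, Pi.div_apply]
    rw [div_sub_one h4, mul_div_assoc', h3, h2]
    congr 1
    field_simp
    ring
  have hratio : NearOne (fun n : ℕ => -natValue R (n + 1) / -natValue R n) (m : ℝ) := by
    have h1 := (nearOne_rpow 1 m).mul hnear
    rw [one_mul, add_zero] at h1
    refine h1.congr ?_
    filter_upwards [eventually_nat hS, eventually_nat (hs1.eventually hS), eventually_gt_atTop 0,
      eventually_nat hneg] with n h2 h3 h4 h5
    have hn : (0 : ℝ) < n := by exact_mod_cast h4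
    have h6 := h5.ne
    rw [h2, h3, Real.rpow_natCast]
    have e : (1 + 1 / (n : ℝ)) ^ m = (n + 1) ^ m / n ^ m := by
      rw [← div_pow]; congr 1; field_simp
    rw [e, natValue, natValue]
    push_cast
    field_simp
  have := gapPos_of_rapid (R := fun n => -natValue R n) (d := m) (c := -c)
    (by have : (2 : ℤ) < m := by rw [← hm]; exact hd
        exact_mod_cast this) hratio (by linarith) ?_ N
  · simpa using this
  · refine ((hlim.comp hcast).neg).congr fun n => ?_
    simp only [Function.comp, Real.rpow_natCast, natValue]
    ring

theorem neg_one_div_four_cos_sq_lt {φ : ℝ} (hc : Real.cos φ ≠ 0) (hs : Real.sin φ ≠ 0) :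
    -(1 / (4 * Real.cos φ ^ 2)) < -(1 / 4) := by
  have h1 := Real.sin_sq_add_cos_sq φ
  have h2 : 0 < Real.sin φ ^ 2 := by positivity
  have h3 : 0 < Real.cos φ ^ 2 := by positivity
  rw [neg_lt_neg_iff]
  exact one_div_lt_one_div_of_lt (by positivity) (by linarith)

theorem cos_sin_pos {θ : ℝ} (h0 : 0 < θ) (h1 : θ < 1 / 2) :
    0 < Real.cos (θ * Real.pi) ∧ 0 < Real.sin (θ * Real.pi) := by
  have hpi := Real.pi_pos
  exact ⟨Real.cos_pos_of_mem_Ioo ⟨by nlinarith, by nlinarith⟩,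
    Real.sin_pos_of_pos_of_lt_pi (by positivity) (by nlinarith)⟩

theorem IsEllipticO.gapPos {k r : ℕ} (hr : 0 < r)
    (h : IsEllipticO P Q ((k : ℚ) / (r : ℚ))) (N : ℕ) :
    GapPos (natValue P) (natValue Q) (2 * r) N := by
  have hrQ : (r : ℚ) ≠ 0 := by positivity
  have hrR : (r : ℝ) ≠ 0 := by positivity
  rcases h with ⟨hpos, hP, -, -, -, -, hlt, a, c, hexp, -, ha⟩ | ⟨h2, hP, -, hneg, hd⟩
  · have hpos' : (0 : ℝ) < (((k : ℚ) / (r : ℚ) : ℚ) : ℝ) := by exact_mod_cast hpos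
    obtain ⟨hcos, hsin⟩ := cos_sin_pos hpos' hlt
    refine (gapPos_iff_normRatio hP Q (even_two_mul r) (by omega) N).2 ?_
    have e : ((2 * r : ℕ) : ℝ) * ((((k : ℚ) / (r : ℚ) : ℚ) : ℝ) * Real.pi) = k * (2 * Real.pi) := by
      push_cast
      field_simp
    refine gapPos_of_elliptic hcos.ne' hsin.ne' ha hr ?_ ?_ (fun i => ?_) N
    · rw [e, ← zero_add ((k : ℝ) * _), Real.sin_add_nat_mul_two_pi, Real.sin_zero]
    · rw [e, ← zero_add ((k : ℝ) * _), Real.cos_add_nat_mul_two_pi, Real.cos_zero]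
    · simpa using hexp.shift_isBigO i
  · have hk : r = 2 * k := by
      rw [div_eq_div_iff hrQ two_ne_zero] at h2
      have h3 : k * 2 = 1 * r := by exact_mod_cast h2
      omega
    refine (gapPos_iff_normRatio hP Q (even_two_mul r) (by omega) N).2 ?_
    have := (gapPos_of_two_lt_intDegree hneg hd N).mul (m := k) (by omega)
    rwa [show 4 * k = 2 * r by omega] at this

theorem IsEllipticOmega.not_gapPos (h : IsEllipticOmega P Q) {τ : ℕ} (hτ : 1 ≤ τ) (N : ℕ) :
    ¬ GapPos (natValue P) (natValue Q) τ N := by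
  intro hG
  have hP : P ≠ 0 := by
    rcases h with h | ⟨_, _, h, _⟩
    · exact h.1
    · exact h.1
  -- Doubling the gap keeps positivity and makes the gap even, as the gauge transformation requires.
  have hG2 := hG.mul (m := 2) (by norm_num)
  rw [gapPos_iff_normRatio hP Q (by simp) (by omega)] at hG2
  have hτ2 : 1 ≤ τ * 2 := by omega
  set R := normRatio P Q with hRdef
  rcases h with ⟨-, -, hneg, hd⟩ | ⟨θ, b, ⟨-, -, -, -, h0, hlt, a, c, hexp, hlex, ha⟩, hnot⟩
  · have hneg' := ultNeg_iff.1 hneg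
    have hR0 : R ≠ 0 := by
      intro h
      rw [← hRdef, h, RatFunc.intDegree_zero] at hd
      omega
    obtain ⟨c, hc, hlim⟩ := exists_tendsto_value_div_zpow hR0
    have hc' : c < 0 := by
      refine lt_of_le_of_ne (le_of_tendsto hlim ?_) hc
      filter_upwards [hneg', eventually_gt_atTop 0] with x h1 h2
      exact div_nonpos_of_nonpos_of_nonneg h1.le (by positivity)
    have hS : ∀ᶠ x : ℝ in atTop, value (-R / (RatFunc.X * RatFunc.X)) x = -value R x / x ^ 2 := by
      filter_upwards [value_div_eventually (-R) (RatFunc.X * RatFunc.X), value_neg_eventually R,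
        value_mul_eventually RatFunc.X RatFunc.X] with x h1 h2 h3
      rw [h1, h2, h3, value_X, sq]
    have hSlim : ∃ A, Tendsto (value (-R / (RatFunc.X * RatFunc.X))) atTop (𝓝 A) ∧
        (0 < A ∨ A = 0 ∧ Tendsto (fun x => x * (value (-R / (RatFunc.X * RatFunc.X)) x - A)) atTop
          (𝓝 (-c))) := by
      rcases hd with hd | hd
      · have h1 : Tendsto (fun x => x * value (-R / (RatFunc.X * RatFunc.X)) x) atTop (𝓝 (-c)) := by
          refine hlim.neg.congr' ?_
          filter_upwards [hS, eventually_gt_atTop 0] with x h1 h2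
          rw [h1, hd, zpow_one]
          field_simp
        refine ⟨0, ?_, Or.inr ⟨rfl, by simpa using h1⟩⟩
        refine (h1.div_atTop tendsto_id).congr' ?_
        filter_upwards [eventually_gt_atTop 0] with x h2
        simp only [id]
        field_simp
      · refine ⟨-c, hlim.neg.congr' ?_, Or.inl (by linarith)⟩
        filter_upwards [hS] with x h1
        rw [h1, hd, neg_div]
        norm_cast
    obtain ⟨A, hA, hA'⟩ := hSlim
    obtain ⟨a, b, e, l, T, hT, hexp⟩ := exists_expansion (intDegree_le_zero_of_tendsto hA)
    have hx1 : Tendsto (fun x : ℝ => x⁻¹) atTop (𝓝 0) := tendsto_inv_atTop_zero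
    have h1 : Tendsto (fun x => x * (value (-R / (RatFunc.X * RatFunc.X)) x - a)) atTop (𝓝 b) := by
      have := ((hx1.const_mul e).const_add b).add ((hT.mul hx1).mul hx1)
      simp only [mul_zero, add_zero] at this
      refine this.congr' ?_
      filter_upwards [hexp, eventually_gt_atTop 0] with x h1 h2
      rw [h1]
      field_simp
      ring
    have ha : a = A := by
      refine tendsto_nhds_unique ?_ hA
      have := (h1.mul hx1).const_add a
      rw [mul_zero, add_zero] at this
      refine this.congr' ?_
      filter_upwards [eventually_gt_atTop 0] with x h2
      field_simp
      ring
    have hab : 0 < a ∨ a = 0 ∧ 0 < b := by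
      rw [ha]
      refine hA'.imp_right fun h2 => ⟨h2.1, ?_⟩
      rw [ha] at h1
      have := tendsto_nhds_unique h1 h2.2
      linarith
    refine not_gapPos_of_linear_or_quadratic (R := fun x => -value R x) (e := e) ?_ hT hab hτ2 N
      (by simp only [neg_neg]; exact hG2)
    filter_upwards [hexp, hS, eventually_gt_atTop 0] with x h1 h2 h3
    rw [h1] at h2
    field_simp at h2 ⊢
    linarith
  · have hlim : Tendsto (natValue R) atTop (𝓝 a) := hexp.tendsto.comp tendsto_natCast_atTop_atTop
    rcases h0.eq_or_lt with rfl | h0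
    · obtain ⟨k, hk, hle⟩ := hexp.le_of_not_lexGe hlex
      rw [zero_mul, Real.cos_zero] at ha
      norm_num at ha
      exact not_gapPos_of_parabolic hk (by rwa [ha] at hlim) (eventually_nat hle) hτ2 N hG2
    obtain ⟨hcos, hsin⟩ := cos_sin_pos h0 hlt
    have hlt' : a < -(1 / 4) := ha ▸ neg_one_div_four_cos_sq_lt hcos.ne' hsin.ne'
    have hfib := fib_mul_sin hcos.ne' ha (τ * 2)
    by_cases hz : Real.sin ((τ * 2 : ℕ) * (θ * Real.pi)) = 0
    -- At a resonance θ is a positive rational number, so the definition of ℚ-Ω type leaves only a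
    -- nonzero 1/x coefficient.
    · have hb : b ≠ 0 := by
        intro hb
        refine hnot ⟨?_, hb⟩
        obtain ⟨j, hj⟩ := Real.sin_eq_zero_iff.1 hz
        have hτR : (0 : ℝ) < ((τ * 2 : ℕ) : ℝ) := by exact_mod_cast hτ2
        have h1 : θ = j / ((τ * 2 : ℕ) : ℝ) := by
          rw [eq_div_iff hτR.ne']
          have := Real.pi_pos.ne'
          have h2 : (j : ℝ) * Real.pi = (θ * ((τ * 2 : ℕ) : ℝ)) * Real.pi := by rw [hj]; ring
          exact (mul_right_cancel₀ this h2).symm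
        have h3 : θ = (((j : ℚ) / ((τ * 2 : ℕ) : ℚ) : ℚ) : ℝ) := by rw [h1]; push_cast; rfl
        refine ⟨_, ?_, h3⟩
        rw [h3] at h0
        exact_mod_cast h0
      have hF0 : fib a (τ * 2) = 0 := by
        rw [hz, mul_zero] at hfib
        simpa [hsin.ne', hcos.ne'] using hfib
      have hD := (differentiable_fib (τ * 2) a).hasDerivAt
      exact not_gapPos_of_drift hlt' hb (fun i => hexp.shift_isBigO i) hτ2 N hF0 hD
        (fib_deriv_ne_zero hcos.ne' ha hτ2 hz hF0 hD) hG2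
    · refine not_gapPos_of_fib_ne_zero hlim hlt' hτ2 N (fun hF0 => ?_) hG2
      rw [hF0, zero_mul, zero_mul] at hfib
      exact mul_ne_zero (mul_ne_zero two_ne_zero hcos.ne') hz hfib.symm

/-- The classification is exhaustive. -/
theorem type_cases (hP : P ≠ 0) (hQ : Q ≠ 0) :
    IsLoxodromic P Q ∨ IsHyperbolic P Q ∨
      (∃ k r : ℕ, 0 < r ∧ IsEllipticO P Q ((k : ℚ) / (r : ℚ))) ∨ IsEllipticOmega P Q := by
  have hR := normRatio_ne_zero hP hQ
  rcases natValue_pos_or_neg hR with hs | hs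
  · left
    rcases lt_or_ge 2 (normRatio P Q).intDegree with h | h
    · exact Or.inl ⟨hP, hQ, hs, h⟩
    · exact Or.inr ⟨hP, hQ, hs, h⟩
  right
  rcases lt_or_ge 2 (normRatio P Q).intDegree with h | h
  · right; left
    exact ⟨1, 2, by norm_num, Or.inr ⟨by norm_num, hP, hQ, hs, h⟩⟩
  rcases lt_or_ge 0 (normRatio P Q).intDegree with h0 | h0
  · right; right
    exact Or.inl ⟨hP, hQ, hs, by omega⟩
  obtain ⟨a, b, c, hexp⟩ := exists_hasExpansion h0
  by_cases hlex : LexGe a b c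
  · exact Or.inl ⟨hP, hQ, hs, h0, a, b, c, hexp, hlex⟩
  right
  have ha : a ≤ -(1 / 4) := by
    simp only [LexGe, not_or, not_lt] at hlex
    exact hlex.1
  have hpi := Real.pi_pos
  set θ : ℝ := Real.arccos (1 / (2 * √(-a))) / Real.pi with hθ
  have hsq : 1 / 2 ≤ √(-a) := Real.le_sqrt_of_sq_le (by linarith)
  have hpos : 0 < 1 / (2 * √(-a)) := by positivity
  have hle : 1 / (2 * √(-a)) ≤ 1 := by
    rw [div_le_one (by positivity)]
    linarith
  have hθpi : θ * Real.pi = Real.arccos (1 / (2 * √(-a))) := by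
    rw [hθ]; field_simp
  have hbd : IsBoundedElliptic P Q θ b := by
    refine ⟨hP, hQ, hs, h0, div_nonneg (Real.arccos_nonneg _) hpi.le, ?_, a, c, hexp, hlex, ?_⟩
    · rw [hθ, div_lt_iff₀ hpi]
      have := Real.arccos_lt_pi_div_two.2 hpos
      linarith
    · rw [hθpi, Real.cos_arccos (by linarith) hle]
      have h1 : √(-a) ^ 2 = -a := Real.sq_sqrt (by linarith)
      have h2 : a ≠ 0 := by linarith
      rw [div_pow, mul_pow, h1]
      field_simp
      norm_num
  by_cases hq : (∃ q : ℚ, 0 < q ∧ θ = (q : ℝ)) ∧ b = 0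
  · left
    obtain ⟨⟨q, hq0, hq⟩, hb⟩ := hq
    refine ⟨q.num.toNat, q.den, q.den_pos, ?_⟩
    have e : ((q.num.toNat : ℕ) : ℚ) / (q.den : ℚ) = q := by
      have h1 : ((q.num.toNat : ℕ) : ℤ) = q.num := Int.toNat_of_nonneg (Rat.num_nonneg.2 hq0.le)
      have h2 : ((q.num.toNat : ℕ) : ℚ) = q.num := by exact_mod_cast h1
      rw [h2, Rat.num_div_den]
    rw [e]
    left
    rw [← hq, ← hb]
    exact ⟨hq0, hbd⟩
  · exact Or.inr (Or.inr ⟨θ, b, hbd, hq⟩)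

theorem exists_gapPos_of_not_ellipticOmega (hP : P ≠ 0) (hQ : Q ≠ 0) (h : ¬ IsEllipticOmega P Q) :
    ∃ τ N : ℕ, 1 ≤ τ ∧ GapPos (natValue P) (natValue Q) τ N := by
  rcases type_cases hP hQ with h1 | h1 | ⟨k, r, hr, h1⟩ | h1
  · exact ⟨2, 0, by norm_num, h1.gapPos 0⟩
  · exact ⟨2, 0, by norm_num, h1.gapPos 0⟩
  · exact ⟨2 * r, 0, by omega, h1.gapPos hr 0⟩
  · exact absurd h1 h

/-- A recurrence with eventually negative last coefficient and an eventually positive solution is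
of hyperbolic type. -/
theorem isHyperbolic_of_pos_solution (hP : P ≠ 0) (hQ : Q ≠ 0)
    (hneg : ∀ᶠ n in atTop, natValue Q n < 0) {h : ℕ → ℝ}
    (hrec : ∀ᶠ n in atTop, h (n + 2) = natValue P n * h (n + 1) + natValue Q n * h n)
    (hpos : ∀ᶠ n in atTop, 0 < h n) : IsHyperbolic P Q := by
  -- A positive solution and Q < 0 rule out P < 0. Hence the gauge eventually has one sign on all
  -- integers, and the transformed solution stays positive everywhere.
  have hPpos : ∀ᶠ n in atTop, 0 < natValue P n := by
    refine (natValue_pos_or_neg hP).resolve_right fun hPneg => ?_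
    obtain ⟨n, h1, h2, h3, h4, h5, h6⟩ := (hPneg.and (hneg.and (hrec.and (hpos.and
      (((tendsto_add_atTop_nat 1).eventually hpos).and
        ((tendsto_add_atTop_nat 2).eventually hpos)))))).exists
    have := mul_neg_of_neg_of_pos h1 h5
    have := mul_neg_of_neg_of_pos h2 h4
    linarith
  have hs : UltNeg (normRatio P Q) := by
    filter_upwards [natValue_normRatio P Q, hneg, natValue_mul_pred_pos hP] with n h1 h2 h3
    change natValue (normRatio P Q) n < 0
    rw [h1]
    exact div_neg_of_neg_of_pos h2 h3
  have hno : ∀ k : ℝ, 1 / 16 < k →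
      ¬ ∀ᶠ x : ℝ in atTop, value (normRatio P Q) x ≤ -(1 / 4) - k / x ^ 2 := by
    intro k hk hle
    obtain ⟨w, hw0, hw1, -⟩ := exists_gauge _ (natValue_mul_pred_pos hP)
    have hw1' := (tendsto_add_atTop_nat 1).eventually hw1
    obtain ⟨n₀, hn₀⟩ := eventually_atTop.1
      (hw1.and ((tendsto_sub_atTop_nat 1).eventually hPpos))
    have hsign : ∀ n, n₀ ≤ n → 0 < w n₀ * w n := by
      intro n hn
      induction n, hn using Nat.le_induction with
      | base => exact mul_self_pos.2 (hw0 n₀)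
      | succ n hn ih =>
        obtain ⟨h1, h2⟩ := hn₀ n hn
        rw [h1]
        have := mul_pos h2 ih
        linarith
    refine no_pos_solution (ρ := natValue (normRatio P Q)) (g := fun n => w n₀ * h n / w n) hk
      (eventually_nat hle) ?_ ?_
    · filter_upwards [hrec, natValue_eq_normRatio_mul hP Q, hw1, hw1', natValue_mul_pred_pos hP]
        with n h2 h3 h4 h5 h6
      have h7 : natValue P n ≠ 0 := left_ne_zero_of_mul h6.ne'
      have h8 : natValue P (n - 1) ≠ 0 := right_ne_zero_of_mul h6.ne'
      have h9 := hw0 n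
      rw [Nat.add_sub_cancel] at h5
      rw [h2, h3, h5, h4]
      field_simp
    · filter_upwards [hpos, eventually_ge_atTop n₀] with n h1 h2
      have h3 := hsign n h2
      have h4 := hw0 n
      have e : w n₀ * h n / w n = w n₀ * w n * h n / (w n * w n) := by field_simp
      rw [e]
      exact div_pos (mul_pos h3 h1) (mul_self_pos.2 h4)
  have hd : (normRatio P Q).intDegree ≤ 0 := by
    by_contra! hd
    obtain ⟨c, hc, hlim⟩ := exists_tendsto_value_div_zpow (normRatio_ne_zero hP hQ)
    have hc' : c < 0 := by
      refine lt_of_le_of_ne (le_of_tendsto hlim ?_) hc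
      filter_upwards [ultNeg_iff.1 hs, eventually_gt_atTop 0] with x h1 h2
      exact div_nonpos_of_nonpos_of_nonneg h1.le (by positivity)
    refine hno 1 (by norm_num) ?_
    have hbot : Tendsto (value (normRatio P Q)) atTop atBot := by
      refine (hlim.neg_mul_atTop hc' (tendsto_zpow_atTop_atTop hd)).congr' ?_
      filter_upwards [eventually_gt_atTop 0] with x hx
      field_simp
    filter_upwards [hbot.eventually_le_atBot (-2), eventually_ge_atTop 1] with x h1 h2
    have : 1 / x ^ 2 ≤ 1 := by
      rw [div_le_one (by positivity)]
      nlinarith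
    linarith
  obtain ⟨a, b, c, hexp⟩ := exists_hasExpansion hd
  refine ⟨hP, hQ, hs, hd, a, b, c, hexp, ?_⟩
  by_contra hlex
  obtain ⟨k, hk, hle⟩ := hexp.le_of_not_lexGe hlex
  exact hno k hk hle

end Types

/-! ### Determinant identities -/

/-- Determinant of the τ-step transfer matrix, as the product of the one-step determinants. -/
theorem seqNum_mul_seqDen_succ (p q : ℕ → ℝ) (τ n : ℕ) :
    seqNum p q τ n * seqDen p q (τ + 1) n - seqDen p q τ n * seqNum p q (τ + 1) n =
      ∏ i ∈ Finset.range τ, -q (n + i) := by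
  induction τ with
  | zero => simp [seqNum, seqDen]
  | succ τ ih =>
    rw [Finset.prod_range_succ, ← ih]
    simp only [seqNum, seqDen]
    ring

/-- As functions of m, both sides solve the recurrence started at n + τ; they agree at m = 0
trivially and at m = 1 by the determinant formula. -/
theorem seqNum_mul_seqDen_sub (p q : ℕ → ℝ) (τ m n : ℕ) :
    seqNum p q (τ + m) n * seqDen p q τ n - seqDen p q (τ + m) n * seqNum p q τ n =
      -((∏ i ∈ Finset.range τ, -q (n + i)) * seqDen p q m (n + τ)) := by
  induction m using Nat.twoStepInduction with
  | zero => simp [seqDen]; ring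
  | one =>
    rw [← seqNum_mul_seqDen_succ p q τ n]
    simp only [seqDen]
    ring
  | more m ih0 ih1 =>
    have h1 : seqNum p q (τ + (m + 2)) n = p (n + τ + m) * seqNum p q (τ + (m + 1)) n +
        q (n + τ + m) * seqNum p q (τ + m) n := by rw [add_assoc n]; rfl
    have h2 : seqDen p q (τ + (m + 2)) n = p (n + τ + m) * seqDen p q (τ + (m + 1)) n +
        q (n + τ + m) * seqDen p q (τ + m) n := by rw [add_assoc n]; rfl
    rw [h1, h2, seqDen]
    linear_combination p (n + τ + m) * ih1 + q (n + τ + m) * ih0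

/-- The square in the denominator displays the sign: B^(τ)(n+τ) B^(τ)(n) is eventually positive for
a nonzero rational function, so the product of the -q decides. -/
theorem seqGapQ_eq {p q : ℕ → ℝ} {τ n : ℕ} (h : seqDen p q τ n ≠ 0) :
    seqGapQ p q τ n =
      -((∏ i ∈ Finset.range τ, -q (n + i)) * (seqDen p q τ (n + τ) * seqDen p q τ n)) /
        (seqDen p q τ n * seqDen p q τ n) := by
  have := seqNum_mul_seqDen_sub p q τ τ n
  rw [← two_mul] at this
  rw [seqGapQ, eq_div_iff (mul_ne_zero h h)]
  field_simp
  linear_combination this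

/-! ### The gap-τ pair of rational functions. -/

section Gap

variable {P Q : RatFunc ℝ} {τ : ℕ}

theorem eventually_prod_ne_zero (hQ : Q ≠ 0) (τ : ℕ) :
    ∀ᶠ n in atTop, ∏ i ∈ Finset.range τ, -natValue Q (n + i) ≠ 0 := by
  obtain ⟨n₀, h⟩ := eventually_atTop.1 (natValue_ne_zero hQ)
  filter_upwards [eventually_ge_atTop n₀] with n hn
  exact Finset.prod_ne_zero_iff.2 fun i _ => neg_ne_zero.2 (h _ (by omega))

theorem eventually_prod_pos (hQ : Q ≠ 0) (hτ : Even τ) :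
    ∀ᶠ n in atTop, 0 < ∏ i ∈ Finset.range τ, -natValue Q (n + i) := by
  rcases natValue_pos_or_neg hQ with h | h
  · obtain ⟨n₀, h⟩ := eventually_atTop.1 h
    filter_upwards [eventually_ge_atTop n₀] with n hn
    rw [Finset.prod_neg, Finset.card_range, hτ.neg_one_pow, one_mul]
    exact Finset.prod_pos fun i _ => h _ (by omega)
  · obtain ⟨n₀, h⟩ := eventually_atTop.1 h
    filter_upwards [eventually_ge_atTop n₀] with n hn
    exact Finset.prod_pos fun i _ => neg_pos.2 (h _ (by omega))

theorem eventually_seqDen_ne_zero (hB : canonDen P Q τ ≠ 0) :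
    ∀ᶠ n in atTop, seqDen (natValue P) (natValue Q) τ n ≠ 0 := by
  filter_upwards [natValue_canon P Q τ, natValue_ne_zero hB] with n h1 h2
  rwa [← h1.1]

theorem natValue_gapQ_eq (hB : canonDen P Q τ ≠ 0) :
    ∀ᶠ n in atTop, 0 < natValue (canonDen P Q τ) (n + τ) * natValue (canonDen P Q τ) n ∧
      natValue (canonDen P Q τ) n ≠ 0 ∧ natValue (gapQ P Q τ) n =
      -((∏ i ∈ Finset.range τ, -natValue Q (n + i)) *
        (natValue (canonDen P Q τ) (n + τ) * natValue (canonDen P Q τ) n)) /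
          (natValue (canonDen P Q τ) n * natValue (canonDen P Q τ) n) := by
  filter_upwards [natValue_gap P Q τ, natValue_canon P Q τ,
    (tendsto_add_atTop_nat τ).eventually (natValue_canon P Q τ), natValue_mul_pos hB τ,
    natValue_ne_zero hB] with n h1 h2 h3 h4 h5
  refine ⟨h4, h5, ?_⟩
  rw [h2.1] at h5
  rw [h1.2, seqGapQ_eq h5, ← h2.1, ← h3.1]

theorem gapQ_ne_zero (hQ : Q ≠ 0) (hB : canonDen P Q τ ≠ 0) : gapQ P Q τ ≠ 0 := by
  intro h
  obtain ⟨n, ⟨h1, h2, h3⟩, h4⟩ := ((natValue_gapQ_eq hB).and (eventually_prod_ne_zero hQ τ)).exists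
  rw [h, natValue, value_zero] at h3
  exact div_ne_zero (neg_ne_zero.2 (mul_ne_zero h4 h1.ne')) (mul_ne_zero h2 h2) h3.symm

theorem natValue_gapQ_neg (hQ : Q ≠ 0) (hB : canonDen P Q τ ≠ 0) (hτ : Even τ) :
    ∀ᶠ n in atTop, natValue (gapQ P Q τ) n < 0 := by
  filter_upwards [natValue_gapQ_eq hB, eventually_prod_pos hQ hτ] with n h1 h2
  rw [h1.2.2]
  exact div_neg_of_neg_of_pos (neg_neg_of_pos (mul_pos h2 h1.1)) (mul_self_pos.2 h1.2.1)

theorem natValue_substLin_gap (hτ : 1 ≤ τ) (N : ℕ) :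
    (∀ᶠ n in atTop, natValue (substLin τ N (gapP P Q τ)) n =
      seqGapP (natValue P) (natValue Q) τ (τ * n + N)) ∧
    (∀ᶠ n in atTop, natValue (substLin τ N (gapQ P Q τ)) n =
      seqGapQ (natValue P) (natValue Q) τ (τ * n + N)) := by
  have h := (tendsto_gap hτ N).eventually (natValue_gap P Q τ)
  constructor
  · filter_upwards [h, natValue_substLin hτ N (gapP P Q τ)] with n h1 h2
    rw [h2, h1.1]
  · filter_upwards [h, natValue_substLin hτ N (gapQ P Q τ)] with n h1 h2
    rw [h2, h1.2]

theorem isHyperbolic_gap (hQ : Q ≠ 0) (hτ : 1 ≤ τ) (heven : Even τ)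
    (hB : canonDen P Q τ ≠ 0) (hP' : gapP P Q τ ≠ 0) {N : ℕ}
    (hG : GapPos (natValue P) (natValue Q) τ N) :
    IsHyperbolic (substLin τ N (gapP P Q τ)) (substLin τ N (gapQ P Q τ)) := by
  obtain ⟨f, hf, hpos⟩ := hG
  have hneg : ∀ᶠ n in atTop, natValue (substLin τ N (gapQ P Q τ)) n < 0 := by
    filter_upwards [natValue_substLin hτ N (gapQ P Q τ),
      (tendsto_gap hτ N).eventually (natValue_gapQ_neg hQ hB heven)] with n h1 h2
    rwa [h1]
  refine isHyperbolic_of_pos_solution (substLin_ne_zero hτ N hP')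
    (substLin_ne_zero hτ N (gapQ_ne_zero hQ hB)) hneg (h := fun n => f (τ * n + N)) ?_ hpos
  filter_upwards [eventually_gap_recurrence hτ N hf (eventually_seqDen_ne_zero hB),
    (natValue_substLin_gap hτ N).1, (natValue_substLin_gap hτ N).2] with n h1 h2 h3
  rw [h1, h2, h3]

theorem IsEllipticOmega.ne_zero (h : IsEllipticOmega P Q) : P ≠ 0 ∧ Q ≠ 0 := by
  rcases h with h | ⟨_, _, h, _⟩ <;> exact ⟨h.1, h.2.1⟩

/-- If B^(τ) = 0, then f(n+τ) = A^(τ)(n) f(n) for large n, with A^(τ) ≠ 0 by the determinant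
formula. As A^(τ) has constant sign, f(n+2τ) and f(n) agree in sign, so a solution is positive along
a progression with gap 2τ. -/
theorem IsEllipticOmega.canonDen_ne_zero (h : IsEllipticOmega P Q) (hτ : 1 ≤ τ) :
    canonDen P Q τ ≠ 0 := by
  intro hB
  have hden : ∀ᶠ n in atTop, seqDen (natValue P) (natValue Q) τ n = 0 := by
    filter_upwards [natValue_canon P Q τ] with n h1
    rw [← h1.1, hB, natValue, value_zero]
  have hA : canonNum P Q τ ≠ 0 := by
    intro hA
    obtain ⟨n, h1, h2, h3⟩ := (hden.and ((natValue_canon P Q τ).and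
      (eventually_prod_ne_zero h.ne_zero.2 τ))).exists
    refine h3 ?_
    rw [← seqNum_mul_seqDen_succ (natValue P), h1, ← h2.2, hA, natValue, value_zero]
    ring
  obtain ⟨n₀, hn₀⟩ := eventually_atTop.1 (hden.and ((natValue_canon P Q τ).and
    (natValue_mul_pos hA τ)))
  obtain ⟨f, ha, -, hf⟩ := exists_solution (natValue P) (natValue Q) n₀ 1 0
  refine h.not_gapPos (τ := 2 * τ) (by omega) n₀
    ⟨f, eventually_atTop.2 ⟨n₀, hf⟩, .of_forall fun n => ?_⟩
  induction n with
  | zero => simp [ha]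
  | succ n ih =>
    have hstep : ∀ m, n₀ ≤ m → f (m + τ) = natValue (canonNum P Q τ) m * f m := by
      intro m hm
      obtain ⟨h1, h2, -⟩ := hn₀ m hm
      rw [gap_formula hf τ hm, h1, h2.2]
      ring
    rw [show 2 * τ * (n + 1) + n₀ = 2 * τ * n + n₀ + τ + τ by ring, hstep _ (by omega),
      hstep _ (by omega), ← mul_assoc]
    exact mul_pos (hn₀ _ (by omega)).2.2 ih

theorem IsEllipticOmega.gap (h : IsEllipticOmega P Q) (hτ : 1 ≤ τ) (N : ℕ) :
    IsEllipticOmega (substLin τ N (gapP P Q τ)) (substLin τ N (gapQ P Q τ)) := by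
  have hB := h.canonDen_ne_zero hτ
  have hP' : gapP P Q τ ≠ 0 := div_ne_zero (h.canonDen_ne_zero (by omega)) hB
  by_contra hne
  obtain ⟨m, N', hm, hG⟩ := exists_gapPos_of_not_ellipticOmega (substLin_ne_zero hτ N hP')
    (substLin_ne_zero hτ N (gapQ_ne_zero h.ne_zero.2 hB)) hne
  have hG' := hG.congr (natValue_substLin_gap hτ N).1 (natValue_substLin_gap hτ N).2
  exact h.not_gapPos (Nat.mul_pos hτ hm) _ (hG'.of_gap hτ hm (eventually_seqDen_ne_zero hB))

end Gap

end SecondOrderHolonomic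

/-! ### The corollary. -/

open SecondOrderHolonomic in
theorem mainTheorem9 (P Q : RatFunc ℝ)
    (hP0 : NoZeroInNat P) (hP : NoPoleInNat P) (hQ0 : NoZeroInNat Q) (hQ : NoPoleInNat Q) :
    (∀ τ : ℕ,
      ((IsLoxodromic P Q ∧ τ = 2) ∨
        (∃ k r : ℕ, 0 < k ∧ 0 < r ∧ Nat.Coprime k r ∧
          IsEllipticO P Q ((k : ℚ) / (r : ℚ)) ∧ τ = 2 * r)) →
      canonDen P Q τ ≠ 0 → canonDen P Q (2 * τ) ≠ 0 →
        gapP P Q τ ≠ 0 ∧ gapQ P Q τ ≠ 0 ∧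
          ∀ N : ℕ, IsHyperbolic (substLin τ N (gapP P Q τ)) (substLin τ N (gapQ P Q τ))) ∧
    (IsEllipticOmega P Q →
      ∀ τ : ℕ, 1 ≤ τ →
        canonDen P Q τ ≠ 0 ∧ gapP P Q τ ≠ 0 ∧ gapQ P Q τ ≠ 0 ∧
          ∀ N : ℕ, IsEllipticOmega (substLin τ N (gapP P Q τ)) (substLin τ N (gapQ P Q τ))) := by
  have hQne : Q ≠ 0 := by
    rintro rfl
    exact hQ0 0 (by simp)
  refine ⟨fun τ htype hB hB2 => ?_, fun h τ hτ => ?_⟩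
  · have hG : 1 ≤ τ ∧ Even τ ∧ ∀ N, GapPos (natValue P) (natValue Q) τ N := by
      rcases htype with ⟨h, rfl⟩ | ⟨k, r, -, hr, -, h, rfl⟩
      · exact ⟨by norm_num, even_two, h.gapPos⟩
      · exact ⟨by omega, even_two_mul r, h.gapPos hr⟩
    have hP' : gapP P Q τ ≠ 0 := div_ne_zero hB2 hB
    exact ⟨hP', gapQ_ne_zero hQne hB, fun N => isHyperbolic_gap hQne hG.1 hG.2.1 hB hP' (hG.2.2 N)⟩
  · have hB := h.canonDen_ne_zero hτ
    exact ⟨hB, div_ne_zero (h.canonDen_ne_zero (by omega)) hB, gapQ_ne_zero hQne hB, h.gap hτ⟩
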